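/- **Setting.** Let $d\ge 1$, $m\ge 0$ be integers and let $s$ be real with either $\max\{d-2,0\}<s<d$, or $d=1$ and $s=0$. Points of $\mathbb R^{d+m}$ are written $X=(x,z)$, $x\in\mathbb R^d$, $z\in\mathbb R^m$. Let $\mathsf g:\mathbb R^d\to\mathbb R$ and $\mathsf G:\mathbb R^{d+m}\to\mathbb R$ (the values at $0$ play no role) with $\mathsf G$ smooth on $\mathbb R^{d+m}\setminus\{0\}$, and suppose that there are $r_0>0$ and constants $A_0,A_1,\dots$, $B$, $C_1>0$, $C_2$, $c$ such that 1. $\mathsf G(x,0)=\mathsf g(x)$ for $x\ne 0$; $\mathsf G(X)=\mathsf G(-X)$ for $X\neq 0$; $\lim_{X\to 0}\mathsf G(X)=+\infty$; 2. $\Delta \mathsf G\le 0$ in $B(0,r_0)\subset\mathbb R^{d+m}$ in the sense of distributions; 3. for every $k\ge 0$ and $X\ne 0$, $|\nabla^{\otimes k}\mathsf G(X)|\le A_k\big(|X|^{-s-k}+|\log|X||\,\mathbf 1_{s=k=0\wedge d=1}\big)$; 4. $|X||\nabla \mathsf G(X)|+|X|^2|\nabla^{\otimes 2}\mathsf G(X)|\le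 B\,\mathsf G(X)$ for $X\in B(0,r_0)\setminus\{0\}$; 5. away from the origin the Fourier transform of the tempered distribution $\mathsf G$ is a function $\hat{\mathsf G}$ with $C_1|\Xi|^{-(d+m-s)}\le\hat{\mathsf G}(\Xi)\le C_2|\Xi|^{-(d+m-s)}$ for all $\Xi\neq 0$; 6. for all $X,Y\in B(0,r_0)\setminus\{0\}$ with $|Y|\ge 2|X|$: if $s>0$, then $c<1$ and $\mathsf G(Y)<c\,\mathsf G(X)$; if $s=0$, then $c>0$ and $\mathsf G(X)-\mathsf G(Y)\ge c$. For $X\in\mathbb R^{d+m}$ and $\eta>0$ let $\delta_X^{(\eta)}$ be the uniform probability measure on the sphere $\partial B(X,\eta)\subset\mathbb R^{d+m}$, and let $\mathsf G_\eta:=\mathsf G*\delta_0^{(\eta)}$. For $\underline x_N=(x_1,\dots,x_N)\in(\mathbb R^d)^N$ and a probability measure $\mu$ on $\mathbb R^d$ let $$F_N(\underline x_N,\mu):=\int_{\{(x,y)\in(\mathbb R^d)^2:\,x\ne y\}}\mathsf g(x-y)\,d\Big(\frac1N\sum_{i=1}^N\delta_{x_i}-\mu\Big)^{\otimes 2}(x,y),$$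 let $X_i:=(x_i,0)$, and let $\tilde\mu:=\mu\otimes\delta_0$ be the image of $\mu$ under $x\mapsto(x,0)$, i.e. $\tilde\mu(X)=\mu(x)\delta_{\mathbb R^d\times\{0\}}(X)$. Finally $\|f\|^2_{\dot H^{\sigma}(\mathbb R^{d+m})}:=\int_{\mathbb R^{d+m}}|\Xi|^{2\sigma}|\hat f(\Xi)|^2\,d\Xi$, where $\hat f(\Xi)=\int e^{-2\pi i X\cdot\Xi}\,df(X)$. **Proposition.** There is a constant $C>0$, depending only on $d,m,s$ and on the constants $r_0,(A_k)_{k\ge0},B,C_1,C_2,c$ above (and not otherwise on $\mathsf g,\mathsf G$), such that the following holds for every $N\ge 1$, every pairwise distinct configuration $\underline x_N\in(\mathbb R^d)^N$, every probability measure $\mu$ on $\mathbb R^d$ with a bounded density (and with $\int_{\mathbb R^d}\log(1+|x|)\,d\mu(x)<\infty$ if $s=0$), and all $\eta_1,\dots,\eta_N$ with $0<\eta_i<\min\{\frac12,\frac12 r_0\}$. The integrals defining $F_N(\underline x_N,\mu)$ and $\mathsf G_{\eta_i}$ converge absolutely, the $\dot H$ norm below is finite, and $$\frac1{N^2}\sum_{\substack{1\le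 i\ne j\le N\\|x_i-x_j|\le\frac12 r_0}}\big(\mathsf g(x_j-x_i)-\mathsf G_{\eta_i}(x_j-x_i,0)\big)_+ + C^{-1}\Big\|\frac1N\sum_{i=1}^N\delta_{X_i}^{(\eta_i)}-\tilde\mu\Big\|^2_{\dot H^{\frac{s-d-m}2}(\mathbb R^{d+m})}$$ $$\le F_N(\underline x_N,\mu)+\frac1{N^2}\sum_{i=1}^N\mathsf G_{\eta_i}(0)+\frac CN\sum_{i=1}^N\Big(\|\mu\|_{L^\infty}\big(\eta_i^{d-s}+\eta_i^d|\log\eta_i|\,\mathbf 1_{s=0}\big)+\eta_i^2\Big).$$ -/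

import Mathlib

open MeasureTheory
open scoped ENNReal SchwartzMap FourierTransform Topology

noncomputable section

/-- The space `ℝ^d`. -/
abbrev Space (d : ℕ) : Type := EuclideanSpace ℝ (Fin d)

/-- The extended space `ℝ^{d+m}`, with points `X = (x, z)`, `x ∈ ℝ^d`, `z ∈ ℝ^m`. -/
abbrev ExtSpace (d m : ℕ) : Type := EuclideanSpace ℝ (Fin d ⊕ Fin m)

/-- The embedding `x ↦ (x, 0)` of `ℝ^d` into `ℝ^{d+m}`. -/
def embedZero (d m : ℕ) (x : Space d) : ExtSpace d m :=
  WithLp.toLp 2 (Sum.elim (fun i => x i) (fun _ => 0))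

section General

variable {E : Type*} [NormedAddCommGroup E] [InnerProductSpace ℝ E] [FiniteDimensional ℝ E]
  [MeasurableSpace E] [BorelSpace E]

/-- The uniform probability measure `δ_X^{(η)}` on the sphere `∂B(X, η)`: the normalized surface
measure of the unit sphere, transported by `ω ↦ X + η ω`. -/
def sphereMeasure (X : E) (η : ℝ) : Measure E :=
  (((volume : Measure E).toSphere Set.univ)⁻¹ • (volume : Measure E).toSphere).map
    (fun ω : Metric.sphere (0 : E) 1 => X + η • (ω : E))

/-- The smeared potential `G_η = G ∗ δ_0^{(η)}`. -/
def smeared (G : E → ℝ) (η : ℝ) (X : E) : ℝ :=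
  ∫ Y, G (X - Y) ∂(sphereMeasure (0 : E) η)

/-- `Δ G ≤ 0` on the open set `U` in the sense of distributions. -/
def SuperharmonicOn (G : E → ℝ) (U : Set E) : Prop :=
  ∀ φ : E → ℝ, ContDiff ℝ (⊤ : ℕ∞) φ → HasCompactSupport φ → tsupport φ ⊆ U → (∀ X, 0 ≤ φ X) →
    ∫ X, G X * Laplacian.laplacian φ X ≤ 0

/-- Away from the origin, the Fourier transform of the tempered distribution `G` is the
function `h`, i.e. `⟨G, 𝓕 φ⟩ = ⟨h, φ⟩` for every Schwartz function `φ` whose support does not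
contain the origin. -/
def FourierTransformAwayFromZero (G h : E → ℝ) : Prop :=
  ∀ φ : 𝓢(E, ℂ), (0 : E) ∉ tsupport φ →
    ∫ X, (G X : ℂ) * (𝓕 φ) X = ∫ Ξ, (h Ξ : ℂ) * φ Ξ

/-- The squared homogeneous Sobolev norm `‖α - β‖²` in `Ḣ^σ`, that is
`∫ |Ξ|^{2σ} |(α - β)^(Ξ)|² dΞ`, for finite measures `α`, `β`. The Fourier transform of `α` at `Ξ`,
`∫ e^{-2πi⟨X, Ξ⟩} dα(X)`, is the characteristic function of `α` at `-2π Ξ`. -/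
def sobolevNormSq (σ : ℝ) (α β : Measure E) : ℝ≥0∞ :=
  ∫⁻ Ξ : E, ENNReal.ofReal (‖Ξ‖ ^ (2 * σ) *
    ‖charFun α (-(2 * Real.pi) • Ξ) - charFun β (-(2 * Real.pi) • Ξ)‖ ^ 2)

/-- The complement of the diagonal in `E × E`. -/
def offDiagonal (E : Type*) : Set (E × E) := {p | p.1 ≠ p.2}

/-- The integral of `g (x - y)` off the diagonal against the tensor square of the signed measure
`α - β`, whose positive terms are `α ⊗ α + β ⊗ β` and negative terms `α ⊗ β + β ⊗ α`. -/
def offDiagonalEnergy (g : E → ℝ) (α β : Measure E) : ℝ :=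
  (∫ p in offDiagonal E, g (p.1 - p.2) ∂(α.prod α + β.prod β)) -
    ∫ p in offDiagonal E, g (p.1 - p.2) ∂(α.prod β + β.prod α)

/-- Absolute convergence of all the integrals in `offDiagonalEnergy g α β`. -/
def OffDiagonalIntegrable (g : E → ℝ) (α β : Measure E) : Prop :=
  IntegrableOn (fun p : E × E => g (p.1 - p.2)) (offDiagonal E) ((α + β).prod (α + β))

/-- The average `(1/N) ∑ ν_i` of `N` measures. -/
def averageMeasure {N : ℕ} (ν : Fin N → Measure E) : Measure E :=
  (N : ℝ≥0∞)⁻¹ • ∑ i, ν i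

/-- The empirical measure `(1/N) ∑ δ_{x_i}`. -/
def empiricalMeasure {N : ℕ} (x : Fin N → E) : Measure E :=
  averageMeasure fun i => Measure.dirac (x i)

/-- The modulated energy `F_N(x, μ)`. -/
def modulatedEnergy (g : E → ℝ) {N : ℕ} (x : Fin N → E) (μ : Measure E) : ℝ :=
  offDiagonalEnergy g (empiricalMeasure x) μ

/-- The `L^∞` norm of the Lebesgue density of `μ` (for `μ ≪ volume`). -/
def densitySup (μ : Measure E) : ℝ≥0∞ :=
  essSup (μ.rnDeriv volume) volume

end General

/-- The assumptions on the potential `g` on `ℝ^d` and its extension `G` to `ℝ^{d+m}`, with all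
their constants made explicit: the radius `r₀`, the constants `A k` of the pointwise bounds on
the `k`-th derivatives, the constant `B` of the bounds relative to `G`, the constants `C₁`, `C₂` of
the Fourier bounds, and the constant `c` of the doubling condition (called `c_s` if `s > 0`, and
`c_0` if `s = 0`). -/
structure ExtAdmissible (d m : ℕ) (s r₀ : ℝ) (A : ℕ → ℝ) (B C₁ C₂ c : ℝ)
    (g : Space d → ℝ) (G : ExtSpace d m → ℝ) : Prop where
  r₀_pos : 0 < r₀
  C₁_pos : 0 < C₁
  restrict : ∀ x : Space d, x ≠ 0 → G (embedZero d m x) = g x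
  even : ∀ X : ExtSpace d m, X ≠ 0 → G X = G (-X)
  tendsto_zero : Filter.Tendsto G (𝓝[≠] 0) Filter.atTop
  superharmonic : SuperharmonicOn G (Metric.ball 0 r₀)
  smooth : ContDiffOn ℝ (⊤ : ℕ∞) G {0}ᶜ
  deriv_bound : ∀ (k : ℕ) (X : ExtSpace d m), X ≠ 0 →
    ‖iteratedFDeriv ℝ k G X‖ ≤
      A k * (1 / ‖X‖ ^ (s + k) + if s = 0 ∧ k = 0 ∧ d = 1 then |Real.log ‖X‖| else 0)
  deriv_bound_local : ∀ X ∈ Metric.ball (0 : ExtSpace d m) r₀, X ≠ 0 →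
    ‖X‖ * ‖iteratedFDeriv ℝ 1 G X‖ + ‖X‖ ^ 2 * ‖iteratedFDeriv ℝ 2 G X‖ ≤ B * G X
  fourier_bound : ∃ h : ExtSpace d m → ℝ, Measurable h ∧ FourierTransformAwayFromZero G h ∧
    ∀ Ξ : ExtSpace d m, Ξ ≠ 0 →
      C₁ / ‖Ξ‖ ^ ((d : ℝ) + m - s) ≤ h Ξ ∧ h Ξ ≤ C₂ / ‖Ξ‖ ^ ((d : ℝ) + m - s)
  doubling_pos : 0 < s → c < 1 ∧ ∀ X ∈ Metric.ball (0 : ExtSpace d m) r₀, X ≠ 0 →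
    ∀ Y ∈ Metric.ball (0 : ExtSpace d m) r₀, Y ≠ 0 → 2 * ‖X‖ ≤ ‖Y‖ → G Y < c * G X
  doubling_zero : s = 0 → 0 < c ∧ ∀ X ∈ Metric.ball (0 : ExtSpace d m) r₀, X ≠ 0 →
    ∀ Y ∈ Metric.ball (0 : ExtSpace d m) r₀, Y ≠ 0 → 2 * ‖X‖ ≤ ‖Y‖ → c ≤ G X - G Y

end

/-! Let Q_ij be the G-interaction of the spheres of radii η_i and η_j about X_i and X_j. The energy
of the smeared charges, E = N⁻² ∑_{i,j} Q_ij - (2/N) ∑_i ∫ G_{η_i}(x_i - y, 0) dμ(y) + ∬ g(x - y) dμ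
dμ, differs from F_N in three places only: the pair terms g(x_i - x_j) - Q_ij, the diagonal terms
Q_ii, which F_N does not contain, and the cross terms ∫ (g(x_i - y) - G_{η_i}(x_i - y, 0)) dμ(y).
The self-interaction of μ is common to both. So it suffices to show that E controls C₁ times the
Sobolev norm, and to bound the three differences from the correct side.

Pairs (`exists_pair_bound`). The distributional inequality Δ G ≤ 0 becomes a pointwise mean value
inequality on spheres, valid even for spheres through the singularity
(`SuperharmonicOn.lintegral_sphere_le`). Applied once per sphere, it gives Q ≤ G_η' ≤ g for close
pairs, so that g - Q dominates the positive part in the claim; on the diagonal it gives Q_ii ≤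
G_{η_i}(0). For distant pairs and small radii, the symmetry of spheres cancels the first order term
and leaves O(η² + η'²). If a radius is comparable to r₀ and the points are not far apart, all
quantities are bounded on the needed side by a constant, which η² + η'² absorbs.

Density (`exists_integral_sub_smeared_le`). After rescaling by η, the positive part of g - G_η is
dominated by η^(-s) times a fixed profile, singular like |w|^(-s) at the origin and decaying like
|w|^(-s-2). As s < d < s + 2 the profile is integrable, and the change of variables contributes η^d.
For s = 0 the logarithm adds |log η| near the origin.

Coercivity (`ExtAdmissible.sobolevNormSq_le_energy`). This would be Plancherel's identity, except
that G is singular, may grow at infinity, and has a known Fourier transform only away from 0. Since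
α - β has total mass zero, it is enough to represent increments of G. For a mollifier R, low
frequencies of R(· - a) - R are cut off, the hypothesis on the transform is used, and the removed
part is shown to tend to 0, because a growth of order |X|^(1/2) is too slow to be seen by it
(`PositiveFourierPair.lintegral_symbol`). Averaging over a = X - Y under α ⊗ α, α ⊗ β and β ⊗ β
produces |α̂ - β̂|². The mollifier is then removed by dominated convergence on the energy side and
by Fatou's lemma on the Fourier side.

The constants are uniform because the lower bound on G and the bound on its spherical averages come
from the derivative bounds and doubling alone (`exists_lower_bound`) together with the mean value
inequality (`exists_lintegral_sphere_le`). -/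

section SmearedCharges

open Set Filter Metric

set_option linter.unusedSectionVars false

/-! ### Uniform measures on spheres: translation, symmetry, scaling, polar coordinates -/

section SphereMeasure

variable {E : Type*} [NormedAddCommGroup E] [InnerProductSpace ℝ E] [FiniteDimensional ℝ E]
  [MeasurableSpace E] [BorelSpace E]

lemma measurable_sphere_affine (X : E) (η : ℝ) :
    Measurable (fun ω : sphere (0 : E) 1 => X + η • (ω : E)) := by fun_prop

lemma lintegral_sphereMeasure (X : E) (η : ℝ) {f : E → ℝ≥0∞} (hf : Measurable f) :
    ∫⁻ Y, f Y ∂sphereMeasure X η =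
      ((volume : Measure E).toSphere univ)⁻¹ *
        ∫⁻ ω : sphere (0 : E) 1, f (X + η • (ω : E)) ∂(volume : Measure E).toSphere := by
  rw [sphereMeasure, lintegral_map hf (measurable_sphere_affine X η), lintegral_smul_measure,
    smul_eq_mul]

instance [Nontrivial E] (X : E) (η : ℝ) : IsProbabilityMeasure (sphereMeasure X η) := by
  refine ⟨?_⟩
  rw [sphereMeasure, Measure.map_apply (measurable_sphere_affine X η) .univ, preimage_univ,
    Measure.smul_apply, smul_eq_mul]
  exact ENNReal.inv_mul_cancel
    (mt Measure.measure_univ_eq_zero.1 (Measure.toSphere_ne_zero _)) (measure_ne_top _ _)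

lemma sphereMeasure_eq_map (X : E) (η : ℝ) :
    sphereMeasure X η = (sphereMeasure (0 : E) η).map (fun Y => X + Y) := by
  rw [sphereMeasure, sphereMeasure, Measure.map_map (by fun_prop) (measurable_sphere_affine 0 η)]
  congr 1
  ext ω
  simp

lemma ae_norm_sphereMeasure {η : ℝ} (hη : 0 ≤ η) :
    ∀ᵐ Y ∂sphereMeasure (0 : E) η, ‖Y‖ = η := by
  rw [sphereMeasure, ae_map_iff (measurable_sphere_affine 0 η).aemeasurable
    (measurableSet_eq_fun (by fun_prop) (by fun_prop))]
  refine Eventually.of_forall fun ω => ?_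
  simp [norm_smul, abs_of_nonneg hη]

open scoped Pointwise in
-- The surface measure of a set is the dimension times the volume of the cone over it, and Lebesgue
-- measure is invariant under negation.
lemma measurePreserving_neg_toSphere :
    MeasurePreserving (fun ω : sphere (0 : E) 1 => -ω) (volume : Measure E).toSphere
      (volume : Measure E).toSphere := by
  have hm : Measurable (fun ω : sphere (0 : E) 1 => -ω) := continuous_neg.measurable
  refine ⟨hm, ?_⟩
  ext s hs
  rw [Measure.map_apply hm hs, Measure.toSphere_apply' _ (hm hs), Measure.toSphere_apply' _ hs]
  congr 1
  have : Ioo (0 : ℝ) 1 • ((↑) '' ((fun ω : sphere (0 : E) 1 => -ω) ⁻¹' s) : Set E) =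
      -(Ioo (0 : ℝ) 1 • ((↑) '' s : Set E)) := by
    ext x
    simp only [Set.mem_smul, Set.mem_neg, Set.mem_image, Set.mem_preimage]
    constructor
    · rintro ⟨r, hr, _, ⟨ω, hω, rfl⟩, rfl⟩
      exact ⟨r, hr, _, ⟨-ω, hω, rfl⟩, by simp⟩
    · rintro ⟨r, hr, _, ⟨ω, hω, rfl⟩, h⟩
      exact ⟨r, hr, _, ⟨-ω, by simpa using hω, rfl⟩, by simp [h]⟩
  rw [this, Measure.measure_neg]

lemma map_neg_sphereMeasure (η : ℝ) :
    (sphereMeasure (0 : E) η).map (fun Y => -Y) = sphereMeasure (0 : E) η := by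
  rw [sphereMeasure, Measure.map_map (by fun_prop) (measurable_sphere_affine 0 η)]
  have h : (fun Y : E => -Y) ∘ (fun ω : sphere (0 : E) 1 => (0 : E) + η • (ω : E)) =
      (fun ω : sphere (0 : E) 1 => (0 : E) + η • (ω : E)) ∘ (fun ω => -ω) := by
    ext ω; simp
  rw [h, ← Measure.map_map (measurable_sphere_affine 0 η) continuous_neg.measurable,
    Measure.map_smul, measurePreserving_neg_toSphere.map_eq]

lemma measurePreserving_neg_sphereMeasure (η : ℝ) :
    MeasurePreserving (fun Y : E => -Y) (sphereMeasure (0 : E) η) (sphereMeasure (0 : E) η) :=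
  ⟨by fun_prop, map_neg_sphereMeasure η⟩

lemma map_smul_sphereMeasure (t η : ℝ) :
    (sphereMeasure (0 : E) η).map (fun Y => t • Y) = sphereMeasure (0 : E) (t * η) := by
  rw [sphereMeasure, sphereMeasure, Measure.map_map (by fun_prop) (measurable_sphere_affine 0 η)]
  congr 1
  ext ω
  simp [mul_smul]

/-- Integration in polar coordinates, in terms of averages over spheres. -/
lemma lintegral_eq_lintegral_sphereMeasure [Nontrivial E] {f : E → ℝ≥0∞} (hf : Measurable f) :
    ∫⁻ Y, f Y = ∫⁻ r in Ioi (0 : ℝ), (volume : Measure E).toSphere univ *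
      ENNReal.ofReal (r ^ (Module.finrank ℝ E - 1)) * ∫⁻ Y, f Y ∂sphereMeasure (0 : E) r := by
  have hg : Measurable (fun p : sphere (0 : E) 1 × Ioi (0 : ℝ) => f (p.2.1 • p.1.1)) :=
    hf.comp (by fun_prop)
  have h1 : ∫⁻ Y, f Y = ∫⁻ p, f (p.2.1 • p.1.1) ∂((volume : Measure E).toSphere.prod
      (Measure.volumeIoiPow (Module.finrank ℝ E - 1))) := by
    rw [← (Measure.measurePreserving_homeomorphUnitSphereProd (volume : Measure E)).lintegral_comp
      hg]
    have : ∀ x : ({0}ᶜ : Set E), f ((homeomorphUnitSphereProd E x).2.1 •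
        (homeomorphUnitSphereProd E x).1.1) = f x := by
      intro x
      have hx : ‖(x : E)‖ ≠ 0 := norm_ne_zero_iff.2 x.2
      simp [smul_smul, hx]
    simp_rw [this]
    rw [lintegral_subtype_comap (measurableSet_singleton _).compl, restrict_compl_singleton]
  rw [h1, lintegral_prod_symm _ hg.aemeasurable, Measure.volumeIoiPow,
    lintegral_withDensity_eq_lintegral_mul₀ (by fun_prop)
      (Measurable.lintegral_prod_left' hg).aemeasurable]
  simp only [Pi.mul_apply]
  have h2 := lintegral_subtype_comap (μ := volume) (measurableSet_Ioi (a := (0 : ℝ)))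
    (fun r : ℝ => ENNReal.ofReal (r ^ (Module.finrank ℝ E - 1)) *
      ∫⁻ ω : sphere (0 : E) 1, f (r • ω.1) ∂(volume : Measure E).toSphere)
  rw [h2]
  refine lintegral_congr fun r => ?_
  rw [lintegral_sphereMeasure _ _ hf]
  simp only [zero_add]
  rw [mul_comm ((volume : Measure E).toSphere univ), mul_assoc, ← mul_assoc
    ((volume : Measure E).toSphere univ), ENNReal.mul_inv_cancel, one_mul]
  · exact mt Measure.measure_univ_eq_zero.1 (Measure.toSphere_ne_zero _)
  · exact measure_ne_top _ _

end SphereMeasure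

/-! ### From distributional superharmonicity to the mean value inequality on spheres -/

section MeanValue

/-- A nonnegative radial profile, in the variable `t = ‖Z - X‖ ^ 2`, whose Laplacian is the
difference of two given shell densities. -/
lemma exists_radial_profile (n : ℝ) {b₁ b₂ : ℝ → ℝ} {a b T : ℝ} (ha : 0 < a) (hab : a ≤ b)
    (hbT : b ≤ T) (hb₁ : ContDiff ℝ (⊤ : ℕ∞) b₁) (hb₂ : ContDiff ℝ (⊤ : ℕ∞) b₂)
    (h₁ : ∀ t, 0 ≤ b₁ t) (h₂ : ∀ t, 0 ≤ b₂ t)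
    (s₁ : ∀ t, t ∉ Icc a b → b₁ t = 0) (s₂ : ∀ t, t ∉ Icc b T → b₂ t = 0)
    (i₁ : ∫ t, b₁ t = 1) (i₂ : ∫ t, b₂ t = 1) :
    ∃ V : ℝ → ℝ, ContDiff ℝ (⊤ : ℕ∞) V ∧ (∀ t, 0 ≤ V t) ∧ (∀ t, T ≤ t → V t = 0) ∧
      ∀ t, 4 * t * deriv (deriv V) t + 2 * n * deriv V t =
        4 * (t ^ (1 - n / 2) * b₂ t - t ^ (1 - n / 2) * b₁ t) := by
  have c₁ := hb₁.continuous
  have c₂ := hb₂.continuous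
  have j₁ : Integrable b₁ := c₁.integrable_of_hasCompactSupport
    (HasCompactSupport.intro isCompact_Icc s₁)
  have j₂ : Integrable b₂ := c₂.integrable_of_hasCompactSupport
    (HasCompactSupport.intro isCompact_Icc s₂)
  have full : ∀ f : ℝ → ℝ, ∀ t, 0 ≤ t → (∀ x, x ∉ Icc a t → f x = 0) →
      ∫ x in (0 : ℝ)..t, f x = ∫ x, f x := by
    intro f t ht hf
    rw [intervalIntegral.integral_of_le ht, ← integral_indicator measurableSet_Ioc]
    refine integral_congr_ae (Eventually.of_forall fun x => ?_)
    by_cases hx : x ∈ Ioc 0 t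
    · simp [hx]
    · simp only [hx, not_false_eq_true, indicator_of_notMem]
      rw [hf x]
      exact fun h => hx ⟨ha.trans_le h.1, h.2⟩
  have zero : ∀ f : ℝ → ℝ, ∀ t, (∀ x, x ≤ max 0 t → f x = 0) → ∫ x in (0 : ℝ)..t, f x = 0 := by
    intro f t hf
    rw [intervalIntegral.integral_congr (g := fun _ => 0)]
    · simp
    · intro x hx
      exact hf x hx.2
  -- The left side of the required equation is 4 t^(1 - n/2) (t^(n/2) V')', so V' = -t^(-n/2) p with
  -- p' = b₁ - b₂. The unit mass of b₁ lies to the left of that of b₂; hence p is nonnegative and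
  -- vanishes outside [a, T].
  set p : ℝ → ℝ := fun t => ∫ x in (0 : ℝ)..t, (b₁ x - b₂ x) with hp
  have p_deriv : ∀ t, HasDerivAt p (b₁ t - b₂ t) t := fun t =>
    ((c₁.sub c₂).integral_hasStrictDerivAt 0 t).hasDerivAt
  have p_smooth : ContDiff ℝ (⊤ : ℕ∞) p := by
    rw [contDiff_infty_iff_deriv]
    refine ⟨fun t => (p_deriv t).differentiableAt, ?_⟩
    rw [show deriv p = fun t => b₁ t - b₂ t from funext fun t => (p_deriv t).deriv]
    exact hb₁.sub hb₂
  have p_zero : ∀ t ≤ a, p t = 0 := by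
    intro t ht
    refine zero _ t fun x hx => ?_
    rcases lt_or_eq_of_le (hx.trans (max_le ha.le ht)) with h | h
    · rw [s₁ x (fun h' => h.not_ge h'.1), s₂ x (fun h' => h.not_ge (hab.trans h'.1)), sub_zero]
    -- The support hypotheses say nothing at the endpoint a; the value there is 0 by continuity.
    · have hcl : ∀ f : ℝ → ℝ, Continuous f → (∀ y, y < a → f y = 0) → f a = 0 := by
        intro f hf h0
        have : closure (Iio a) ⊆ {y | f y = 0} :=
          closure_minimal (fun y hy => h0 y hy) (isClosed_eq hf continuous_const)
        exact this (by rw [closure_Iio]; exact self_mem_Iic)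
      rw [h, hcl b₁ c₁ fun y hy => s₁ y fun h' => hy.not_ge h'.1,
        hcl b₂ c₂ fun y hy => s₂ y fun h' => hy.not_ge (hab.trans h'.1), sub_zero]
  have p_sub : ∀ t, p t = (∫ x in (0 : ℝ)..t, b₁ x) - ∫ x in (0 : ℝ)..t, b₂ x := fun t =>
    intervalIntegral.integral_sub (c₁.intervalIntegrable _ _) (c₂.intervalIntegrable _ _)
  have p_end : ∀ t, T ≤ t → p t = 0 := by
    intro t ht
    have ht0 : 0 ≤ t := ha.le.trans (hab.trans (hbT.trans ht))
    rw [p_sub, full b₁ t ht0 fun x hx => s₁ x fun h => hx ⟨h.1, h.2.trans (hbT.trans ht)⟩,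
      full b₂ t ht0 fun x hx => s₂ x fun h => hx ⟨hab.trans h.1, h.2.trans ht⟩, i₁, i₂, sub_self]
  have p_nonneg : ∀ t, 0 ≤ p t := by
    intro t
    rcases le_total t a with hta | hta
    · rw [p_zero t hta]
    have ht0 : 0 ≤ t := ha.le.trans hta
    rcases lt_or_ge t b with h | h
    · rw [p_sub, zero b₂ t fun x hx => s₂ x fun h' => (hx.trans_lt (max_lt (ha.trans_le hab) h)).not_ge h'.1,
        sub_zero]
      exact intervalIntegral.integral_nonneg ht0 fun x _ => h₁ x
    · rw [p_sub, full b₁ t ht0 fun x hx => s₁ x fun h' => hx ⟨h'.1, h'.2.trans h⟩, i₁, sub_nonneg,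
        ← i₂, intervalIntegral.integral_of_le ht0]
      exact setIntegral_le_integral j₂ (Eventually.of_forall h₂)
  set v : ℝ → ℝ := fun t => t ^ (-(n / 2)) * p t with hv
  have v_nonneg : ∀ t, 0 ≤ v t := by
    intro t
    rcases le_total t a with hta | hta
    · simp [hv, p_zero t hta]
    · exact mul_nonneg (Real.rpow_nonneg (ha.le.trans hta) _) (p_nonneg t)
  have v_local : ∀ t, t < a → v =ᶠ[𝓝 t] fun _ => 0 := by
    intro t ht
    filter_upwards [Iio_mem_nhds ht] with x hx
    simp [hv, p_zero x (le_of_lt hx)]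
  have v_smooth : ContDiff ℝ (⊤ : ℕ∞) v := by
    rw [contDiff_iff_contDiffAt]
    intro t
    rcases lt_or_ge t a with hta | hta
    · exact contDiffAt_const.congr_of_eventuallyEq (v_local t hta)
    · exact (Real.contDiffAt_rpow_const_of_ne (ha.trans_le hta).ne').mul p_smooth.contDiffAt
  have v_end : ∀ t, T ≤ t → v t = 0 := fun t ht => by simp [hv, p_end t ht]
  set V : ℝ → ℝ := fun t => -∫ x in T..t, v x with hV
  have V_deriv : ∀ t, HasDerivAt V (-v t) t := fun t =>
    (v_smooth.continuous.integral_hasStrictDerivAt T t).hasDerivAt.neg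
  have V_deriv' : deriv V = fun t => -v t := funext fun t => (V_deriv t).deriv
  refine ⟨V, ?_, ?_, ?_, ?_⟩
  · rw [contDiff_infty_iff_deriv, V_deriv']
    exact ⟨fun t => (V_deriv t).differentiableAt, v_smooth.neg⟩
  · intro t
    rcases le_total t T with h | h
    · simp only [hV]
      rw [← intervalIntegral.integral_symm]
      exact intervalIntegral.integral_nonneg h fun x _ => v_nonneg x
    · simp only [hV]
      rw [intervalIntegral.integral_congr (g := fun _ => 0)]
      · simp
      · intro x hx
        rw [uIcc_of_le h] at hx
        exact v_end x hx.1
  · intro t h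
    simp only [hV]
    rw [intervalIntegral.integral_congr (g := fun _ => 0)]
    · simp
    · intro x hx
      rw [uIcc_of_le h] at hx
      exact v_end x hx.1
  · intro t
    rw [V_deriv']
    rcases lt_or_ge t a with hta | hta
    · have : deriv (fun t => -v t) t = 0 := by
        have h : (fun t => -v t) =ᶠ[𝓝 t] fun _ => 0 := (v_local t hta).mono fun x hx => by simp [hx]
        rw [h.deriv_eq, deriv_const]
      have h0 : v t = 0 := (v_local t hta).eq_of_nhds
      simp only [this, h0]
      rw [s₁ t fun h => hta.not_ge h.1,
        s₂ t fun h => hta.not_ge (hab.trans h.1)]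
      simp
    · have ht : 0 < t := ha.trans_le hta
      have hd : HasDerivAt v (-(n / 2) * t ^ (-(n / 2) - 1) * p t +
          t ^ (-(n / 2)) * (b₁ t - b₂ t)) t :=
        (Real.hasDerivAt_rpow_const (Or.inl ht.ne')).mul (p_deriv t)
      rw [hd.fun_neg.deriv]
      have e1 : t ^ (1 - n / 2) = t * t ^ (-(n / 2)) := by
        rw [sub_eq_add_neg, Real.rpow_add ht, Real.rpow_one]
      have e2 : t * t ^ (-(n / 2) - 1) = t ^ (-(n / 2)) := by
        rw [Real.rpow_sub_one ht.ne']; field_simp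
      rw [e1, hv]
      linear_combination (2 * n * p t) * e2

variable {E : Type*} [NormedAddCommGroup E] [InnerProductSpace ℝ E] [FiniteDimensional ℝ E]
  [MeasurableSpace E] [BorelSpace E]

/-- The gradient of ‖Z - X‖² is 2 (Z - X), so the Hessian is 2 V' times the identity plus 4 V''
times the tensor square of Z - X; the formula is its trace. -/
lemma laplacian_comp_norm_sq {V : ℝ → ℝ} (hV : ContDiff ℝ (⊤ : ℕ∞) V) (X Z : E) :
    Laplacian.laplacian (fun Z : E => V (‖Z - X‖ ^ 2)) Z =
      4 * ‖Z - X‖ ^ 2 * deriv (deriv V) (‖Z - X‖ ^ 2) +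
        2 * Module.finrank ℝ E * deriv V (‖Z - X‖ ^ 2) := by
  have hV0 := contDiff_infty_iff_deriv.1 hV
  have hV1 := contDiff_infty_iff_deriv.1 hV0.2
  -- The inner product retyped as a plain bilinear map, on which the rules of calculus can be used
  -- directly.
  have : ∃ S : E →L[ℝ] E →L[ℝ] ℝ, ∀ x, S x = innerSL ℝ x := ⟨innerSL ℝ, fun _ => rfl⟩
  obtain ⟨S, hS⟩ := this
  have hsq : ∀ Z : E, HasFDerivAt (fun Z : E => ‖Z - X‖ ^ 2) ((2 : ℝ) • S (Z - X)) Z := by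
    intro Z
    have := ((hasFDerivAt_id (𝕜 := ℝ) Z).sub_const X).norm_sq
    rw [hS, two_smul ℝ]
    simpa [two_smul] using this
  have hf1 : fderiv ℝ (fun Z : E => V (‖Z - X‖ ^ 2)) =
      fun Z => deriv V (‖Z - X‖ ^ 2) • ((2 : ℝ) • S (Z - X)) := by
    ext1 Z
    exact ((hV0.1 (‖Z - X‖ ^ 2)).hasDerivAt.comp_hasFDerivAt Z (hsq Z)).fderiv
  have hf2 : ∀ Z : E, HasFDerivAt (fun Z : E => deriv V (‖Z - X‖ ^ 2) • ((2 : ℝ) • S (Z - X)))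
      (deriv V (‖Z - X‖ ^ 2) • ((2 : ℝ) • S) +
        (deriv (deriv V) (‖Z - X‖ ^ 2) • ((2 : ℝ) • S (Z - X))).smulRight
          ((2 : ℝ) • S (Z - X))) Z := by
    intro Z
    have h1 : HasFDerivAt (fun Z : E => deriv V (‖Z - X‖ ^ 2))
        (deriv (deriv V) (‖Z - X‖ ^ 2) • ((2 : ℝ) • S (Z - X))) Z := by
      have h0 : HasDerivAt (deriv V) (deriv (deriv V) (‖Z - X‖ ^ 2)) (‖Z - X‖ ^ 2) :=
        (hV1.1 (‖Z - X‖ ^ 2)).hasDerivAt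
      exact h0.comp_hasFDerivAt Z (hsq Z)
    have h2 : HasFDerivAt (fun Z : E => (2 : ℝ) • S (Z - X)) ((2 : ℝ) • S) Z := by
      have h3 : HasFDerivAt (fun Z : E => S (Z - X)) S Z := by
        have := (S.hasFDerivAt (x := Z - X)).comp Z ((hasFDerivAt_id Z).sub_const X)
        exact this
      exact h3.const_smul (2 : ℝ)
    exact h1.smul h2
  rw [InnerProductSpace.laplacian_eq_iteratedFDeriv_stdOrthonormalBasis]
  simp only [iteratedFDeriv_two_apply, hf1, (hf2 Z).fderiv]
  simp only [Matrix.cons_val_zero, Matrix.cons_val_one, _root_.add_apply,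
    _root_.smul_apply, ContinuousLinearMap.smulRight_apply, hS, innerSL_apply_apply,
    smul_eq_mul, Finset.sum_add_distrib]
  have e1 : ∀ i, inner ℝ (stdOrthonormalBasis ℝ E i) (stdOrthonormalBasis ℝ E i) = 1 := by
    intro i; simp
  have e2 : ∑ i, inner ℝ (Z - X) (stdOrthonormalBasis ℝ E i) ^ 2 = ‖Z - X‖ ^ 2 := by
    rw [← (stdOrthonormalBasis ℝ E).sum_sq_norm_inner_left]
    simp
  simp only [e1]
  rw [← e2, Finset.mul_sum, Finset.sum_mul, Finset.sum_const, Finset.card_univ, Fintype.card_fin, add_comm]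
  congr 1
  · exact Finset.sum_congr rfl fun i _ => by ring
  · simp; ring

end MeanValue

/-! ### Averages over thin shells -/

section MeanValue

lemma continuous_rpow_mul_of_support (q : ℝ) {b : ℝ → ℝ} {a : ℝ} (ha : 0 < a) (hb : Continuous b)
    (s : ∀ t, t < a → b t = 0) : Continuous fun t : ℝ => t ^ q * b t := by
  rw [continuous_iff_continuousAt]
  intro t
  rcases lt_or_ge t a with h | h
  · have : (fun t : ℝ => t ^ q * b t) =ᶠ[𝓝 t] fun _ => 0 := by
      filter_upwards [Iio_mem_nhds h] with x hx
      rw [s x hx, mul_zero]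
    exact continuousAt_const.congr this.symm
  · exact (Real.continuousAt_rpow_const _ _ (Or.inl (ha.trans_le h).ne')).mul hb.continuousAt

variable {E : Type*} [NormedAddCommGroup E] [InnerProductSpace ℝ E] [FiniteDimensional ℝ E]
  [MeasurableSpace E] [BorelSpace E]

/-- The radial density `‖Y‖ ^ (2 - n) b (‖Y‖ ^ 2)`, where `n` is the dimension. -/
noncomputable def shellDensity (E : Type*) [NormedAddCommGroup E] [InnerProductSpace ℝ E] (b : ℝ → ℝ)
    (Y : E) : ℝ :=
  (‖Y‖ ^ 2) ^ (1 - (Module.finrank ℝ E : ℝ) / 2) * b (‖Y‖ ^ 2)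

lemma continuous_shellDensity {b : ℝ → ℝ} {a : ℝ} (ha : 0 < a) (hb : Continuous b)
    (s : ∀ t, t < a → b t = 0) : Continuous (shellDensity E b) :=
  (continuous_rpow_mul_of_support (1 - (Module.finrank ℝ E : ℝ) / 2) ha hb s).comp
    (continuous_norm.pow 2)

lemma shellDensity_nonneg {b : ℝ → ℝ} (h : ∀ t, 0 ≤ b t) (Y : E) : 0 ≤ shellDensity E b Y :=
  mul_nonneg (Real.rpow_nonneg (by positivity) _) (h _)

lemma shellDensity_eq_zero {b : ℝ → ℝ} {Y : E} (h : b (‖Y‖ ^ 2) = 0) : shellDensity E b Y = 0 := by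
  simp [shellDensity, h]

lemma hasCompactSupport_shellDensity {b : ℝ → ℝ} {T : ℝ} (s : ∀ t, T < t → b t = 0) :
    HasCompactSupport (shellDensity E b) := by
  refine HasCompactSupport.intro (isCompact_closedBall (0 : E) (√T)) fun Y hY => ?_
  refine shellDensity_eq_zero (s _ ?_)
  rw [mem_closedBall_zero_iff, not_le] at hY
  exact (Real.lt_sq_of_sqrt_lt hY)

/-- With t = r², the radial weight r^(n-1) r^(2-n) dr becomes dt / 2. Shells with equal ∫ b thus
have equal mass, which makes their averages comparable. -/
lemma integral_shellDensity [Nontrivial E] {b : ℝ → ℝ} (s : ∀ t, t ≤ 0 → b t = 0) :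
    ∫ Y : E, shellDensity E b Y =
      Module.finrank ℝ E * (volume : Measure E).real (ball 0 1) * (1 / 2 * ∫ t, b t) := by
  have h := integral_fun_norm_addHaar (volume : Measure E)
    (fun r => (r ^ 2) ^ (1 - (Module.finrank ℝ E : ℝ) / 2) * b (r ^ 2))
  simp only [shellDensity]
  rw [h, nsmul_eq_mul, smul_eq_mul, mul_assoc]
  congr 2
  have h1 : ∫ t, b t = ∫ t in Ioi (0 : ℝ), b t := by
    rw [← integral_indicator measurableSet_Ioi]
    refine integral_congr_ae (Eventually.of_forall fun t => ?_)
    by_cases ht : 0 < t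
    · simp [ht]
    · simp [ht, s t (not_lt.1 ht)]
  rw [h1, ← integral_comp_rpow_Ioi_of_pos (g := b) (p := 2) two_pos, ← integral_const_mul]
  refine setIntegral_congr_fun measurableSet_Ioi fun r hr => ?_
  have hr : 0 < r := hr
  have hD : 1 ≤ Module.finrank ℝ E := Module.finrank_pos
  have e : r ^ (Module.finrank ℝ E - 1) * (r ^ 2) ^ (1 - (Module.finrank ℝ E : ℝ) / 2) = r := by
    rw [← Real.rpow_natCast r, ← Real.rpow_natCast r 2, ← Real.rpow_mul hr.le, ← Real.rpow_add hr,
      Nat.cast_sub hD]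
    rw [show ((Module.finrank ℝ E : ℝ) - (1 : ℕ)) + ((2 : ℕ) : ℝ) *
      (1 - (Module.finrank ℝ E : ℝ) / 2) = 1 by push_cast; ring, Real.rpow_one]
  simp only [smul_eq_mul]
  rw [← mul_assoc, e, show (2 : ℝ) - 1 = 1 by norm_num, Real.rpow_one,
    show r ^ (2 : ℝ) = r ^ 2 from Real.rpow_two r]
  ring

/-- For a superharmonic function, averages over larger shells are smaller. -/
lemma SuperharmonicOn.integral_shellDensity_le {G : E → ℝ} {r₀ : ℝ}
    (hG : SuperharmonicOn G (ball 0 r₀)) (hloc : LocallyIntegrable G) {X : E}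
    {b₁ b₂ : ℝ → ℝ} {a b T : ℝ} (ha : 0 < a) (hab : a ≤ b)
    (hbT : b ≤ T) (hb₁ : ContDiff ℝ (⊤ : ℕ∞) b₁) (hb₂ : ContDiff ℝ (⊤ : ℕ∞) b₂)
    (h₁ : ∀ t, 0 ≤ b₁ t) (h₂ : ∀ t, 0 ≤ b₂ t)
    (s₁ : ∀ t, t ∉ Icc a b → b₁ t = 0) (s₂ : ∀ t, t ∉ Icc b T → b₂ t = 0)
    (i₁ : ∫ t, b₁ t = 1) (i₂ : ∫ t, b₂ t = 1) (hX : ‖X‖ + √T < r₀) :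
    ∫ Z, G Z * shellDensity E b₂ (Z - X) ≤ ∫ Z, G Z * shellDensity E b₁ (Z - X) := by
  obtain ⟨V, V1, V2, V3, V4⟩ := exists_radial_profile (Module.finrank ℝ E) ha hab hbT hb₁ hb₂ h₁ h₂
    s₁ s₂ i₁ i₂
  have supp : ∀ Z : E, Z ∉ closedBall X (√T) → V (‖Z - X‖ ^ 2) = 0 := by
    intro Z hZ
    rw [mem_closedBall, dist_eq_norm, not_le] at hZ
    exact V3 _ (Real.lt_sq_of_sqrt_lt hZ).le
  have key := hG (fun Z => V (‖Z - X‖ ^ 2))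
    (V1.comp ((contDiff_id.sub contDiff_const).norm_sq ℝ))
    (HasCompactSupport.intro (isCompact_closedBall X (√T)) supp)
    ((closure_minimal (s := Function.support fun Z => V (‖Z - X‖ ^ 2)) (t := closedBall X (√T))
      (fun Z hZ => by_contra fun h => hZ (supp Z h))
      isClosed_closedBall).trans (closedBall_subset_ball' (by rw [dist_zero_right]; linarith)))
    (fun Z => V2 _)
  have int : ∀ b : ℝ → ℝ, Continuous b → (∀ t, t ∉ Icc a T → b t = 0) →
      Integrable fun Z => G Z * shellDensity E b (Z - X) := by
    intro b cb sb
    have c := continuous_shellDensity (E := E) ha cb fun t ht => sb t fun h => ht.not_ge h.1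
    have k := hasCompactSupport_shellDensity (E := E) fun t ht => sb t fun h => ht.not_ge h.2
    have := hloc.integrable_smul_left_of_hasCompactSupport (c.comp (continuous_id.sub continuous_const))
      (k.comp_homeomorph (Homeomorph.subRight X))
    simpa [mul_comm] using this
  have e : ∀ Z, G Z * Laplacian.laplacian (fun Z => V (‖Z - X‖ ^ 2)) Z =
      4 * (G Z * shellDensity E b₂ (Z - X) - G Z * shellDensity E b₁ (Z - X)) := by
    intro Z
    rw [laplacian_comp_norm_sq V1, V4, shellDensity, shellDensity]
    ring
  simp_rw [e] at key
  rw [integral_const_mul, integral_sub (int b₂ hb₂.continuous fun t ht => s₂ t fun h =>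
      ht ⟨hab.trans h.1, h.2⟩) (int b₁ hb₁.continuous fun t ht => s₁ t fun h =>
      ht ⟨h.1, h.2.trans hbT⟩)] at key
  linarith

/-- The function `G + L` as an extended nonnegative function, with the value `∞` at `0`. -/
noncomputable def liftedPotential (G : E → ℝ) (L : ℝ) (Z : E) : ℝ≥0∞ :=
  open Classical in if Z = 0 then ∞ else ENNReal.ofReal (G Z + L)

/-- Since G tends to +∞ at the origin, the value ∞ there is the continuous extension. -/
lemma continuous_liftedPotential {G : E → ℝ} (hc : ContinuousOn G {0}ᶜ)
    (h0 : Tendsto G (𝓝[≠] 0) atTop) (L : ℝ) : Continuous (liftedPotential G L) := by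
  rw [continuous_iff_continuousAt]
  intro Z
  by_cases hZ : Z = 0
  · subst hZ
    rw [ContinuousAt, ← nhdsNE_sup_pure, tendsto_sup]
    constructor
    · have h1 : liftedPotential G L 0 = ∞ := by simp [liftedPotential]
      rw [h1]
      have h2 : Tendsto (fun Z => ENNReal.ofReal (G Z + L)) (𝓝[≠] 0) (𝓝 ∞) :=
        ENNReal.tendsto_ofReal_atTop.comp (tendsto_atTop_add_const_right _ _ h0)
      refine h2.congr' ?_
      filter_upwards [self_mem_nhdsWithin] with Z hZ
      have : Z ≠ 0 := hZ
      simp [liftedPotential, this]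
    · exact tendsto_pure_nhds _ _
  · have h1 : ContinuousAt G Z := hc.continuousAt (isOpen_compl_singleton.mem_nhds hZ)
    have h2 : ContinuousAt (fun Z => ENNReal.ofReal (G Z + L)) Z :=
      ENNReal.continuous_ofReal.continuousAt.comp (h1.add continuousAt_const)
    refine h2.congr ?_
    filter_upwards [isOpen_compl_singleton.mem_nhds hZ] with W hW
    have : W ≠ 0 := hW
    simp [liftedPotential, this]

/-- The averages of the truncations min F k are continuous in the radius by dominated convergence,
and the average of F is their supremum. Full continuity can fail at a radius for which the sphere
meets a point where F = ∞. -/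
lemma lowerSemicontinuous_sphere_average [Nontrivial E] {F : E → ℝ≥0∞} (hF : Continuous F)
    (X : E) : LowerSemicontinuous fun r : ℝ => ∫⁻ Y, F (X + Y) ∂sphereMeasure (0 : E) r := by
  have h : ∀ r : ℝ, ∫⁻ Y, F (X + Y) ∂sphereMeasure (0 : E) r =
      ⨆ k : ℕ, ∫⁻ Y, min (F (X + Y)) k ∂sphereMeasure (0 : E) r := by
    intro r
    rw [← lintegral_iSup (f := fun (k : ℕ) Y => min (F (X + Y)) (k : ℝ≥0∞))
      (fun k => (by fun_prop : Continuous fun Y => min (F (X + Y)) (k : ℝ≥0∞)).measurable)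
      (fun i j hij Y => min_le_min le_rfl (by exact_mod_cast hij))]
    refine lintegral_congr fun Y => ?_
    have : (⨆ k : ℕ, min (F (X + Y)) (k : ℝ≥0∞)) = min (F (X + Y)) (⨆ k : ℕ, (k : ℝ≥0∞)) :=
      (inf_iSup_eq _ _).symm
    rw [this, ENNReal.iSup_natCast]
    simp
  simp_rw [h]
  refine lowerSemicontinuous_iSup fun k => Continuous.lowerSemicontinuous ?_
  have h2 : ∀ r : ℝ, ∫⁻ Y, min (F (X + Y)) k ∂sphereMeasure (0 : E) r =
      ((volume : Measure E).toSphere univ)⁻¹ * ∫⁻ ω : sphere (0 : E) 1,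
        min (F (X + r • (ω : E))) k ∂(volume : Measure E).toSphere := by
    intro r
    rw [lintegral_sphereMeasure _ _
      (by fun_prop : Continuous fun Y => min (F (X + Y)) (k : ℝ≥0∞)).measurable]
    simp
  simp_rw [h2]
  refine (ENNReal.continuous_const_mul ?_).comp ?_
  · exact ENNReal.inv_ne_top.2 (mt Measure.measure_univ_eq_zero.1 (Measure.toSphere_ne_zero _))
  · rw [continuous_iff_continuousAt]
    intro r
    refine tendsto_lintegral_filter_of_dominated_convergence (fun _ => (k : ℝ≥0∞)) ?_ ?_ ?_ ?_
    · exact Eventually.of_forall fun r =>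
        (by fun_prop : Continuous fun ω : sphere (0 : E) 1 =>
          min (F (X + r • (ω : E))) (k : ℝ≥0∞)).measurable
    · exact Eventually.of_forall fun r => Eventually.of_forall fun ω => min_le_right _ _
    · simp only [lintegral_const]
      exact ENNReal.mul_ne_top (ENNReal.natCast_ne_top k) (measure_ne_top _ _)
    · refine Eventually.of_forall fun ω => ?_
      have : Continuous fun r : ℝ => min (F (X + r • (ω : E))) (k : ℝ≥0∞) := by fun_prop
      exact this.tendsto r

end MeanValue

/-! ### The mean value inequality -/

section MeanValue

variable {E : Type*} [NormedAddCommGroup E] [InnerProductSpace ℝ E] [FiniteDimensional ℝ E]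
  [MeasurableSpace E] [BorelSpace E] [Nontrivial E]

/-- The mean value inequality on spheres. The value `∞` of `liftedPotential G L` at the origin makes
it apply to spheres through the origin. -/
lemma SuperharmonicOn.lintegral_sphere_le {G : E → ℝ} {r₀ L : ℝ}
    (hG : SuperharmonicOn G (ball 0 r₀)) (hloc : LocallyIntegrable G)
    (hc : ContinuousOn G {0}ᶜ) (h0 : Tendsto G (𝓝[≠] 0) atTop)
    (hL : ∀ Z ∈ ball (0 : E) r₀, Z ≠ 0 → -L ≤ G Z) {X : E} (hX : X ≠ 0) {η : ℝ} (hη : 0 < η)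
    (hXη : ‖X‖ + η < r₀) :
    ∫⁻ Y, liftedPotential G L (X + Y) ∂sphereMeasure (0 : E) η ≤ ENNReal.ofReal (G X + L) := by
  have hF := continuous_liftedPotential hc h0 L
  -- Fix κ₁ < κ between G X + L and the supposedly larger average. By semicontinuity, averages at
  -- radii near η stay above κ; by continuity, G + L stays below κ₁ near X. Comparing a shell near
  -- radius η with a tiny one around X contradicts κ₁ < κ.
  by_contra! hlt
  obtain ⟨κ, hκ1, hκ⟩ := ENNReal.lt_iff_exists_nnreal_btwn.1 hlt
  obtain ⟨κ₁, hκ₁, hκ₁κ⟩ := ENNReal.lt_iff_exists_nnreal_btwn.1 hκ1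
  have hκ₁κ : κ₁ < κ := by exact_mod_cast hκ₁κ
  have hGX : G X + L < κ₁ := by
    by_contra! h
    exact hκ₁.not_ge (by rw [← ENNReal.ofReal_coe_nnreal]; exact ENNReal.ofReal_le_ofReal h)
  have hsqrt : √(η ^ 2) = η := Real.sqrt_sq hη.le
  have ev : ∀ᶠ t in 𝓝 (η ^ 2), ((κ : ℝ≥0∞) < ∫⁻ Y, liftedPotential G L (X + Y)
      ∂sphereMeasure (0 : E) (√t)) ∧ ‖X‖ + √t < r₀ := by
    have hs : Tendsto Real.sqrt (𝓝 (η ^ 2)) (𝓝 η) := by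
      have := Real.continuous_sqrt.tendsto (η ^ 2)
      rwa [hsqrt] at this
    refine hs.eventually (p := fun r => ((κ : ℝ≥0∞) < ∫⁻ Y, liftedPotential G L (X + Y)
      ∂sphereMeasure (0 : E) r) ∧ ‖X‖ + r < r₀) (Filter.Eventually.and ?_ ?_)
    · exact lowerSemicontinuous_sphere_average hF X η κ hκ
    · exact (tendsto_const_nhds.add tendsto_id).eventually_lt_const hXη
  obtain ⟨τ, hτ, hball⟩ := Metric.eventually_nhds_iff.1 ev
  have hη2 : 0 < η ^ 2 := by positivity
  obtain ⟨τ', hτ', hτ1, hτ2⟩ : ∃ τ', 0 < τ' ∧ τ' < τ ∧ τ' < η ^ 2 :=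
    ⟨min τ (η ^ 2) / 2, by positivity, by
      have := min_le_left τ (η ^ 2); have : 0 < min τ (η ^ 2) := by positivity
      linarith, by
      have := min_le_right τ (η ^ 2); have : 0 < min τ (η ^ 2) := by positivity
      linarith⟩
  have evX : ∀ᶠ Z in 𝓝 X, G Z + L < κ₁ :=
    ((hc.continuousAt (isOpen_compl_singleton.mem_nhds hX)).tendsto.add_const L).eventually_lt_const
      hGX
  obtain ⟨e, he, hball1⟩ := Metric.eventually_nhds_iff.1 evX
  -- The bump b₁, in the variable t = r², will live on (c/2, 3c/2): radii below e, and to the left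
  -- of the support of b₂.
  obtain ⟨c, hcpos, hce, hcb⟩ : ∃ c, 0 < c ∧ 3 / 2 * c < e ^ 2 ∧ 3 / 2 * c ≤ η ^ 2 - τ' := by
    have h1 : 0 < min (e ^ 2) (η ^ 2 - τ') := lt_min (by positivity) (by linarith)
    refine ⟨min (e ^ 2) (η ^ 2 - τ') / 2, by positivity, ?_, ?_⟩
    · have := min_le_left (e ^ 2) (η ^ 2 - τ'); linarith
    · have := min_le_right (e ^ 2) (η ^ 2 - τ'); linarith
  let f₁ : ContDiffBump c := ⟨c / 4, c / 2, by positivity, by linarith⟩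
  let f₂ : ContDiffBump (η ^ 2) := ⟨τ' / 2, τ', by positivity, by linarith⟩
  set b₁ := f₁.normed volume with hb₁
  set b₂ := f₂.normed volume with hb₂
  have z₁ : ∀ t, t ∉ Ioo (c / 2) (3 / 2 * c) → b₁ t = 0 := by
    intro t ht
    by_contra h
    have : t ∈ Function.support b₁ := h
    rw [hb₁, f₁.support_normed_eq, Real.ball_eq_Ioo] at this
    exact ht ⟨by have := this.1; simp only [f₁] at this; linarith,
      by have := this.2; simp only [f₁] at this; linarith⟩
  have z₂ : ∀ t, t ∉ Ioo (η ^ 2 - τ') (η ^ 2 + τ') → b₂ t = 0 := by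
    intro t ht
    by_contra h
    have : t ∈ Function.support b₂ := h
    rw [hb₂, f₂.support_normed_eq, Real.ball_eq_Ioo] at this
    exact ht this
  have hT : ‖X‖ + √(η ^ 2 + τ') < r₀ := (hball (by
    rw [Real.dist_eq, add_sub_cancel_left, abs_of_pos hτ']; exact hτ1)).2
  have n₁ : ∀ t, 0 ≤ b₁ t := f₁.nonneg_normed
  have n₂ : ∀ t, 0 ≤ b₂ t := f₂.nonneg_normed
  have i₁ : ∫ t, b₁ t = 1 := f₁.integral_normed
  have i₂ : ∫ t, b₂ t = 1 := f₂.integral_normed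
  have key := hG.integral_shellDensity_le (X := X) hloc (a := c / 2) (b := η ^ 2 - τ')
    (T := η ^ 2 + τ') (by positivity) (by linarith) (by linarith) f₁.contDiff_normed
    f₂.contDiff_normed n₁ n₂
    (fun t ht => z₁ t fun h => ht ⟨h.1.le, h.2.le.trans hcb⟩)
    (fun t ht => z₂ t fun h => ht ⟨h.1.le, h.2.le⟩) i₁ i₂ hT
  rw [← hb₁, ← hb₂] at key
  have cont₁ : Continuous (shellDensity E b₁) := continuous_shellDensity (a := c / 2) (by positivity)
    f₁.continuous_normed fun t ht => z₁ t fun h => ht.not_ge h.1.le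
  have cont₂ : Continuous (shellDensity E b₂) := continuous_shellDensity (a := η ^ 2 - τ')
    (by linarith) f₂.continuous_normed fun t ht => z₂ t fun h => ht.not_ge h.1.le
  have supp₁ : HasCompactSupport (shellDensity E b₁) := hasCompactSupport_shellDensity
    (T := 3 / 2 * c) fun t ht => z₁ t fun h => ht.not_ge h.2.le
  have supp₂ : HasCompactSupport (shellDensity E b₂) := hasCompactSupport_shellDensity
    (T := η ^ 2 + τ') fun t ht => z₂ t fun h => ht.not_ge h.2.le
  obtain ⟨m, hm⟩ : ∃ m, m = Module.finrank ℝ E * (volume : Measure E).real (ball 0 1) * (1 / 2) :=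
    ⟨_, rfl⟩
  have hmpos : 0 < m := by
    have h1 : 0 < Module.finrank ℝ E := Module.finrank_pos
    have h2 : 0 < (volume : Measure E).real (ball 0 1) :=
      ENNReal.toReal_pos (measure_ball_pos _ _ one_pos).ne' measure_ball_lt_top.ne
    rw [hm]; positivity
  have m₁ : ∫ Y : E, shellDensity E b₁ Y = m := by
    rw [integral_shellDensity fun t ht => z₁ t fun h => (h.1.trans_le ht).not_ge (by linarith), i₁,
      mul_one, hm]
  have m₂ : ∫ Y : E, shellDensity E b₂ Y = m := by
    rw [integral_shellDensity fun t ht => z₂ t fun h => (h.1.trans_le ht).not_ge (by linarith), i₂,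
      mul_one, hm]
  have jG : ∀ u : E → ℝ, Continuous u → HasCompactSupport u →
      Integrable fun Z => G Z * u (Z - X) := by
    intro u cu ku
    have := hloc.integrable_smul_left_of_hasCompactSupport
      (cu.comp (continuous_id.sub continuous_const)) (ku.comp_homeomorph (Homeomorph.subRight X))
    simpa [mul_comm] using this
  have j1 : ∀ u : E → ℝ, Continuous u → HasCompactSupport u →
      Integrable fun Z => u (Z - X) := fun u cu ku =>
    (cu.integrable_of_hasCompactSupport ku).comp_sub_right X
  have jL : ∀ u : E → ℝ, Continuous u → HasCompactSupport u →
      Integrable fun Z => (G Z + L) * u (Z - X) := by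
    intro u cu ku
    simp_rw [add_mul]
    exact (jG u cu ku).add ((j1 u cu ku).const_mul L)
  have split : ∀ u : E → ℝ, Continuous u → HasCompactSupport u → ∫ Y, u Y = m →
      ∫ Z, (G Z + L) * u (Z - X) = (∫ Z, G Z * u (Z - X)) + L * m := by
    intro u cu ku hu
    simp_rw [add_mul]
    rw [integral_add (jG u cu ku) ((j1 u cu ku).const_mul L), integral_const_mul,
      integral_sub_right_eq_self u X, hu]
  have upper : ∫ Z, (G Z + L) * shellDensity E b₂ (Z - X) ≤ κ₁ * m := by
    calc ∫ Z, (G Z + L) * shellDensity E b₂ (Z - X)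
        ≤ ∫ Z, (G Z + L) * shellDensity E b₁ (Z - X) := by
          rw [split _ cont₂ supp₂ m₂, split _ cont₁ supp₁ m₁]
          linarith
      _ ≤ ∫ Z, κ₁ * shellDensity E b₁ (Z - X) := by
          refine integral_mono (jL _ cont₁ supp₁) ((j1 _ cont₁ supp₁).const_mul _) fun Z => ?_
          by_cases hZ : dist Z X < e
          · exact mul_le_mul_of_nonneg_right (hball1 hZ).le (shellDensity_nonneg n₁ _)
          · have : shellDensity E b₁ (Z - X) = 0 := by
              refine shellDensity_eq_zero (z₁ _ fun h => ?_)
              rw [not_lt, dist_eq_norm] at hZ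
              have := pow_le_pow_left₀ he.le hZ 2
              linarith [h.2]
            simp [this]
      _ = κ₁ * m := by
          rw [integral_const_mul, integral_sub_right_eq_self (shellDensity E b₁) X, m₁]
  have nonneg : ∀ Z, Z ≠ 0 → 0 ≤ (G Z + L) * shellDensity E b₂ (Z - X) := by
    intro Z hZ
    by_cases hZ' : ‖Z‖ < r₀
    · exact mul_nonneg (by linarith [hL Z (mem_ball_zero_iff.2 hZ') hZ]) (shellDensity_nonneg n₂ _)
    · rw [shellDensity_eq_zero, mul_zero]
      refine z₂ _ fun h => ?_
      have h1 : ‖Z - X‖ < √(η ^ 2 + τ') := Real.lt_sqrt_of_sq_lt h.2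
      have h2 : ‖Z‖ ≤ ‖Z - X‖ + ‖X‖ := by simpa using norm_add_le (Z - X) X
      linarith
  have ae0 : ∀ᵐ Z : E, Z ≠ 0 := by simp [ae_iff, measure_singleton]
  have upper' : ∫⁻ Y, liftedPotential G L (X + Y) * ENNReal.ofReal (shellDensity E b₂ Y) ≤
      ENNReal.ofReal (κ₁ * m) := by
    calc ∫⁻ Y, liftedPotential G L (X + Y) * ENNReal.ofReal (shellDensity E b₂ Y)
        = ∫⁻ Z, liftedPotential G L Z * ENNReal.ofReal (shellDensity E b₂ (Z - X)) := by
          rw [← lintegral_add_left_eq_self (fun Z => liftedPotential G L Z *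
            ENNReal.ofReal (shellDensity E b₂ (Z - X))) X]
          simp only [add_sub_cancel_left]
      _ = ∫⁻ Z, ENNReal.ofReal ((G Z + L) * shellDensity E b₂ (Z - X)) := by
          refine lintegral_congr_ae ?_
          filter_upwards [ae0] with Z hZ
          rw [liftedPotential, if_neg hZ, ENNReal.ofReal_mul' (shellDensity_nonneg n₂ _)]
      _ = ENNReal.ofReal (∫ Z, (G Z + L) * shellDensity E b₂ (Z - X)) :=
          (ofReal_integral_eq_lintegral_ofReal (jL _ cont₂ supp₂) (ae0.mono nonneg)).symm
      _ ≤ _ := ENNReal.ofReal_le_ofReal upper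
  have lower : κ * ENNReal.ofReal m ≤
      ∫⁻ Y, liftedPotential G L (X + Y) * ENNReal.ofReal (shellDensity E b₂ Y) := by
    have e1 : ENNReal.ofReal m = ∫⁻ Y, ENNReal.ofReal (shellDensity E b₂ Y) := by
      rw [← m₂]
      exact ofReal_integral_eq_lintegral_ofReal (cont₂.integrable_of_hasCompactSupport supp₂)
        (Eventually.of_forall (shellDensity_nonneg n₂))
    -- In polar coordinates the shell density is constant on each sphere. Where it is nonzero, the
    -- radius is close enough to η for the spherical average to exceed κ.
    rw [e1, lintegral_eq_lintegral_sphereMeasure (by fun_prop),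
      lintegral_eq_lintegral_sphereMeasure (f := fun Y => liftedPotential G L (X + Y) *
        ENNReal.ofReal (shellDensity E b₂ Y)) ((hF.measurable.comp (measurable_const_add X)).mul
        (by fun_prop)), ← lintegral_const_mul' _ _ ENNReal.coe_ne_top]
    refine setLIntegral_mono_ae' measurableSet_Ioi (Eventually.of_forall fun r hr => ?_)
    have hr : 0 < r := hr
    rw [mul_left_comm]
    gcongr
    have hs : ∀ᵐ Y ∂sphereMeasure (0 : E) r, ENNReal.ofReal (shellDensity E b₂ Y) =
        ENNReal.ofReal ((r ^ 2) ^ (1 - (Module.finrank ℝ E : ℝ) / 2) * b₂ (r ^ 2)) := by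
      filter_upwards [ae_norm_sphereMeasure hr.le] with Y hY
      rw [shellDensity, hY]
    have hs' := hs.mono fun Y hY => congrArg (fun q => liftedPotential G L (X + Y) * q) hY
    rw [lintegral_congr_ae hs, lintegral_const, measure_univ, mul_one]
    refine le_trans ?_ (lintegral_congr_ae hs').ge
    rw [lintegral_mul_const _ (f := fun Y => liftedPotential G L (X + Y))
        (hF.measurable.comp (measurable_const_add X))]
    by_cases hrb : r ^ 2 ∈ Ioo (η ^ 2 - τ') (η ^ 2 + τ')
    · gcongr
      have := (hball (y := r ^ 2) (by
        rw [Real.dist_eq, abs_lt]; exact ⟨by linarith [hrb.1], by linarith [hrb.2]⟩)).1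
      rw [Real.sqrt_sq hr.le] at this
      exact this.le
    · simp [z₂ _ hrb]
  have final := lower.trans upper'
  rw [← ENNReal.ofReal_coe_nnreal, ← ENNReal.ofReal_mul κ.coe_nonneg,
    ENNReal.ofReal_le_ofReal_iff (by positivity)] at final
  have h3 : (κ : ℝ) ≤ κ₁ := le_of_mul_le_mul_right final hmpos
  exact hκ₁κ.not_ge (by exact_mod_cast h3)

end MeanValue

/-! ### Integrability of powers of the norm -/

section PowerIntegrals

variable {E : Type*} [NormedAddCommGroup E] [InnerProductSpace ℝ E] [FiniteDimensional ℝ E]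
  [MeasurableSpace E] [BorelSpace E] [Nontrivial E]

lemma integrableOn_ball_norm_rpow {p : ℝ} (hp : p < Module.finrank ℝ E) (r : ℝ) :
    IntegrableOn (fun X : E => ‖X‖ ^ (-p)) (ball 0 r) := by
  rw [integrableOn_fun_norm_addHaar volume (f := fun t => t ^ (-p))]
  have hD : 1 ≤ Module.finrank ℝ E := Module.finrank_pos
  rcases le_or_gt r 0 with hr | hr
  · simp [Ioo_eq_empty (not_lt.2 hr)]
  have h : IntervalIntegrable (fun t : ℝ => t ^ ((Module.finrank ℝ E : ℝ) - 1 - p)) volume 0 r :=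
    intervalIntegral.intervalIntegrable_rpow' (by linarith)
  rw [intervalIntegrable_iff_integrableOn_Ioo_of_le hr.le] at h
  refine h.congr_fun (fun t ht => ?_) measurableSet_Ioo
  simp only [smul_eq_mul]
  rw [← Real.rpow_natCast, ← Real.rpow_add ht.1, Nat.cast_sub hD]
  congr 1
  push_cast; ring

lemma integrableOn_norm_rpow_of_lt {p : ℝ} (hp : (Module.finrank ℝ E : ℝ) < p) {r : ℝ} (hr : 0 < r) :
    IntegrableOn (fun X : E => ‖X‖ ^ (-p)) {X | r ≤ ‖X‖} := by
  have hp0 : 0 < p := (Nat.cast_nonneg _).trans_lt hp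
  have h := (integrable_one_add_norm (μ := (volume : Measure E)) hp).const_mul
    ((r / (1 + r)) ^ (-p))
  refine Integrable.mono' h.integrableOn
    (by fun_prop : Measurable fun X : E => ‖X‖ ^ (-p)).aestronglyMeasurable ?_
  refine (ae_restrict_mem (measurableSet_le measurable_const measurable_norm)).mono fun X hX => ?_
  have hX : r ≤ ‖X‖ := hX
  have hX0 : 0 < ‖X‖ := hr.trans_le hX
  rw [Real.norm_of_nonneg (by positivity), ← Real.mul_rpow (by positivity) (by positivity)]
  refine Real.rpow_le_rpow_of_nonpos (by positivity) ?_ (by linarith)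
  rw [div_mul_eq_mul_div, div_le_iff₀ (by positivity)]
  nlinarith

/-- The growth allowed to the potential is matched by decay of order dimension plus one: at infinity
the exponent -(n + 1) + 1/2 is still below -n, and at the origin p < n suffices. -/
lemma integrable_growth_mul {p : ℝ} (hp0 : 0 < p) (hp : p < Module.finrank ℝ E) :
    Integrable fun X : E => (‖X‖ ^ (-p) + ‖X‖ ^ (1 / 2 : ℝ)) *
      (1 + ‖X‖) ^ (-((Module.finrank ℝ E : ℝ) + 1)) := by
  have hm : Measurable fun X : E => (‖X‖ ^ (-p) + ‖X‖ ^ (1 / 2 : ℝ)) *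
      (1 + ‖X‖) ^ (-((Module.finrank ℝ E : ℝ) + 1)) := by fun_prop
  rw [← integrableOn_univ, ← union_compl_self (ball (0 : E) 1)]
  have e : ∀ X : E, ‖(‖X‖ ^ (-p) + ‖X‖ ^ (1 / 2 : ℝ)) *
      (1 + ‖X‖) ^ (-((Module.finrank ℝ E : ℝ) + 1))‖ = (‖X‖ ^ (-p) + ‖X‖ ^ (1 / 2 : ℝ)) *
      (1 + ‖X‖) ^ (-((Module.finrank ℝ E : ℝ) + 1)) := fun X =>
    Real.norm_of_nonneg (by positivity)
  refine IntegrableOn.union ?_ ?_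
  · have h : IntegrableOn (fun X : E => ‖X‖ ^ (-p) + 1) (ball 0 1) :=
      (integrableOn_ball_norm_rpow hp 1).add (integrableOn_const measure_ball_lt_top.ne)
    refine Integrable.mono' h hm.aestronglyMeasurable ?_
    refine (ae_restrict_mem measurableSet_ball).mono fun X hX => ?_
    rw [mem_ball_zero_iff] at hX
    rw [e]
    have h1 : ‖X‖ ^ (1 / 2 : ℝ) ≤ 1 := Real.rpow_le_one (norm_nonneg _) hX.le (by norm_num)
    have h2 : (1 + ‖X‖) ^ (-((Module.finrank ℝ E : ℝ) + 1)) ≤ 1 :=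
      Real.rpow_le_one_of_one_le_of_nonpos (by linarith [norm_nonneg X])
        (by linarith [(Nat.cast_nonneg (Module.finrank ℝ E) : (0 : ℝ) ≤ _)])
    calc _ ≤ (‖X‖ ^ (-p) + ‖X‖ ^ (1 / 2 : ℝ)) * 1 := by gcongr
      _ ≤ _ := by rw [mul_one]; gcongr
  · have h := (integrable_one_add_norm (μ := (volume : Measure E))
      (show (Module.finrank ℝ E : ℝ) < Module.finrank ℝ E + 1 / 2 by linarith)).const_mul 2
    refine Integrable.mono' h.integrableOn hm.aestronglyMeasurable ?_
    refine (ae_restrict_mem measurableSet_ball.compl).mono fun X hX => ?_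
    have hX : 1 ≤ ‖X‖ := by simpa using hX
    rw [e]
    have h1 : ‖X‖ ^ (-p) ≤ (1 + ‖X‖) ^ (1 / 2 : ℝ) :=
      (Real.rpow_le_one_of_one_le_of_nonpos hX (by linarith)).trans
        (Real.one_le_rpow (by linarith) (by norm_num))
    have h2 : ‖X‖ ^ (1 / 2 : ℝ) ≤ (1 + ‖X‖) ^ (1 / 2 : ℝ) := by gcongr; linarith
    calc _ ≤ ((1 + ‖X‖) ^ (1 / 2 : ℝ) + (1 + ‖X‖) ^ (1 / 2 : ℝ)) *
          (1 + ‖X‖) ^ (-((Module.finrank ℝ E : ℝ) + 1)) := by gcongr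
      _ = _ := by
        rw [← two_mul, mul_assoc, ← Real.rpow_add (by linarith)]
        congr 2
        ring

end PowerIntegrals

/-! ### Taylor estimates -/

section Second

variable {E : Type*} [NormedAddCommGroup E] [InnerProductSpace ℝ E]

/-- First order Taylor estimate in terms of iterated derivatives. -/
lemma abs_sub_le_of_iteratedFDeriv_one {G : E → ℝ} {X Z : E} {K : ℝ}
    (hG : ∀ t ∈ Icc (0 : ℝ) 1, ContDiffAt ℝ (⊤ : ℕ∞) G (X + t • Z))
    (hK : ∀ t ∈ Icc (0 : ℝ) 1, ‖iteratedFDeriv ℝ 1 G (X + t • Z)‖ ≤ K) :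
    |G (X + Z) - G X| ≤ K * ‖Z‖ := by
  have hd : ∀ t ∈ Icc (0 : ℝ) 1, HasDerivWithinAt (fun t : ℝ => G (X + t • Z))
      (fderiv ℝ G (X + t • Z) Z) (Icc 0 1) t := by
    intro t ht
    have h1 : HasDerivAt (fun t : ℝ => X + t • Z) Z t := by
      simpa using ((hasDerivAt_id t).smul_const Z).const_add X
    exact ((((hG t ht).differentiableAt (by simp)).hasFDerivAt).comp_hasDerivAt t h1).hasDerivWithinAt
  have := norm_image_sub_le_of_norm_deriv_le_segment_01' hd (C := K * ‖Z‖) fun t ht => by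
    have ht' := Ico_subset_Icc_self ht
    refine (ContinuousLinearMap.le_opNorm _ _).trans ?_
    gcongr
    rw [← norm_iteratedFDeriv_one]
    exact hK t ht'
  simpa using this

/-- Second order Taylor estimate for symmetric differences. -/
lemma abs_symm_diff_le_of_iteratedFDeriv_two {G : E → ℝ} {X Z : E} {K : ℝ}
    (hG : ∀ t ∈ Icc (-1 : ℝ) 1, ContDiffAt ℝ (⊤ : ℕ∞) G (X + t • Z))
    (hK : ∀ t ∈ Icc (-1 : ℝ) 1, ‖iteratedFDeriv ℝ 2 G (X + t • Z)‖ ≤ K) :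
    |G (X + Z) + G (X - Z) - 2 * G X| ≤ 2 * K * ‖Z‖ ^ 2 := by
  have line : ∀ t : ℝ, HasDerivAt (fun t : ℝ => X + t • Z) Z t := fun t => by
    simpa using ((hasDerivAt_id t).smul_const Z).const_add X
  have hf : ∀ t ∈ Icc (-1 : ℝ) 1, HasDerivAt (fun t : ℝ => G (X + t • Z))
      (fderiv ℝ G (X + t • Z) Z) t := fun t ht =>
    (((hG t ht).differentiableAt (by simp)).hasFDerivAt).comp_hasDerivAt t (line t)
  have hf2 : ∀ t ∈ Icc (-1 : ℝ) 1, HasDerivWithinAt (fun t : ℝ => fderiv ℝ G (X + t • Z) Z)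
      (fderiv ℝ (fderiv ℝ G) (X + t • Z) Z Z) (Icc (-1) 1) t := fun t ht => by
    have h1 : ContDiffAt ℝ 1 (fderiv ℝ G) (X + t • Z) :=
      (hG t ht).fderiv_right (m := 1) (by
        rw [show (1 : WithTop ℕ∞) + 1 = ((2 : ℕ∞) : WithTop ℕ∞) by norm_num]
        exact_mod_cast le_top)
    have h2 := ((h1.differentiableAt (by simp)).hasFDerivAt).comp_hasDerivAt t (line t)
    have h3 := h2.clm_apply (hasDerivAt_const t Z)
    have h4 : HasDerivAt (fun t : ℝ => fderiv ℝ G (X + t • Z) Z)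
        (fderiv ℝ (fderiv ℝ G) (X + t • Z) Z Z) t := by simpa using h3
    exact h4.hasDerivWithinAt
  have bd : ∀ t ∈ Icc (-1 : ℝ) 1, ‖fderiv ℝ (fderiv ℝ G) (X + t • Z) Z Z‖ ≤ K * ‖Z‖ ^ 2 := by
    intro t ht
    have e : ‖fderiv ℝ (fderiv ℝ G) (X + t • Z)‖ = ‖iteratedFDeriv ℝ 2 G (X + t • Z)‖ := by
      rw [← norm_iteratedFDeriv_one, norm_iteratedFDeriv_fderiv]
    calc ‖fderiv ℝ (fderiv ℝ G) (X + t • Z) Z Z‖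
        ≤ ‖fderiv ℝ (fderiv ℝ G) (X + t • Z)‖ * ‖Z‖ * ‖Z‖ := ContinuousLinearMap.le_opNorm₂ _ _ _
      _ ≤ K * ‖Z‖ * ‖Z‖ := by rw [e]; gcongr; exact hK t ht
      _ = K * ‖Z‖ ^ 2 := by ring
  -- This is the derivative in t of G(X + tZ) + G(X - tZ). It is bounded by 2tK‖Z‖², and t is
  -- replaced by 1, so the final constant is not the sharp one.
  have lip : ∀ t ∈ Icc (0 : ℝ) 1, ‖fderiv ℝ G (X + t • Z) Z - fderiv ℝ G (X + (-t) • Z) Z‖ ≤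
      2 * K * ‖Z‖ ^ 2 := by
    intro t ht
    have h := (convex_Icc (-1 : ℝ) 1).norm_image_sub_le_of_norm_hasDerivWithin_le hf2 bd
      (x := -t) (y := t) ⟨by linarith [ht.2], by linarith [ht.1]⟩ ⟨by linarith [ht.1], ht.2⟩
    refine h.trans ?_
    have hK0 : 0 ≤ K * ‖Z‖ ^ 2 := (norm_nonneg _).trans (bd 0 (by norm_num))
    rw [sub_neg_eq_add, Real.norm_of_nonneg (by linarith [ht.1])]
    nlinarith [ht.2]
  have hd : ∀ t ∈ Icc (0 : ℝ) 1, HasDerivWithinAt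
      (fun t : ℝ => G (X + t • Z) + G (X + (-t) • Z))
      (fderiv ℝ G (X + t • Z) Z - fderiv ℝ G (X + (-t) • Z) Z) (Icc 0 1) t := by
    intro t ht
    have h1 := hf t ⟨by linarith [ht.1], ht.2⟩
    have h2 := (hf (-t) ⟨by linarith [ht.2], by linarith [ht.1]⟩).scomp t (hasDerivAt_neg t)
    have h3 := h1.add h2
    have h4 : HasDerivAt (fun t : ℝ => G (X + t • Z) + G (X + (-t) • Z))
        (fderiv ℝ G (X + t • Z) Z - fderiv ℝ G (X + (-t) • Z) Z) t := by
      rw [sub_eq_add_neg, ← neg_one_smul ℝ (fderiv ℝ G (X + (-t) • Z) Z)]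
      exact h3
    exact h4.hasDerivWithinAt
  have := norm_image_sub_le_of_norm_deriv_le_segment_01' hd (C := 2 * K * ‖Z‖ ^ 2)
    fun t ht => lip t (Ico_subset_Icc_self ht)
  rw [Real.norm_eq_abs] at this
  convert this using 2
  simp [← sub_eq_add_neg]
  ring

end Second

/-! ### Pointwise bounds on the potential -/

section PotentialEstimates

/-- An exponent `p > 0` such that `‖X‖ ^ (-p)` controls the singularity of the potential, also in the
logarithmic case `s = 0`. -/
noncomputable def singularExponent (s : ℝ) : ℝ :=
  open Classical in if s = 0 then 1 / 2 else s

variable {d m : ℕ} {s r₀ : ℝ} {A : ℕ → ℝ} {B C₁ C₂ c : ℝ} {g : Space d → ℝ} {G : ExtSpace d m → ℝ}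

lemma finrank_extSpace (d m : ℕ) : Module.finrank ℝ (ExtSpace d m) = d + m := by
  simp

lemma nontrivial_extSpace (hd : 1 ≤ d) : Nontrivial (ExtSpace d m) := by
  apply Module.nontrivial_of_finrank_pos (R := ℝ)
  rw [finrank_extSpace]; omega

lemma nontrivial_space (hd : 1 ≤ d) : Nontrivial (Space d) := by
  apply Module.nontrivial_of_finrank_pos (R := ℝ)
  simp; omega

lemma nonneg_of_exponent_range (hs : (max ((d : ℝ) - 2) 0 < s ∧ s < d) ∨ (d = 1 ∧ s = 0)) :
    0 ≤ s := by
  rcases hs with h | h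
  · exact (le_max_right _ _).trans h.1.le
  · exact h.2.ge

lemma singularExponent_pos (h : 0 ≤ s) : 0 < singularExponent s := by
  unfold singularExponent
  split_ifs with h0
  · norm_num
  · exact lt_of_le_of_ne h (Ne.symm h0)

lemma singularExponent_lt (hs : (max ((d : ℝ) - 2) 0 < s ∧ s < d) ∨ (d = 1 ∧ s = 0)) :
    singularExponent s < d := by
  unfold singularExponent
  rcases hs with h | ⟨rfl, rfl⟩
  · have : s ≠ 0 := ((le_max_right _ _).trans_lt h.1).ne'
    rw [if_neg this]; exact h.2
  · norm_num

lemma abs_log_le_rpow {r : ℝ} (hr : 0 < r) :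
    |Real.log r| ≤ 2 * (r ^ (-(1 / 2) : ℝ) + r ^ (1 / 2 : ℝ)) := by
  have h1 : Real.log r ≤ r ^ (1 / 2 : ℝ) / (1 / 2) := Real.log_le_rpow_div hr.le (by norm_num)
  have h2 : Real.log r⁻¹ ≤ r⁻¹ ^ (1 / 2 : ℝ) / (1 / 2) :=
    Real.log_le_rpow_div (inv_pos.2 hr).le (by norm_num)
  rw [Real.log_inv, Real.inv_rpow hr.le, ← Real.rpow_neg hr.le] at h2
  have h3 : 0 ≤ r ^ (1 / 2 : ℝ) := by positivity
  have h4 : 0 ≤ r ^ (-(1 / 2) : ℝ) := by positivity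
  rw [abs_le]
  constructor <;> linarith

lemma one_le_rpow_add {r : ℝ} (hr : 0 < r) : 1 ≤ r ^ (-(1 / 2) : ℝ) + r ^ (1 / 2 : ℝ) := by
  rcases le_total r 1 with h | h
  · have := Real.one_le_rpow_of_pos_of_le_one_of_nonpos hr h (z := -(1 / 2)) (by norm_num)
    have : 0 ≤ r ^ (1 / 2 : ℝ) := by positivity
    linarith
  · have := Real.one_le_rpow h (z := 1 / 2) (by norm_num)
    have : 0 ≤ r ^ (-(1 / 2) : ℝ) := by positivity
    linarith

namespace ExtAdmissible

variable (h : ExtAdmissible d m s r₀ A B C₁ C₂ c g G)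
include h

lemma continuousOn : ContinuousOn G {0}ᶜ := h.smooth.continuousOn

lemma contDiffAt {X : ExtSpace d m} (hX : X ≠ 0) : ContDiffAt ℝ (⊤ : ℕ∞) G X :=
  h.smooth.contDiffAt (isOpen_compl_singleton.mem_nhds hX)

lemma measurable : Measurable G := measurable_of_continuousOn_compl_singleton 0 h.continuousOn

lemma abs_le {X : ExtSpace d m} (hX : X ≠ 0) :
    |G X| ≤ |A 0| * (‖X‖ ^ (-s) + if s = 0 then |Real.log ‖X‖| else 0) := by
  have h1 := h.deriv_bound 0 X hX
  rw [norm_iteratedFDeriv_zero, Real.norm_eq_abs, Nat.cast_zero, add_zero, one_div,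
    ← Real.rpow_neg (norm_nonneg _)] at h1
  refine h1.trans ?_
  refine mul_le_mul (le_abs_self _) ?_ (by positivity) (abs_nonneg _)
  gcongr
  split_ifs with h2 h3 h3
  · exact le_rfl
  · exact absurd h2.1 h3
  · positivity
  · exact le_rfl

/-- Powers replace the logarithm: |log r| and 1 are both dominated by r^(-1/2) + r^(1/2). This form
serves the pairing with Schwartz functions. -/
lemma abs_le_growth {X : ExtSpace d m} (hX : X ≠ 0) :
    |G X| ≤ 3 * |A 0| * (‖X‖ ^ (-singularExponent s) + ‖X‖ ^ (1 / 2 : ℝ)) := by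
  have hr : 0 < ‖X‖ := norm_pos_iff.2 hX
  refine (h.abs_le hX).trans ?_
  rw [mul_comm 3, mul_assoc]
  refine mul_le_mul_of_nonneg_left ?_ (abs_nonneg _)
  unfold singularExponent
  split_ifs with h0
  · rw [h0, neg_zero, Real.rpow_zero]
    linarith [one_le_rpow_add hr, abs_log_le_rpow hr]
  · have : 0 ≤ ‖X‖ ^ (-s) := by positivity
    have : 0 ≤ ‖X‖ ^ (1 / 2 : ℝ) := by positivity
    linarith

/-- Here the logarithm is kept at infinity, so that a logarithmic moment of the measure is enough
for integrability. -/
lemma abs_le_log (hs0 : 0 ≤ s) {X : ExtSpace d m} (hX : X ≠ 0) :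
    |G X| ≤ 3 * |A 0| * ((if ‖X‖ ≤ 1 then ‖X‖ ^ (-singularExponent s) else 0) +
      (1 + if s = 0 then Real.log (1 + ‖X‖) else 0)) := by
  have hr : 0 < ‖X‖ := norm_pos_iff.2 hX
  refine (h.abs_le hX).trans ?_
  rw [mul_comm 3, mul_assoc]
  refine mul_le_mul_of_nonneg_left ?_ (abs_nonneg _)
  unfold singularExponent
  split_ifs with h0 h1 h1
  · rw [h0, neg_zero, Real.rpow_zero]
    have h2 : Real.log ‖X‖⁻¹ ≤ ‖X‖⁻¹ ^ (1 / 2 : ℝ) / (1 / 2) :=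
      Real.log_le_rpow_div (inv_pos.2 hr).le (by norm_num)
    rw [Real.log_inv, Real.inv_rpow hr.le, ← Real.rpow_neg hr.le] at h2
    have h3 : 0 ≤ ‖X‖ ^ (-(1 / 2) : ℝ) := by positivity
    have h4 : 0 ≤ Real.log (1 + ‖X‖) := Real.log_nonneg (by linarith)
    rw [abs_of_nonpos (Real.log_nonpos hr.le h1)]
    linarith
  · rw [h0, neg_zero, Real.rpow_zero]
    rw [not_le] at h1
    rw [abs_of_nonneg (Real.log_nonneg h1.le)]
    have := Real.log_le_log hr (show ‖X‖ ≤ 1 + ‖X‖ by linarith)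
    have : 0 ≤ Real.log ‖X‖ := Real.log_nonneg h1.le
    linarith
  · have : 0 ≤ ‖X‖ ^ (-s) := by positivity
    linarith
  · have := Real.rpow_le_one_of_one_le_of_nonpos (not_le.1 h1).le (neg_nonpos.2 hs0)
    linarith

lemma locallyIntegrable (hs : (max ((d : ℝ) - 2) 0 < s ∧ s < d) ∨ (d = 1 ∧ s = 0)) (hd : 1 ≤ d) :
    LocallyIntegrable G := by
  have := nontrivial_extSpace (m := m) hd
  rw [locallyIntegrable_iff]
  intro K hK
  obtain ⟨R, hR⟩ := hK.isBounded.subset_ball (0 : ExtSpace d m)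
  have hp : singularExponent s < Module.finrank ℝ (ExtSpace d m) := by
    rw [finrank_extSpace]; push_cast
    linarith [singularExponent_lt hs, (Nat.cast_nonneg m : (0 : ℝ) ≤ m)]
  have h1 : IntegrableOn (fun X : ExtSpace d m => 3 * |A 0| *
      (‖X‖ ^ (-singularExponent s) + R ^ (1 / 2 : ℝ))) (ball 0 R) :=
    ((integrableOn_ball_norm_rpow hp R).add
      (integrableOn_const measure_ball_lt_top.ne)).const_mul _
  refine IntegrableOn.mono_set ?_ hR
  refine Integrable.mono' h1 h.measurable.aestronglyMeasurable ?_
  have ae0 : ∀ᵐ Z : ExtSpace d m, Z ≠ 0 := by simp [ae_iff, measure_singleton]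
  filter_upwards [ae_restrict_mem measurableSet_ball, ae_restrict_of_ae ae0] with X hX hX0
  rw [mem_ball_zero_iff] at hX
  refine (h.abs_le_growth hX0).trans ?_
  gcongr

omit h in
/-- A bound for the potential away from the origin. -/
lemma exists_abs_le (s : ℝ) (hs0 : 0 ≤ s) (A : ℕ → ℝ) (a R : ℝ) (ha : 0 < a) :
    ∃ K : ℝ, 0 ≤ K ∧ ∀ {d m : ℕ} {r₀ B C₁ C₂ c : ℝ} {g : Space d → ℝ} {G : ExtSpace d m → ℝ},
      ExtAdmissible d m s r₀ A B C₁ C₂ c g G → ∀ X, a ≤ ‖X‖ → ‖X‖ ≤ R → |G X| ≤ K := by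
  refine ⟨3 * |A 0| * (a ^ (-singularExponent s) + |R| ^ (1 / 2 : ℝ)), by positivity, ?_⟩
  intro d m r₀ B C₁ C₂ c g G h X h1 h2
  have hX : X ≠ 0 := norm_pos_iff.1 (ha.trans_le h1)
  refine (h.abs_le_growth hX).trans ?_
  have h3 := singularExponent_pos hs0
  have h4 : ‖X‖ ^ (-singularExponent s) ≤ a ^ (-singularExponent s) :=
    Real.rpow_le_rpow_of_nonpos ha h1 (by linarith)
  have h5 : ‖X‖ ≤ |R| := h2.trans (le_abs_self _)
  gcongr

lemma exists_large (M : ℝ) (r : ℝ) (hr : 0 < r) :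
    d + m ≠ 0 → ∃ X : ExtSpace d m, X ≠ 0 ∧ ‖X‖ < r ∧ M < G X := by
  intro hdm
  have : Nontrivial (ExtSpace d m) := by
    apply Module.nontrivial_of_finrank_pos (R := ℝ)
    rw [finrank_extSpace]; omega
  have h1 : ∀ᶠ X in 𝓝[≠] (0 : ExtSpace d m), M < G X := h.tendsto_zero.eventually_gt_atTop M
  have h2 : ∀ᶠ X in 𝓝[≠] (0 : ExtSpace d m), X ∈ ball (0 : ExtSpace d m) r :=
    mem_nhdsWithin_of_mem_nhds (ball_mem_nhds _ hr)
  obtain ⟨X, hX⟩ := (h1.and (h2.and self_mem_nhdsWithin)).exists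
  exact ⟨X, hX.2.2, mem_ball_zero_iff.1 hX.2.1, hX.1⟩

/-- As G blows up at the origin, it is positive at some X and Y with 2‖X‖ ≤ ‖Y‖; then G Y < c G X
forces the sign of c. -/
lemma doubling_constant_pos (hs0 : 0 < s) (hd : 1 ≤ d) : 0 < c := by
  by_contra! hc
  have h2 := (h.doubling_pos hs0).2
  obtain ⟨Y, hY, hYr, hYG⟩ := h.exists_large 0 r₀ h.r₀_pos (by omega)
  have hY0 : 0 < ‖Y‖ := norm_pos_iff.2 hY
  obtain ⟨X, hX, hXr, hXG⟩ := h.exists_large 0 (‖Y‖ / 2) (by positivity) (by omega)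
  have := h2 X (mem_ball_zero_iff.2 (by linarith)) hX Y (mem_ball_zero_iff.2 hYr) hY (by linarith)
  nlinarith

/-- The potential is almost decreasing under doubling. -/
lemma le_add_of_two_mul_le (hs0 : 0 ≤ s) (hd : 1 ≤ d) {L : ℝ} (hL0 : 0 ≤ L) {X Y : ExtSpace d m}
    (hX : X ≠ 0) (hXL : -L ≤ G X) (hY : ‖Y‖ < r₀) (hXY : 2 * ‖X‖ ≤ ‖Y‖) : G Y ≤ G X + L := by
  have hX0 : 0 < ‖X‖ := norm_pos_iff.2 hX
  have hY0 : Y ≠ 0 := norm_pos_iff.1 (by linarith)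
  have hXb : X ∈ ball (0 : ExtSpace d m) r₀ := mem_ball_zero_iff.2 (by linarith)
  have hYb : Y ∈ ball (0 : ExtSpace d m) r₀ := mem_ball_zero_iff.2 hY
  rcases hs0.eq_or_lt with h0 | h0
  · have := (h.doubling_zero h0.symm)
    have := this.2 X hXb hX Y hYb hY0 hXY
    linarith [(h.doubling_zero h0.symm).1]
  · have hlt := (h.doubling_pos h0).2 X hXb hX Y hYb hY0 hXY
    have hc1 := (h.doubling_pos h0).1
    have hc := h.doubling_constant_pos h0 hd
    -- If G X ≤ 0 then G Y < c G X ≤ 0 ≤ G X + L; if G X > 0 then c < 1 gives G Y < G X.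
    rcases le_or_gt (G X) 0 with hG | hG <;> nlinarith

omit h in
/-- A lower bound for the potential on bounded sets. -/
lemma exists_lower_bound (d : ℕ) (s r₀ : ℝ) (hd : 1 ≤ d) (hs0 : 0 ≤ s) (A : ℕ → ℝ) (c R : ℝ) :
    ∃ L : ℝ, 0 ≤ L ∧ ∀ {m : ℕ} {B C₁ C₂ : ℝ} {g : Space d → ℝ} {G : ExtSpace d m → ℝ},
      ExtAdmissible d m s r₀ A B C₁ C₂ c g G → ∀ X, X ≠ 0 → ‖X‖ ≤ R → -L ≤ G X := by
  rcases le_or_gt r₀ 0 with hr | hr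
  · exact ⟨0, le_rfl, fun h => absurd h.r₀_pos hr.not_gt⟩
  obtain ⟨K, hK0, hK⟩ := exists_abs_le s hs0 A (r₀ / 4) (max R r₀) (by linarith)
  -- For ‖X‖ < r₀ / 4 the doubling condition compares X with a point Y of norm r₀ / 2, where |G| ≤
  -- K: G X ≥ G Y + c if s = 0, and G X > G Y / c if s > 0.
  refine ⟨K + K / |c|, by positivity, ?_⟩
  intro m B C₁ C₂ g G h X hX hXR
  have hKc : 0 ≤ K / |c| := by positivity
  rcases le_or_gt (r₀ / 4) ‖X‖ with h1 | h1
  · have := (_root_.abs_le.1 (hK h X h1 (hXR.trans (le_max_left _ _)))).1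
    linarith
  · have := nontrivial_extSpace (m := m) hd
    obtain ⟨Y, hY⟩ := exists_norm_eq (ExtSpace d m) (show 0 ≤ r₀ / 2 by linarith)
    have hY0 : Y ≠ 0 := norm_pos_iff.1 (by linarith)
    have hXb : X ∈ ball (0 : ExtSpace d m) r₀ := mem_ball_zero_iff.2 (by linarith)
    have hYb : Y ∈ ball (0 : ExtSpace d m) r₀ := mem_ball_zero_iff.2 (by linarith)
    have hGY := (_root_.abs_le.1 (hK h Y (by linarith) (by
      rw [hY]; exact (by linarith : r₀ / 2 ≤ r₀).trans (le_max_right _ _)))).1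
    rcases hs0.eq_or_lt with h0 | h0
    · have := (h.doubling_zero h0.symm).2 X hXb hX Y hYb hY0 (by linarith)
      linarith [(h.doubling_zero h0.symm).1]
    · have hc := h.doubling_constant_pos h0 hd
      have := (h.doubling_pos h0).2 X hXb hX Y hYb hY0 (by linarith)
      rw [abs_of_pos hc]
      have h3 : -K / c < G X := by rw [div_lt_iff₀ hc]; linarith
      rw [neg_div] at h3
      linarith

lemma norm_iteratedFDeriv_le {k : ℕ} (hk : 1 ≤ k) {X : ExtSpace d m} (hX : X ≠ 0) :
    ‖iteratedFDeriv ℝ k G X‖ ≤ |A k| * ‖X‖ ^ (-(s + k)) := by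
  have h1 := h.deriv_bound k X hX
  rw [if_neg (by rintro ⟨_, h2, _⟩; omega), add_zero, one_div,
    ← Real.rpow_neg (norm_nonneg _)] at h1
  refine h1.trans ?_
  gcongr
  exact le_abs_self _

omit h in
lemma norm_add_smul_ge {X Z : ExtSpace d m} (hZ : ‖Z‖ ≤ ‖X‖ / 2) {t : ℝ} (ht : |t| ≤ 1) :
    ‖X‖ / 2 ≤ ‖X + t • Z‖ := by
  have h1 : ‖t • Z‖ ≤ ‖X‖ / 2 := by
    rw [norm_smul, Real.norm_eq_abs]
    nlinarith [norm_nonneg Z, abs_nonneg t]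
  have h2 : ‖X‖ ≤ ‖X + t • Z‖ + ‖t • Z‖ := by simpa using norm_sub_le (X + t • Z) (t • Z)
  linarith

lemma norm_iteratedFDeriv_add_smul_le (hs0 : 0 ≤ s) {k : ℕ} (hk : 1 ≤ k) {X Z : ExtSpace d m}
    (hX : X ≠ 0) (hZ : ‖Z‖ ≤ ‖X‖ / 2) {t : ℝ} (ht : |t| ≤ 1) :
    ‖iteratedFDeriv ℝ k G (X + t • Z)‖ ≤ |A k| * (‖X‖ / 2) ^ (-(s + k)) := by
  have hX0 : 0 < ‖X‖ := norm_pos_iff.2 hX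
  have h1 := norm_add_smul_ge hZ ht
  have h2 : X + t • Z ≠ 0 := norm_pos_iff.1 ((half_pos hX0).trans_le h1)
  refine (h.norm_iteratedFDeriv_le hk h2).trans (mul_le_mul_of_nonneg_left ?_ (abs_nonneg _))
  have : (0 : ℝ) ≤ k := Nat.cast_nonneg k
  exact Real.rpow_le_rpow_of_nonpos (half_pos hX0) h1 (by linarith)

lemma abs_sub_le (hs0 : 0 ≤ s) {X Z : ExtSpace d m} (hX : X ≠ 0) (hZ : ‖Z‖ ≤ ‖X‖ / 2) :
    |G (X + Z) - G X| ≤ |A 1| * (‖X‖ / 2) ^ (-(s + 1)) * ‖Z‖ := by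
  have hX0 : 0 < ‖X‖ := norm_pos_iff.2 hX
  refine abs_sub_le_of_iteratedFDeriv_one (fun t ht => ?_) fun t ht => ?_
  · exact h.contDiffAt (norm_pos_iff.1 ((half_pos hX0).trans_le
      (norm_add_smul_ge hZ (_root_.abs_le.2 ⟨by linarith [ht.1], ht.2⟩))))
  · have := h.norm_iteratedFDeriv_add_smul_le hs0 (k := 1) le_rfl hX hZ (t := t)
      (_root_.abs_le.2 ⟨by linarith [ht.1], ht.2⟩)
    simpa using this

lemma abs_symm_diff_le (hs0 : 0 ≤ s) {X Z : ExtSpace d m} (hX : X ≠ 0) (hZ : ‖Z‖ ≤ ‖X‖ / 2) :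
    |G (X + Z) + G (X - Z) - 2 * G X| ≤ 2 * (|A 2| * (‖X‖ / 2) ^ (-(s + 2))) * ‖Z‖ ^ 2 := by
  have hX0 : 0 < ‖X‖ := norm_pos_iff.2 hX
  refine abs_symm_diff_le_of_iteratedFDeriv_two (fun t ht => ?_) fun t ht => ?_
  · exact h.contDiffAt (norm_pos_iff.1 ((half_pos hX0).trans_le
      (norm_add_smul_ge hZ (_root_.abs_le.2 ⟨by linarith [ht.1], ht.2⟩))))
  · have := h.norm_iteratedFDeriv_add_smul_le hs0 (k := 2) (by norm_num) hX hZ (t := t)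
      (_root_.abs_le.2 ⟨by linarith [ht.1], ht.2⟩)
    simpa using this

end ExtAdmissible

end PotentialEstimates

/-! ### Spherical averages of the potential -/

section SphereAverages

variable {d m : ℕ} {s r₀ : ℝ} {A : ℕ → ℝ} {B C₁ C₂ c : ℝ} {g : Space d → ℝ} {G : ExtSpace d m → ℝ}

lemma ofReal_le_liftedPotential {E : Type*} [NormedAddCommGroup E] (G : E → ℝ) (L : ℝ) (Z : E) :
    ENNReal.ofReal (G Z + L) ≤ liftedPotential G L Z := by
  unfold liftedPotential
  split_ifs
  · exact le_top
  · exact le_rfl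

namespace ExtAdmissible

variable (h : ExtAdmissible d m s r₀ A B C₁ C₂ c g G)
  (hs : (max ((d : ℝ) - 2) 0 < s ∧ s < d) ∨ (d = 1 ∧ s = 0)) (hd : 1 ≤ d)
include h hs hd

lemma lintegral_liftedPotential_le {L : ℝ} (hL : ∀ Z, Z ≠ 0 → ‖Z‖ < r₀ → -L ≤ G Z)
    {X : ExtSpace d m} (hX : X ≠ 0) {η : ℝ} (hη : 0 < η) (hXη : ‖X‖ + η < r₀) :
    ∫⁻ Y, liftedPotential G L (X - Y) ∂sphereMeasure (0 : ExtSpace d m) η ≤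
      ENNReal.ofReal (G X + L) := by
  have := nontrivial_extSpace (m := m) hd
  have hF := continuous_liftedPotential h.continuousOn h.tendsto_zero L
  have h1 := h.superharmonic.lintegral_sphere_le (h.locallyIntegrable hs hd) h.continuousOn
    h.tendsto_zero (fun Z hZ hZ0 => hL Z hZ0 (mem_ball_zero_iff.1 hZ)) hX hη hXη
  rw [← (measurePreserving_neg_sphereMeasure (E := ExtSpace d m) η).lintegral_comp
    (f := fun Y => liftedPotential G L (X + Y)) (hF.measurable.comp (measurable_const_add X))] at h1
  simpa [← sub_eq_add_neg] using h1

/-- Spheres are not charged at points: otherwise the mean value inequality would fail on a sphere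
through the origin. -/
lemma sphereMeasure_singleton {η : ℝ} (hη : 0 < η) (hη2 : 2 * η < r₀) (Z : ExtSpace d m) :
    sphereMeasure (0 : ExtSpace d m) η {Z} = 0 := by
  by_cases hZ : ‖Z‖ = η
  · obtain ⟨L, -, hL⟩ := exists_lower_bound d s r₀ hd (nonneg_of_exponent_range hs) A c r₀
    have hF := continuous_liftedPotential h.continuousOn h.tendsto_zero L
    -- For the sphere centred at Z, the integrand is ∞ exactly at Y = Z, while its average is
    -- finite.
    have h1 := h.lintegral_liftedPotential_le hs hd (fun Z hZ hZr => hL h Z hZ hZr.le)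
      (X := Z) (norm_pos_iff.1 (by linarith)) hη (by linarith)
    have h2 := ae_lt_top (hF.measurable.comp (measurable_const_sub Z))
      (h1.trans_lt ENNReal.ofReal_lt_top).ne
    rw [ae_iff] at h2
    refine measure_mono_null (fun Y hY => ?_) h2
    rw [mem_singleton_iff] at hY
    simp [hY, liftedPotential]
  · have h2 := ae_norm_sphereMeasure (E := ExtSpace d m) hη.le
    rw [ae_iff] at h2
    refine measure_mono_null (fun Y hY => ?_) h2
    rw [mem_singleton_iff] at hY
    rw [hY]
    exact hZ

lemma ae_sub_ne_zero {η : ℝ} (hη : 0 < η) (hη2 : 2 * η < r₀) (X : ExtSpace d m) :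
    ∀ᵐ Y ∂sphereMeasure (0 : ExtSpace d m) η, X - Y ≠ 0 := by
  rw [ae_iff]
  refine measure_mono_null (fun Y hY => ?_) (h.sphereMeasure_singleton hs hd hη hη2 X)
  simp only [ne_eq, not_not, mem_ofPred_eq] at hY
  exact (sub_eq_zero.1 hY).symm

omit h in
/-- A uniform bound for spherical averages of the potential, for radii bounded below. -/
lemma exists_lintegral_sphere_le (m : ℕ) (r₀ : ℝ) (A : ℕ → ℝ) (c η₀ R : ℝ) (hη₀ : 0 < η₀) :
    ∃ K : ℝ, 0 ≤ K ∧ ∀ {B C₁ C₂ : ℝ} {g : Space d → ℝ} {G : ExtSpace d m → ℝ},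
      ExtAdmissible d m s r₀ A B C₁ C₂ c g G → ∀ η, η₀ ≤ η → 2 * η < r₀ → ∀ X, ‖X‖ ≤ R →
      ∫⁻ Y, ENNReal.ofReal |G (X - Y)| ∂sphereMeasure (0 : ExtSpace d m) η ≤ ENNReal.ofReal K := by
  have hs0 := nonneg_of_exponent_range hs
  rcases le_or_gt r₀ 0 with hr | hr
  · exact ⟨0, le_rfl, fun h => absurd h.r₀_pos hr.not_gt⟩
  rcases lt_or_ge R 0 with hR | hR
  · exact ⟨0, le_rfl, fun h η _ _ X hX => absurd (norm_nonneg X) (by linarith)⟩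
  -- The sphere may leave B(0, r₀), where no mean value inequality is available. Scaling by t brings
  -- it inside: doubling gives G W ≤ G (t W) + L for ‖W‖ < r₀, larger W being covered by the bound
  -- K, and the mean value inequality then applies to the sphere of radius tη about tX.
  obtain ⟨t, ht, ht4, htR⟩ : ∃ t : ℝ, 0 < t ∧ t ≤ 1 / 4 ∧ t * (R + r₀) = r₀ / 4 := by
    refine ⟨r₀ / (4 * (R + r₀)), by positivity, ?_, by field_simp⟩
    rw [div_le_div_iff₀ (by positivity) (by norm_num)]
    linarith
  -- A common lower bound for the norms at which |G| ≤ K is used: η₀ / 2 when X is close to 0, t‖X‖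
  -- otherwise, and r₀.
  obtain ⟨a, ha, ha1, ha2⟩ : ∃ a : ℝ, 0 < a ∧ a ≤ t * (η₀ / 2) ∧ a ≤ r₀ :=
    ⟨min (t * (η₀ / 2)) r₀, by positivity, min_le_left _ _, min_le_right _ _⟩
  have ha3 : a ≤ η₀ / 2 := by nlinarith
  obtain ⟨L, hL0, hL⟩ := exists_lower_bound d s r₀ hd hs0 A c (R + r₀)
  obtain ⟨K, hK0, hK⟩ := ExtAdmissible.exists_abs_le s hs0 A a (R + r₀) ha
  refine ⟨K + L + (2 * L + K), by positivity, ?_⟩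
  intro B C₁ C₂ g G h η hη hη2 X hX
  have := nontrivial_extSpace (m := m) hd
  have hη0 : 0 < η := hη₀.trans_le hη
  have bound : ∀ Y : ExtSpace d m, ‖Y‖ = η → ‖X - Y‖ ≤ R + r₀ := fun Y hY =>
    (norm_sub_le _ _).trans (by linarith)
  rcases lt_or_ge ‖X‖ (η₀ / 2) with hX2 | hX2
  · calc ∫⁻ Y, ENNReal.ofReal |G (X - Y)| ∂sphereMeasure (0 : ExtSpace d m) η
        ≤ ∫⁻ Y, ENNReal.ofReal K ∂sphereMeasure (0 : ExtSpace d m) η := by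
          refine lintegral_mono_ae ?_
          filter_upwards [ae_norm_sphereMeasure hη0.le] with Y hY
          refine ENNReal.ofReal_le_ofReal (hK h _ ?_ (bound Y hY))
          have := norm_sub_norm_le Y X
          rw [norm_sub_rev] at this
          linarith
      _ = ENNReal.ofReal K := by simp
      _ ≤ _ := ENNReal.ofReal_le_ofReal (by linarith)
  · have hX0 : 0 < ‖X‖ := by linarith
    have htX : ‖t • X‖ = t * ‖X‖ := by rw [norm_smul, Real.norm_of_nonneg ht.le]
    have hF := continuous_liftedPotential h.continuousOn h.tendsto_zero L
    calc ∫⁻ Y, ENNReal.ofReal |G (X - Y)| ∂sphereMeasure (0 : ExtSpace d m) η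
        ≤ ∫⁻ Y, (liftedPotential G L (t • X - t • Y) + ENNReal.ofReal (2 * L + K))
            ∂sphereMeasure (0 : ExtSpace d m) η := by
          refine lintegral_mono_ae ?_
          filter_upwards [ae_norm_sphereMeasure hη0.le, h.ae_sub_ne_zero hs hd hη0 hη2 X] with
            Y hY hXY
          have hW := bound Y hY
          rw [← smul_sub]
          obtain ⟨W, hWe⟩ : ∃ W, W = X - Y := ⟨_, rfl⟩
          rw [← hWe] at hXY hW ⊢
          have hW0 : 0 < ‖W‖ := norm_pos_iff.2 hXY
          have htW : ‖t • W‖ = t * ‖W‖ := by rw [norm_smul, Real.norm_of_nonneg ht.le]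
          have htW0 : t • W ≠ 0 := norm_pos_iff.1 (by rw [htW]; positivity)
          have l1 := hL h W hXY hW
          have l2 := hL h (t • W) htW0 (by rw [htW]; nlinarith)
          have key : |G W| ≤ (G (t • W) + L) + (2 * L + K) := by
            rcases lt_or_ge ‖W‖ r₀ with h1 | h1
            · have := h.le_add_of_two_mul_le hs0 hd hL0 htW0 l2 h1 (by rw [htW]; nlinarith)
              rw [_root_.abs_le]
              constructor <;> linarith
            · have := hK h W (ha2.trans h1) hW
              linarith
          calc ENNReal.ofReal |G W| ≤ ENNReal.ofReal ((G (t • W) + L) + (2 * L + K)) :=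
                ENNReal.ofReal_le_ofReal key
            _ ≤ ENNReal.ofReal (G (t • W) + L) + ENNReal.ofReal (2 * L + K) :=
                ENNReal.ofReal_add_le
            _ ≤ _ := by gcongr; exact ofReal_le_liftedPotential _ _ _
      _ = (∫⁻ Y, liftedPotential G L (t • X - Y) ∂sphereMeasure (0 : ExtSpace d m) (t * η)) +
            ENNReal.ofReal (2 * L + K) := by
          rw [lintegral_add_right _ measurable_const, lintegral_const, measure_univ, mul_one,
            ← map_smul_sphereMeasure, lintegral_map (f := fun Y => liftedPotential G L (t • X - Y))
              (hF.measurable.comp (measurable_const_sub _)) (by fun_prop)]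
      _ ≤ ENNReal.ofReal (G (t • X) + L) + ENNReal.ofReal (2 * L + K) := by
          gcongr
          refine h.lintegral_liftedPotential_le hs hd (fun Z hZ hZr => hL h Z hZ (by linarith))
            (norm_pos_iff.1 (by rw [htX]; positivity)) (by positivity) ?_
          rw [htX]
          nlinarith
      _ ≤ ENNReal.ofReal (K + L) + ENNReal.ofReal (2 * L + K) := by
          gcongr
          refine (le_abs_self _).trans (hK h _ ?_ ?_)
          · rw [htX]; nlinarith
          · rw [htX]; nlinarith
      _ = _ := by rw [← ENNReal.ofReal_add (by positivity) (by positivity)]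

lemma integrable_sphere {η : ℝ} (hη : 0 < η) (hη2 : 2 * η < r₀) (X : ExtSpace d m) :
    Integrable (fun Y => G (X - Y)) (sphereMeasure (0 : ExtSpace d m) η) := by
  obtain ⟨K, -, hK⟩ := exists_lintegral_sphere_le hs hd m r₀ A c η ‖X‖ hη
  refine ⟨(h.measurable.comp (measurable_const_sub X)).aestronglyMeasurable, ?_⟩
  rw [hasFiniteIntegral_iff_norm]
  exact (hK h η le_rfl hη2 X le_rfl).trans_lt ENNReal.ofReal_lt_top

lemma abs_smeared_le {η K : ℝ} {X : ExtSpace d m} (hK : 0 ≤ K)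
    (hb : ∫⁻ Y, ENNReal.ofReal |G (X - Y)| ∂sphereMeasure (0 : ExtSpace d m) η ≤
      ENNReal.ofReal K) : |smeared G η X| ≤ K := by
  have h1 : ‖smeared G η X‖ₑ ≤ ENNReal.ofReal K := by
    refine (enorm_integral_le_lintegral_enorm _).trans (le_trans ?_ hb)
    simp_rw [← ofReal_norm, Real.norm_eq_abs]
    exact le_rfl
  rw [← ofReal_norm, Real.norm_eq_abs] at h1
  exact (ENNReal.ofReal_le_ofReal_iff hK).1 h1

/-- The mean value inequality. -/
lemma smeared_le {X : ExtSpace d m} (hX : X ≠ 0) {η : ℝ} (hη : 0 < η) (hη2 : 2 * η < r₀)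
    (hXη : ‖X‖ + η < r₀) : smeared G η X ≤ G X := by
  have := nontrivial_extSpace (m := m) hd
  obtain ⟨L, -, hL⟩ := exists_lower_bound d s r₀ hd (nonneg_of_exponent_range hs) A c r₀
  have hI := h.integrable_sphere hs hd hη hη2 X
  have h1 : ENNReal.ofReal (∫ Y, (G (X - Y) + L) ∂sphereMeasure (0 : ExtSpace d m) η) ≤
      ENNReal.ofReal (G X + L) := by
    rw [ofReal_integral_eq_lintegral_ofReal (f := fun Y => G (X - Y) + L)
      (hI.add (integrable_const L))]
    · exact (lintegral_mono fun Y => ofReal_le_liftedPotential _ _ _).trans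
        (h.lintegral_liftedPotential_le hs hd (fun Z hZ hZr => hL h Z hZ hZr.le) hX hη hXη)
    · filter_upwards [ae_norm_sphereMeasure hη.le, h.ae_sub_ne_zero hs hd hη hη2 X] with Y hY hXY
      have := hL h (X - Y) hXY ((norm_sub_le _ _).trans (by linarith))
      simp only [Pi.zero_apply]
      linarith
  have h2 : 0 ≤ G X + L := by
    have := hL h X hX (by linarith)
    linarith
  rw [ENNReal.ofReal_le_ofReal_iff h2, integral_add hI (integrable_const L)] at h1
  simp only [integral_const, probReal_univ, one_smul] at h1
  simp only [smeared]
  linarith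

/-- The smeared potential inherits lower bounds. -/
lemma neg_le_smeared {L : ℝ} {X : ExtSpace d m} {η : ℝ} (hη : 0 < η) (hη2 : 2 * η < r₀)
    (hL : ∀ Z, Z ≠ 0 → ‖Z‖ ≤ ‖X‖ + η → -L ≤ G Z) : -L ≤ smeared G η X := by
  have := nontrivial_extSpace (m := m) hd
  have h1 : ∫ Y, (-L) ∂sphereMeasure (0 : ExtSpace d m) η ≤ smeared G η X := by
    refine integral_mono_ae (integrable_const _) (h.integrable_sphere hs hd hη hη2 X) ?_
    filter_upwards [ae_norm_sphereMeasure hη.le, h.ae_sub_ne_zero hs hd hη hη2 X] with Y hY hXY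
    exact hL _ hXY ((norm_sub_le _ _).trans (by linarith))
  simpa using h1

end ExtAdmissible

end SphereAverages

/-! ### Frequency cutoffs and Schwartz functions -/

section FourierCutoff

variable {E : Type*} [NormedAddCommGroup E] [InnerProductSpace ℝ E]

/-- A smooth radial cutoff, equal to `1` for `‖Ξ‖ ≤ 1` and vanishing for `‖Ξ‖ ≥ 2`. -/
noncomputable def radialCutoff (E : Type*) [NormedAddCommGroup E] [InnerProductSpace ℝ E] (Ξ : E) : ℝ :=
  Real.smoothTransition (2 - ‖Ξ‖ ^ 2)

lemma contDiff_radialCutoff : ContDiff ℝ (⊤ : ℕ∞) (radialCutoff E) :=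
  Real.smoothTransition.contDiff.comp (contDiff_const.sub (contDiff_norm_sq ℝ))

lemma radialCutoff_nonneg (Ξ : E) : 0 ≤ radialCutoff E Ξ := Real.smoothTransition.nonneg _

lemma radialCutoff_le_one (Ξ : E) : radialCutoff E Ξ ≤ 1 := Real.smoothTransition.le_one _

lemma radialCutoff_eq_one {Ξ : E} (h : ‖Ξ‖ ≤ 1) : radialCutoff E Ξ = 1 :=
  Real.smoothTransition.one_of_one_le (by nlinarith [norm_nonneg Ξ])

lemma radialCutoff_eq_zero {Ξ : E} (h : 2 ≤ ‖Ξ‖) : radialCutoff E Ξ = 0 :=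
  Real.smoothTransition.zero_of_nonpos (by nlinarith)

lemma radialCutoff_anti {Ξ Ξ' : E} (h : ‖Ξ‖ ≤ ‖Ξ'‖) : radialCutoff E Ξ' ≤ radialCutoff E Ξ :=
  Real.smoothTransition.monotone (by nlinarith [norm_nonneg Ξ])

/-- The cutoff at frequency scale `1 / r`, as a Schwartz function. -/
noncomputable def cutoffSchwartz (E : Type*) [NormedAddCommGroup E] [InnerProductSpace ℝ E]
    [FiniteDimensional ℝ E] (r : ℝ) (hr : r ≠ 0) : 𝓢(E, ℂ) :=
  HasCompactSupport.toSchwartzMap (f := fun Ξ : E => (radialCutoff E (r • Ξ) : ℂ))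
    (HasCompactSupport.intro (isCompact_closedBall (0 : E) (2 / |r|)) fun Ξ hΞ => by
      rw [mem_closedBall_zero_iff, not_le, div_lt_iff₀ (abs_pos.2 hr)] at hΞ
      rw [radialCutoff_eq_zero, Complex.ofReal_zero]
      rw [norm_smul, Real.norm_eq_abs, mul_comm]
      exact hΞ.le)
    (Complex.ofRealCLM.contDiff.comp (contDiff_radialCutoff.comp (contDiff_const_smul r)))

end FourierCutoff

section FourierCutoffIntegral

variable {E : Type*} [NormedAddCommGroup E] [InnerProductSpace ℝ E] [FiniteDimensional ℝ E]
  [MeasurableSpace E] [BorelSpace E]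

lemma cutoffSchwartz_apply (r : ℝ) (hr : r ≠ 0) (Ξ : E) :
    cutoffSchwartz E r hr Ξ = (radialCutoff E (r • Ξ) : ℂ) := rfl

lemma fourierInv_cutoffSchwartz (r : ℝ) (hr : 0 < r) (X : E) :
    𝓕⁻ (cutoffSchwartz E r hr.ne') X =
      ((r⁻¹ ^ Module.finrank ℝ E : ℝ) : ℂ) * 𝓕⁻ (cutoffSchwartz E 1 one_ne_zero) (r⁻¹ • X) := by
  rw [SchwartzMap.fourierInv_coe, SchwartzMap.fourierInv_coe, Real.fourierInv_eq,
    Real.fourierInv_eq]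
  have := Measure.integral_comp_smul (volume : Measure E) (fun v : E =>
    Real.fourierChar (inner ℝ v (r⁻¹ • X)) • (cutoffSchwartz E 1 one_ne_zero) v) r
  have h1 : ∀ v : E, inner ℝ (r • v) (r⁻¹ • X) = inner ℝ v X := fun v => by
    rw [real_inner_smul_left, real_inner_smul_right, mul_inv_cancel_left₀ hr.ne']
  simp only [h1, cutoffSchwartz_apply, one_smul] at this ⊢
  rw [this, abs_of_pos (by positivity), Complex.real_smul, inv_pow]

/-- Increments of Schwartz functions decay rapidly. -/
lemma SchwartzMap.exists_norm_sub_le (k : 𝓢(E, ℂ)) (N : ℕ) :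
    ∃ C : ℝ, 0 ≤ C ∧ ∀ u v : E, ‖v‖ ≤ 1 / 2 → ‖k (u + v) - k u‖ ≤ C * ‖v‖ / (1 + ‖u‖) ^ N := by
  refine ⟨2 ^ N * (2 ^ N * (Finset.Iic (N, 1)).sup
    (fun m => SchwartzMap.seminorm ℝ m.1 m.2) k), by positivity, ?_⟩
  intro u v hv
  set M := 2 ^ N * (Finset.Iic (N, 1)).sup (fun m => SchwartzMap.seminorm ℝ m.1 m.2) k with hM
  have hseg : ∀ x ∈ segment ℝ u (u + v), ‖fderiv ℝ k x‖ ≤ 2 ^ N * M / (1 + ‖u‖) ^ N := by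
    intro x hx
    have h1 := SchwartzMap.one_add_le_sup_seminorm_apply (𝕜 := ℝ) (m := (N, 1)) (k := N) (n := 1)
      le_rfl le_rfl k x
    rw [norm_iteratedFDeriv_one] at h1
    have hx2 : ‖x - u‖ ≤ 1 / 2 := by
      rw [segment_eq_image'] at hx
      obtain ⟨t, ht, rfl⟩ := hx
      rw [add_sub_cancel_left, add_sub_cancel_left, norm_smul, Real.norm_of_nonneg ht.1]
      nlinarith [norm_nonneg v, ht.2]
    have h2 : (1 + ‖u‖) / 2 ≤ 1 + ‖x‖ := by
      have : ‖u‖ ≤ ‖x‖ + ‖x - u‖ := by simpa using norm_sub_le x (x - u)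
      linarith [norm_nonneg u]
    rw [le_div_iff₀ (by positivity)]
    calc ‖fderiv ℝ k x‖ * (1 + ‖u‖) ^ N
        = 2 ^ N * (((1 + ‖u‖) / 2) ^ N * ‖fderiv ℝ k x‖) := by
          rw [div_pow]; field_simp
      _ ≤ 2 ^ N * ((1 + ‖x‖) ^ N * ‖fderiv ℝ k x‖) := by gcongr
      _ ≤ 2 ^ N * M := by gcongr
  have := (convex_segment u (u + v)).norm_image_sub_le_of_norm_fderiv_le (𝕜 := ℝ) (f := k)
    (fun x _ => k.differentiableAt) hseg (left_mem_segment _ _ _) (right_mem_segment _ _ _)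
  rw [add_sub_cancel_left] at this
  refine this.trans (le_of_eq ?_)
  ring

lemma SchwartzMap.fourier_fourier_apply (f : 𝓢(E, ℂ)) (X : E) : 𝓕 (𝓕 f) X = f (-X) := by
  have h1 : 𝓕⁻ (𝓕 f) (-X) = f (-X) := by rw [FourierTransform.fourierInv_fourier_eq]
  rw [← h1, SchwartzMap.fourierInv_apply_eq]
  simp

lemma SchwartzMap.fourier_compSubConst_apply (f : 𝓢(E, ℂ)) (a Ξ : E) :
    𝓕 (f.compSubConstCLM ℂ a) Ξ =
      Complex.exp (-(2 * Real.pi * inner ℝ a Ξ : ℝ) * Complex.I) * 𝓕 f Ξ := by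
  rw [SchwartzMap.fourier_coe, SchwartzMap.fourier_coe, Real.fourier_eq, Real.fourier_eq,
    ← integral_const_mul, ← integral_sub_right_eq_self (μ := (volume : Measure E)) (fun v => _ * _) a]
  refine integral_congr_ae (Eventually.of_forall fun v => ?_)
  simp only [SchwartzMap.compSubConstCLM_apply, Circle.smul_def, Real.fourierChar_apply, smul_eq_mul]
  rw [← mul_assoc, ← Complex.exp_add]
  congr 2
  rw [inner_sub_left]
  push_cast
  ring

end FourierCutoffIntegral

/-! ### Fourier representation of the increments of the potential -/

section PositiveFourierPair

variable {E : Type*} [NormedAddCommGroup E] [InnerProductSpace ℝ E] [FiniteDimensional ℝ E]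
  [MeasurableSpace E] [BorelSpace E]

/-- An even potential `G` of moderate growth whose Fourier transform away from the origin is the
nonnegative function `h`. -/
structure PositiveFourierPair (G h : E → ℝ) (K p : ℝ) : Prop where
  measurable : Measurable G
  even : ∀ X, X ≠ 0 → G X = G (-X)
  exponent_pos : 0 < p
  exponent_lt : p < Module.finrank ℝ E
  growth : ∀ X, X ≠ 0 → |G X| ≤ K * (‖X‖ ^ (-p) + ‖X‖ ^ (1 / 2 : ℝ))
  measurable_symbol : Measurable h
  symbol_nonneg : ∀ Ξ, Ξ ≠ 0 → 0 ≤ h Ξ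
  symbol_bound : ∀ δ : ℝ, 0 < δ → ∃ C : ℝ, ∀ Ξ, δ ≤ ‖Ξ‖ → h Ξ ≤ C
  fourier : FourierTransformAwayFromZero G h

/-- The convolution of a Schwartz difference with the inverse transform of the cutoff. -/
lemma exists_norm_convolution_cutoff_le (R : 𝓢(E, ℂ)) (hR : ∀ X, 1 < ‖X‖ → R X = 0) (a : E) :
    ∃ C : ℝ, 0 ≤ C ∧ ∀ r : ℝ, ∀ hr : 0 < r, 2 ≤ r → 2 * ‖a‖ ≤ r → ∀ X : E,
      ‖SchwartzMap.convolution (ContinuousLinearMap.mul ℂ ℂ) (R.compSubConstCLM ℂ a - R)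
        (𝓕⁻ (cutoffSchwartz E r hr.ne')) X‖ ≤ C / (r + ‖X‖) ^ (Module.finrank ℝ E + 1) := by
  set D := Module.finrank ℝ E with hD
  obtain ⟨C, hC0, hC⟩ := SchwartzMap.exists_norm_sub_le (𝓕⁻ (cutoffSchwartz E 1 one_ne_zero))
    (D + 1)
  refine ⟨∫ t, ‖R t‖ * (2 ^ (D + 1) * (C * ‖a‖)), integral_nonneg fun t => by positivity, ?_⟩
  intro r hr hr2 hra X
  set k := 𝓕⁻ (cutoffSchwartz E r hr.ne') with hk
  have hkint : ∀ (f : 𝓢(E, ℂ)) (Y : E), Integrable fun t => f t * k (Y - t) := by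
    intro f Y
    obtain ⟨M, hM⟩ := k.toBoundedContinuousFunction.bddAbove_range_norm_comp
    refine f.integrable.mul_bdd (c := M) ?_ (Eventually.of_forall fun t => ?_)
    · exact (k.continuous.comp (continuous_const.sub continuous_id)).aestronglyMeasurable
    · exact hM ⟨Y - t, rfl⟩
  -- The difference is moved from R onto the kernel k, which varies at scale r. Its increments gain
  -- a factor ‖a‖ / r, raising the decay from order D to D + 1.
  have e1 : SchwartzMap.convolution (ContinuousLinearMap.mul ℂ ℂ) (R.compSubConstCLM ℂ a - R) k X
      = ∫ t, R t * (k (X - t - a) - k (X - t)) := by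
    rw [SchwartzMap.convolution_apply, convolution_def]
    simp only [sub_apply, SchwartzMap.compSubConstCLM_apply,
      ContinuousLinearMap.mul_apply', sub_mul, mul_sub]
    have h1 : Integrable fun t => R (t - a) * k (X - t) := hkint (R.compSubConstCLM ℂ a) X
    have h2 : Integrable fun t => R t * k (X - t - a) := by
      have := hkint R (X - a)
      refine this.congr (Eventually.of_forall fun t => ?_)
      simp only [sub_right_comm]
    rw [integral_sub h1 (hkint R X), integral_sub h2 (hkint R X)]
    congr 1
    rw [← integral_add_right_eq_self (fun t => R (t - a) * k (X - t)) a]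
    refine integral_congr_ae (Eventually.of_forall fun t => ?_)
    simp only [add_sub_cancel_right, sub_sub]
  rw [e1, ← integral_div]
  refine norm_integral_le_of_norm_le ?_ (Eventually.of_forall fun t => ?_)
  · exact (R.integrable.norm.mul_const _).div_const _
  by_cases ht : 1 < ‖t‖
  · simp [hR t ht]
  rw [not_lt] at ht
  rw [norm_mul, mul_div_assoc]
  gcongr
  have h2 := hC (r⁻¹ • (X - t)) (r⁻¹ • (-a)) (by
    rw [norm_smul, norm_neg, norm_inv, Real.norm_of_nonneg hr.le, inv_mul_le_iff₀ hr]; linarith)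
  rw [hk, fourierInv_cutoffSchwartz r hr, fourierInv_cutoffSchwartz r hr, ← mul_sub, norm_mul,
    Complex.norm_real, Real.norm_of_nonneg (by positivity), ← hD, sub_eq_add_neg (X - t) a, smul_add]
  rw [norm_smul, norm_smul, norm_neg, norm_inv, Real.norm_of_nonneg hr.le] at h2
  -- Here ‖t‖ ≤ 1 by the support of R, and r ≥ 2.
  have h3 : (r + ‖X‖) / 2 ≤ r + ‖X - t‖ := by
    have : ‖X‖ ≤ ‖X - t‖ + ‖t‖ := by simpa using norm_add_le (X - t) t
    linarith [norm_nonneg (X - t)]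
  have h4 : 1 + r⁻¹ * ‖X - t‖ = r⁻¹ * (r + ‖X - t‖) := by field_simp
  calc r⁻¹ ^ D * _ ≤ r⁻¹ ^ D * (C * (r⁻¹ * ‖a‖) / (1 + r⁻¹ * ‖X - t‖) ^ (D + 1)) := by gcongr
    _ = C * ‖a‖ / (r + ‖X - t‖) ^ (D + 1) := by
        rw [h4, mul_pow, inv_pow, inv_pow, pow_succ r]; field_simp
    _ ≤ C * ‖a‖ / ((r + ‖X‖) / 2) ^ (D + 1) := by gcongr
    _ = _ := by rw [div_pow]; field_simp

namespace PositiveFourierPair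

variable {G h : E → ℝ} {K p : ℝ} (H : PositiveFourierPair G h K p)
include H

lemma ae_abs_le [Nontrivial E] : ∀ᵐ X : E, |G X| ≤ K * (‖X‖ ^ (-p) + ‖X‖ ^ (1 / 2 : ℝ)) := by
  filter_upwards [compl_mem_ae_iff.2 (measure_singleton (0 : E))] with X hX
  exact H.growth X hX

lemma integrable_mul_bound [Nontrivial E] : Integrable fun X : E =>
    |G X| * (1 / (1 + ‖X‖) ^ (Module.finrank ℝ E + 1)) := by
  refine (((integrable_growth_mul (E := E) H.exponent_pos H.exponent_lt)).const_mul K).mono'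
    (by have := H.measurable; fun_prop) ?_
  filter_upwards [H.ae_abs_le] with X hX
  rw [Real.norm_of_nonneg (by positivity), ← mul_assoc]
  refine mul_le_mul hX (le_of_eq ?_) (by positivity) ((abs_nonneg _).trans hX)
  rw [Real.rpow_neg (by positivity), one_div]
  norm_cast

lemma integrable_mul_schwartz [Nontrivial E] (f : 𝓢(E, ℂ)) :
    Integrable fun X => (G X : ℂ) * f X := by
  set C := 2 ^ (Module.finrank ℝ E + 1) * (Finset.Iic (Module.finrank ℝ E + 1, 0)).sup
    (fun m => SchwartzMap.seminorm ℝ m.1 m.2) f with hC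
  refine (H.integrable_mul_bound.mul_const C).mono' ?_ (Eventually.of_forall fun X => ?_)
  · have := H.measurable
    have := f.continuous.measurable
    fun_prop
  have h1 := SchwartzMap.one_add_le_sup_seminorm_apply (𝕜 := ℝ) (m := (Module.finrank ℝ E + 1, 0))
    (k := Module.finrank ℝ E + 1) (n := 0) le_rfl le_rfl f X
  rw [norm_iteratedFDeriv_zero, ← hC] at h1
  rw [norm_mul, Complex.norm_real, Real.norm_eq_abs, mul_assoc]
  gcongr
  rw [one_div, ← div_eq_inv_mul, le_div_iff₀ (by positivity), mul_comm]
  exact h1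

end PositiveFourierPair

end PositiveFourierPair

section FourierSymbol

variable {E : Type*} [NormedAddCommGroup E] [InnerProductSpace ℝ E] [FiniteDimensional ℝ E]
  [MeasurableSpace E] [BorelSpace E] [Nontrivial E]

lemma SchwartzMap.fourier_sub (f g : 𝓢(E, ℂ)) : 𝓕 (f - g) = 𝓕 f - 𝓕 g :=
  map_sub (FourierTransform.fourierCLM ℂ 𝓢(E, ℂ)) f g

namespace PositiveFourierPair

variable {G h : E → ℝ} {K p : ℝ} (H : PositiveFourierPair G h K p)
include H

lemma integral_mul_neg (f : 𝓢(E, ℂ)) : ∫ X, (G X : ℂ) * f (-X) = ∫ X, (G X : ℂ) * f X := by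
  rw [← integral_neg_eq_self]
  refine integral_congr_ae ?_
  filter_upwards [compl_mem_ae_iff.2 (measure_singleton (0 : E))] with X hX
  simp only [neg_neg]
  rw [← H.even X hX]

/-- With low frequencies removed, the test function has a transform vanishing near 0, so the
hypothesis on the transform of G applies. The real part of e^(-2πi a·Ξ) - 1 supplies the factor 1 -
cos, and every factor of the integrand is nonnegative. -/
lemma lintegral_symbol_cutoff (R : 𝓢(E, ℂ)) {φ : E → ℝ} (hφ : ∀ Ξ, 𝓕 R Ξ = φ Ξ)
    (hφ0 : ∀ Ξ, 0 ≤ φ Ξ) (a : E) (r : ℝ) (hr : 0 < r) :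
    0 ≤ (-∫ X, (G X : ℂ) * ((R.compSubConstCLM ℂ a - R) - SchwartzMap.convolution
      (ContinuousLinearMap.mul ℂ ℂ) (R.compSubConstCLM ℂ a - R)
        (𝓕⁻ (cutoffSchwartz E r hr.ne'))) X).re ∧
    ∫⁻ Ξ, ENNReal.ofReal (h Ξ * ((1 - radialCutoff E (r • Ξ)) * (φ Ξ *
      (1 - Real.cos (2 * Real.pi * inner ℝ a Ξ))))) =
      ENNReal.ofReal (-∫ X, (G X : ℂ) * ((R.compSubConstCLM ℂ a - R) - SchwartzMap.convolution
        (ContinuousLinearMap.mul ℂ ℂ) (R.compSubConstCLM ℂ a - R)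
          (𝓕⁻ (cutoffSchwartz E r hr.ne'))) X).re := by
  set S := (R.compSubConstCLM ℂ a - R) - SchwartzMap.convolution
        (ContinuousLinearMap.mul ℂ ℂ) (R.compSubConstCLM ℂ a - R)
          (𝓕⁻ (cutoffSchwartz E r hr.ne')) with hS
  have hT : ∀ Ξ, 𝓕 S Ξ = ((1 - radialCutoff E (r • Ξ) : ℝ) : ℂ) *
      ((Complex.exp (-(2 * Real.pi * inner ℝ a Ξ : ℝ) * Complex.I) - 1) * φ Ξ) := by
    intro Ξ
    rw [hS, SchwartzMap.fourier_sub, SchwartzMap.fourier_convolution,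
      FourierTransform.fourier_fourierInv_eq, SchwartzMap.fourier_sub, sub_apply,
      SchwartzMap.pairing_apply_apply, sub_apply, SchwartzMap.fourier_compSubConst_apply, hφ,
      cutoffSchwartz_apply]
    simp only [ContinuousLinearMap.mul_apply']
    push_cast
    ring
  have hT0 : ∀ Ξ : E, ‖Ξ‖ < r⁻¹ → 𝓕 S Ξ = 0 := by
    intro Ξ hΞ
    rw [hT, radialCutoff_eq_one]
    · simp
    · rw [norm_smul, Real.norm_of_nonneg hr.le]
      have := mul_lt_mul_of_pos_left hΞ hr
      rw [mul_inv_cancel₀ hr.ne'] at this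
      exact this.le
  have hsupp : (0 : E) ∉ tsupport (𝓕 S : 𝓢(E, ℂ)) := by
    rw [notMem_tsupport_iff_eventuallyEq]
    filter_upwards [ball_mem_nhds (0 : E) (inv_pos.2 hr)] with Ξ hΞ
    exact hT0 Ξ (mem_ball_zero_iff.1 hΞ)
  -- Testing against 𝓕 S produces 𝓕 (𝓕 S), the reflection of S; evenness of G undoes the reflection.
  have hFT := H.fourier (𝓕 S) hsupp
  simp_rw [SchwartzMap.fourier_fourier_apply] at hFT
  rw [H.integral_mul_neg] at hFT
  rw [hFT]
  obtain ⟨C, hC⟩ := H.symbol_bound r⁻¹ (inv_pos.2 hr)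
  have hint : Integrable fun Ξ => (h Ξ : ℂ) * 𝓕 S Ξ := by
    refine ((𝓕 S).integrable.norm.const_mul |C|).mono' ?_ (Eventually.of_forall fun Ξ => ?_)
    · have := H.measurable_symbol
      have := (𝓕 S).continuous.measurable
      fun_prop
    · rw [norm_mul, Complex.norm_real]
      by_cases hΞ : ‖Ξ‖ < r⁻¹
      · rw [hT0 Ξ hΞ]; simp
      rw [not_lt] at hΞ
      have hΞ0 : Ξ ≠ 0 := norm_pos_iff.1 ((inv_pos.2 hr).trans_le hΞ)
      rw [Real.norm_of_nonneg (H.symbol_nonneg Ξ hΞ0)]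
      gcongr
      exact (hC Ξ hΞ).trans (le_abs_self C)
  have hre : ∀ Ξ, ((h Ξ : ℂ) * 𝓕 S Ξ).re = -(h Ξ * ((1 - radialCutoff E (r • Ξ)) * (φ Ξ *
      (1 - Real.cos (2 * Real.pi * inner ℝ a Ξ))))) := by
    intro Ξ
    rw [hT, ← Complex.ofReal_neg, Complex.exp_ofReal_mul_I, Real.cos_neg]
    simp only [Complex.mul_re, Complex.ofReal_re, Complex.ofReal_im, Complex.sub_re,
      Complex.add_re, Complex.one_re, Complex.I_re, Complex.I_im, Complex.mul_im]
    ring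
  have hri : (-∫ Ξ, (h Ξ : ℂ) * 𝓕 S Ξ).re = ∫ Ξ, h Ξ * ((1 - radialCutoff E (r • Ξ)) * (φ Ξ *
      (1 - Real.cos (2 * Real.pi * inner ℝ a Ξ)))) := by
    rw [Complex.neg_re]
    have := integral_re hint
    simp only [RCLike.re_to_complex] at this
    rw [← this, ← integral_neg]
    refine integral_congr_ae (Eventually.of_forall fun Ξ => ?_)
    simp only [hre, neg_neg]
  have hnn : 0 ≤ᵐ[volume] fun Ξ => h Ξ * ((1 - radialCutoff E (r • Ξ)) * (φ Ξ *
      (1 - Real.cos (2 * Real.pi * inner ℝ a Ξ)))) := by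
    filter_upwards [compl_mem_ae_iff.2 (measure_singleton (0 : E))] with Ξ hΞ
    have := Real.cos_le_one (2 * Real.pi * inner ℝ a Ξ)
    have := radialCutoff_le_one (r • Ξ)
    exact mul_nonneg (H.symbol_nonneg Ξ hΞ) (mul_nonneg (by linarith)
      (mul_nonneg (hφ0 Ξ) (by linarith)))
  refine ⟨by rw [hri]; exact integral_nonneg_of_ae hnn, ?_⟩
  rw [hri, ofReal_integral_eq_lintegral_ofReal _ hnn]
  have := hint.re.neg
  refine this.congr (Eventually.of_forall fun Ξ => ?_)
  simp only [RCLike.re_to_complex, Pi.neg_apply, hre, neg_neg]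

/-- The removed low frequencies contribute nothing in the limit, so nothing concentrated at
frequency 0 is visible to increments. The bound C / (r + ‖X‖)^(D+1) tends to 0 pointwise and is
dominated by a weight against which |G| is integrable. -/
lemma tendsto_integral_convolution (R : 𝓢(E, ℂ)) (hR : ∀ X, 1 < ‖X‖ → R X = 0) (a : E) :
    Tendsto (fun n : ℕ => ∫ X, (G X : ℂ) * SchwartzMap.convolution
      (ContinuousLinearMap.mul ℂ ℂ) (R.compSubConstCLM ℂ a - R)
        (𝓕⁻ (cutoffSchwartz E ((n : ℝ) + 1) n.cast_add_one_pos.ne')) X) atTop (𝓝 0) := by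
  obtain ⟨C, hC0, hC⟩ := exists_norm_convolution_cutoff_le R hR a
  set D := Module.finrank ℝ E with hD
  have hle : ∀ᶠ n : ℕ in atTop, ∀ X : E, ‖SchwartzMap.convolution
      (ContinuousLinearMap.mul ℂ ℂ) (R.compSubConstCLM ℂ a - R)
        (𝓕⁻ (cutoffSchwartz E ((n : ℝ) + 1) n.cast_add_one_pos.ne')) X‖ ≤
      C / ((n : ℝ) + 1 + ‖X‖) ^ (D + 1) := by
    filter_upwards [tendsto_natCast_atTop_atTop.eventually (eventually_ge_atTop (max 2 (2 * ‖a‖)))]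
      with n hn X
    exact hC (n + 1) n.cast_add_one_pos (by linarith [le_max_left 2 (2 * ‖a‖)])
      (by linarith [le_max_right 2 (2 * ‖a‖)]) X
  have h0 : (0 : ℂ) = ∫ X : E, (0 : ℂ) := by simp
  rw [h0]
  refine tendsto_integral_filter_of_dominated_convergence
    (fun X => |G X| * (1 / (1 + ‖X‖) ^ (D + 1)) * C)
    (Eventually.of_forall fun n => ?_) ?_ (H.integrable_mul_bound.mul_const C) ?_
  · exact (H.integrable_mul_schwartz _).aestronglyMeasurable
  · filter_upwards [hle] with n hn
    refine Eventually.of_forall fun X => ?_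
    rw [norm_mul, Complex.norm_real, Real.norm_eq_abs, mul_assoc]
    gcongr
    refine (hn X).trans ?_
    rw [one_div, ← div_eq_inv_mul]
    gcongr
    linarith [n.cast_nonneg (α := ℝ)]
  · refine Eventually.of_forall fun X => ?_
    rw [← mul_zero (G X : ℂ)]
    refine Tendsto.const_mul _ (squeeze_zero_norm' (hle.mono fun n hn => hn X) ?_)
    refine Tendsto.div_atTop tendsto_const_nhds ?_
    refine (tendsto_pow_atTop (Nat.succ_ne_zero D)).comp ?_
    refine tendsto_atTop_add_const_right _ _ (tendsto_atTop_add_const_right _ _ ?_)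
    exact tendsto_natCast_atTop_atTop

/-- The Fourier representation of the increments of the mollified potential. -/
theorem lintegral_symbol (R : 𝓢(E, ℂ)) (hR : ∀ X, 1 < ‖X‖ → R X = 0) {ρ φ : E → ℝ}
    (hρ : ∀ X, R X = ρ X) (hφ : ∀ Ξ, 𝓕 R Ξ = φ Ξ) (hφ0 : ∀ Ξ, 0 ≤ φ Ξ) (a : E) :
    0 ≤ (∫ X, G X * ρ X) - ∫ X, G X * ρ (X - a) ∧
    ∫⁻ Ξ, ENNReal.ofReal (h Ξ * (φ Ξ * (1 - Real.cos (2 * Real.pi * inner ℝ a Ξ)))) =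
      ENNReal.ofReal ((∫ X, G X * ρ X) - ∫ X, G X * ρ (X - a)) := by
  have hcomp : ∀ r : ℝ, ∀ hr : 0 < r, (-∫ X, (G X : ℂ) * ((R.compSubConstCLM ℂ a - R) -
      SchwartzMap.convolution (ContinuousLinearMap.mul ℂ ℂ) (R.compSubConstCLM ℂ a - R)
        (𝓕⁻ (cutoffSchwartz E r hr.ne'))) X).re = ((∫ X, G X * ρ X) - ∫ X, G X * ρ (X - a)) +
      (∫ X, (G X : ℂ) * SchwartzMap.convolution (ContinuousLinearMap.mul ℂ ℂ)
        (R.compSubConstCLM ℂ a - R) (𝓕⁻ (cutoffSchwartz E r hr.ne')) X).re := by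
    intro r hr
    simp only [sub_apply, mul_sub]
    rw [integral_sub (f := fun X => (G X : ℂ) * R.compSubConstCLM ℂ a X - G X * R X)
      ((H.integrable_mul_schwartz _).sub (H.integrable_mul_schwartz _))
      (H.integrable_mul_schwartz _), integral_sub (H.integrable_mul_schwartz _)
      (H.integrable_mul_schwartz _)]
    simp only [SchwartzMap.compSubConstCLM_apply, hρ, ← Complex.ofReal_mul,
      Complex.neg_re, Complex.sub_re]
    simp only [integral_complex_ofReal, Complex.ofReal_re]
    ring
  have hlim : Tendsto (fun n : ℕ => (-∫ X, (G X : ℂ) * ((R.compSubConstCLM ℂ a - R) -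
      SchwartzMap.convolution (ContinuousLinearMap.mul ℂ ℂ) (R.compSubConstCLM ℂ a - R)
        (𝓕⁻ (cutoffSchwartz E ((n : ℝ) + 1) n.cast_add_one_pos.ne'))) X).re) atTop
      (𝓝 ((∫ X, G X * ρ X) - ∫ X, G X * ρ (X - a))) := by
    simp_rw [fun n : ℕ => hcomp ((n : ℝ) + 1) n.cast_add_one_pos]
    have := (Complex.continuous_re.tendsto 0).comp (H.tendsto_integral_convolution R hR a)
    simpa using this.const_add ((∫ X, G X * ρ X) - ∫ X, G X * ρ (X - a))
  have hcut := fun n : ℕ =>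
    H.lintegral_symbol_cutoff R hφ hφ0 a ((n : ℝ) + 1) n.cast_add_one_pos
  refine ⟨ge_of_tendsto' hlim fun n => (hcut n).1, ?_⟩
  have hlim2 := (ENNReal.continuous_ofReal.tendsto _).comp hlim
  refine tendsto_nhds_unique ?_ hlim2
  have hφm : Measurable φ := by
    have h1 : φ = fun Ξ => (𝓕 R Ξ).re := by ext Ξ; rw [hφ, Complex.ofReal_re]
    rw [h1]
    exact (Complex.continuous_re.comp (𝓕 R).continuous).measurable
  have hrm : Measurable (radialCutoff E) := contDiff_radialCutoff.continuous.measurable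
  have hhm := H.measurable_symbol
  have key : Tendsto (fun n : ℕ => ∫⁻ Ξ, ENNReal.ofReal (h Ξ *
      ((1 - radialCutoff E (((n : ℝ) + 1) • Ξ)) * (φ Ξ *
      (1 - Real.cos (2 * Real.pi * inner ℝ a Ξ)))))) atTop
      (𝓝 (∫⁻ Ξ, ENNReal.ofReal (h Ξ * (φ Ξ * (1 - Real.cos (2 * Real.pi * inner ℝ a Ξ)))))) := by
    refine lintegral_tendsto_of_tendsto_of_monotone (fun n => ?_) ?_ ?_
    · fun_prop
    · filter_upwards [compl_mem_ae_iff.2 (measure_singleton (0 : E))] with Ξ hΞ n n' hn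
      have := Real.cos_le_one (2 * Real.pi * inner ℝ a Ξ)
      have h1 : radialCutoff E (((n' : ℝ) + 1) • Ξ) ≤ radialCutoff E (((n : ℝ) + 1) • Ξ) := by
        refine radialCutoff_anti ?_
        rw [norm_smul, norm_smul, Real.norm_of_nonneg n.cast_add_one_pos.le,
          Real.norm_of_nonneg n'.cast_add_one_pos.le]
        gcongr
      have h2 := H.symbol_nonneg Ξ hΞ
      have h3 := hφ0 Ξ
      have h4 : 0 ≤ φ Ξ * (1 - Real.cos (2 * Real.pi * inner ℝ a Ξ)) := mul_nonneg h3 (by linarith)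
      simp only
      gcongr
    · filter_upwards [compl_mem_ae_iff.2 (measure_singleton (0 : E))] with Ξ hΞ
      refine tendsto_const_nhds.congr' ?_
      have hΞ' : 0 < ‖Ξ‖ := norm_pos_iff.2 hΞ
      filter_upwards [tendsto_natCast_atTop_atTop.eventually (eventually_ge_atTop (2 / ‖Ξ‖))]
        with n hn
      rw [radialCutoff_eq_zero, sub_zero, one_mul]
      rw [norm_smul, Real.norm_of_nonneg n.cast_add_one_pos.le]
      rw [div_le_iff₀ hΞ'] at hn
      nlinarith
  exact key.congr fun n => (hcut n).2

end PositiveFourierPair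

end FourierSymbol

/-! ### Energy of a difference of probability measures -/

section FourierEnergy

variable {E : Type*} [NormedAddCommGroup E] [InnerProductSpace ℝ E] [FiniteDimensional ℝ E]
  [MeasurableSpace E] [BorelSpace E]

lemma integral_cos_prod (α β : Measure E) [IsProbabilityMeasure α] [IsProbabilityMeasure β] (Ξ : E) :
    ∫ p : E × E, Real.cos (2 * Real.pi * inner ℝ (p.1 - p.2) Ξ) ∂(α.prod β) =
      (charFun α (-(2 * Real.pi) • Ξ) * (starRingEnd ℂ) (charFun β (-(2 * Real.pi) • Ξ))).re := by
  rw [charFun_apply, charFun_apply, ← integral_conj, ← integral_prod_mul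
    (f := fun x : E => Complex.exp (inner ℝ x (-(2 * Real.pi) • Ξ) * Complex.I))]
  have hint : Integrable (fun p : E × E =>
      Complex.exp (inner ℝ p.1 (-(2 * Real.pi) • Ξ) * Complex.I) *
      (starRingEnd ℂ) (Complex.exp (inner ℝ p.2 (-(2 * Real.pi) • Ξ) * Complex.I))) (α.prod β) := by
    refine Integrable.of_bound (C := 1) ?_ (Eventually.of_forall fun p => ?_)
    · refine Continuous.aestronglyMeasurable ?_
      have := Complex.continuous_conj
      fun_prop
    · rw [norm_mul, RCLike.norm_conj, Complex.norm_exp_ofReal_mul_I, Complex.norm_exp_ofReal_mul_I,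
        one_mul]
  have := integral_re hint
  simp only [RCLike.re_to_complex] at this
  rw [← this]
  refine integral_congr_ae (Eventually.of_forall fun p => ?_)
  simp only [← Complex.exp_conj, map_mul, Complex.conj_ofReal, Complex.conj_I, ← Complex.exp_add]
  have e : (inner ℝ p.1 (-(2 * Real.pi) • Ξ) : ℂ) * Complex.I +
      (inner ℝ p.2 (-(2 * Real.pi) • Ξ) : ℂ) * -Complex.I =
      ((-(2 * Real.pi * inner ℝ (p.1 - p.2) Ξ) : ℝ) : ℂ) * Complex.I := by
    rw [inner_sub_left, real_inner_smul_right, real_inner_smul_right]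
    push_cast
    ring
  rw [e, Complex.exp_ofReal_mul_I_re, Real.cos_neg]

/-- Expansion of |α̂ - β̂|² = |α̂|² + |β̂|² - 2 Re(α̂ β̂*), with 1 - cos in place of cos. The terms
are arranged so that all are nonnegative and the identity can be integrated in [0, ∞]. -/
lemma norm_charFun_sub_sq (α β : Measure E) [IsProbabilityMeasure α] [IsProbabilityMeasure β]
    (Ξ : E) :
    (∫ p : E × E, (1 - Real.cos (2 * Real.pi * inner ℝ (p.1 - p.2) Ξ)) ∂(α.prod α)) +
      (∫ p : E × E, (1 - Real.cos (2 * Real.pi * inner ℝ (p.1 - p.2) Ξ)) ∂(β.prod β)) +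
      ‖charFun α (-(2 * Real.pi) • Ξ) - charFun β (-(2 * Real.pi) • Ξ)‖ ^ 2 =
      2 * ∫ p : E × E, (1 - Real.cos (2 * Real.pi * inner ℝ (p.1 - p.2) Ξ)) ∂(α.prod β) := by
  have hcos : ∀ γ : Measure (E × E), ∀ _ : IsProbabilityMeasure γ,
      ∫ p : E × E, (1 - Real.cos (2 * Real.pi * inner ℝ (p.1 - p.2) Ξ)) ∂γ =
      1 - ∫ p : E × E, Real.cos (2 * Real.pi * inner ℝ (p.1 - p.2) Ξ) ∂γ := by
    intro γ _
    rw [integral_sub (integrable_const _)]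
    · simp
    · refine Integrable.of_bound (C := 1) (Continuous.aestronglyMeasurable (by fun_prop))
        (Eventually.of_forall fun p => Real.abs_cos_le_one _)
  rw [hcos _ inferInstance, hcos _ inferInstance, hcos _ inferInstance, integral_cos_prod,
    integral_cos_prod, integral_cos_prod, ← Complex.normSq_eq_norm_sq, Complex.normSq_sub,
    Complex.mul_conj, Complex.mul_conj, Complex.ofReal_re, Complex.ofReal_re]
  ring

variable [Nontrivial E]

namespace PositiveFourierPair

variable {G h : E → ℝ} {K p : ℝ} (H : PositiveFourierPair G h K p)
include H

lemma lintegral_symbol_average (R : 𝓢(E, ℂ)) (hR : ∀ X, 1 < ‖X‖ → R X = 0) {ρ φ : E → ℝ}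
    (hρ : ∀ X, R X = ρ X) (hφ : ∀ Ξ, 𝓕 R Ξ = φ Ξ) (hφ0 : ∀ Ξ, 0 ≤ φ Ξ)
    (γ : Measure (E × E)) [IsProbabilityMeasure γ]
    (hγ : Integrable (fun q : E × E => ∫ X, G X * ρ (X - (q.1 - q.2))) γ) :
    0 ≤ (∫ X, G X * ρ X) - ∫ q, (∫ X, G X * ρ (X - (q.1 - q.2))) ∂γ ∧
    ∫⁻ Ξ, ENNReal.ofReal (h Ξ * (φ Ξ *
        ∫ q : E × E, (1 - Real.cos (2 * Real.pi * inner ℝ (q.1 - q.2) Ξ)) ∂γ)) =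
      ENNReal.ofReal ((∫ X, G X * ρ X) - ∫ q, (∫ X, G X * ρ (X - (q.1 - q.2))) ∂γ) := by
  have hsym := H.lintegral_symbol R hR hρ hφ hφ0
  have hφm : Measurable φ := by
    have h1 : φ = fun Ξ => (𝓕 R Ξ).re := by ext Ξ; rw [hφ, Complex.ofReal_re]
    rw [h1]
    exact (Complex.continuous_re.comp (𝓕 R).continuous).measurable
  have hhm := H.measurable_symbol
  have e1 : (∫ X, G X * ρ X) - ∫ q, (∫ X, G X * ρ (X - (q.1 - q.2))) ∂γ =
      ∫ q, ((∫ X, G X * ρ X) - ∫ X, G X * ρ (X - (q.1 - q.2))) ∂γ := by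
    rw [integral_sub (integrable_const _) hγ]
    simp
  have hnn : ∀ q : E × E, 0 ≤ (∫ X, G X * ρ X) - ∫ X, G X * ρ (X - (q.1 - q.2)) :=
    fun q => (hsym (q.1 - q.2)).1
  rw [e1]
  refine ⟨integral_nonneg hnn, ?_⟩
  rw [ofReal_integral_eq_lintegral_ofReal
    (f := fun q : E × E => (∫ X, G X * ρ X) - ∫ X, G X * ρ (X - (q.1 - q.2)))
    ((integrable_const _).sub hγ) (Eventually.of_forall hnn)]
  simp_rw [← (hsym _).2]
  rw [lintegral_lintegral_swap (Measurable.aemeasurable (by unfold Function.uncurry; fun_prop))]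
  refine lintegral_congr_ae ?_
  filter_upwards [compl_mem_ae_iff.2 (measure_singleton (0 : E))] with Ξ hΞ
  have hw : 0 ≤ h Ξ * φ Ξ := mul_nonneg (H.symbol_nonneg Ξ hΞ) (hφ0 Ξ)
  simp_rw [← mul_assoc (h Ξ)]
  rw [← integral_const_mul, ofReal_integral_eq_lintegral_ofReal]
  · refine Integrable.const_mul ?_ _
    refine Integrable.of_bound (C := 2) (Continuous.aestronglyMeasurable (by fun_prop))
      (Eventually.of_forall fun q => ?_)
    rw [Real.norm_eq_abs, abs_le]
    constructor <;> linarith [Real.cos_le_one (2 * Real.pi * inner ℝ (q.1 - q.2) Ξ),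
      Real.neg_one_le_cos (2 * Real.pi * inner ℝ (q.1 - q.2) Ξ)]
  · exact Eventually.of_forall fun q => mul_nonneg hw
      (by linarith [Real.cos_le_one (2 * Real.pi * inner ℝ (q.1 - q.2) Ξ)])

/-- The energy of the mollified potential as a weighted `L²` norm on the Fourier side. -/
theorem lintegral_symbol_charFun (R : 𝓢(E, ℂ)) (hR : ∀ X, 1 < ‖X‖ → R X = 0) {ρ φ : E → ℝ}
    (hρ : ∀ X, R X = ρ X) (hφ : ∀ Ξ, 𝓕 R Ξ = φ Ξ) (hφ0 : ∀ Ξ, 0 ≤ φ Ξ)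
    (α β : Measure E) [IsProbabilityMeasure α] [IsProbabilityMeasure β]
    (hαα : Integrable (fun q : E × E => ∫ X, G X * ρ (X - (q.1 - q.2))) (α.prod α))
    (hαβ : Integrable (fun q : E × E => ∫ X, G X * ρ (X - (q.1 - q.2))) (α.prod β))
    (hββ : Integrable (fun q : E × E => ∫ X, G X * ρ (X - (q.1 - q.2))) (β.prod β)) :
    0 ≤ (∫ q, (∫ X, G X * ρ (X - (q.1 - q.2))) ∂(α.prod α)) +
        (∫ q, (∫ X, G X * ρ (X - (q.1 - q.2))) ∂(β.prod β)) -
        2 * ∫ q, (∫ X, G X * ρ (X - (q.1 - q.2))) ∂(α.prod β) ∧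
    ∫⁻ Ξ, ENNReal.ofReal (h Ξ * (φ Ξ *
        ‖charFun α (-(2 * Real.pi) • Ξ) - charFun β (-(2 * Real.pi) • Ξ)‖ ^ 2)) ≤
      ENNReal.ofReal ((∫ q, (∫ X, G X * ρ (X - (q.1 - q.2))) ∂(α.prod α)) +
        (∫ q, (∫ X, G X * ρ (X - (q.1 - q.2))) ∂(β.prod β)) -
        2 * ∫ q, (∫ X, G X * ρ (X - (q.1 - q.2))) ∂(α.prod β)) := by
  obtain ⟨a0, a1⟩ := H.lintegral_symbol_average R hR hρ hφ hφ0 _ hαα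
  obtain ⟨b0, b1⟩ := H.lintegral_symbol_average R hR hρ hφ hφ0 _ hββ
  obtain ⟨c0, c1⟩ := H.lintegral_symbol_average R hR hρ hφ hφ0 _ hαβ
  have hφm : Measurable φ := by
    have h1 : φ = fun Ξ => (𝓕 R Ξ).re := by ext Ξ; rw [hφ, Complex.ofReal_re]
    rw [h1]
    exact (Complex.continuous_re.comp (𝓕 R).continuous).measurable
  have hhm := H.measurable_symbol
  have hVm : ∀ γ : Measure (E × E), ∀ _ : IsProbabilityMeasure γ, Measurable fun Ξ : E =>
      ∫ q : E × E, (1 - Real.cos (2 * Real.pi * inner ℝ (q.1 - q.2) Ξ)) ∂γ := by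
    intro γ _
    refine StronglyMeasurable.measurable (StronglyMeasurable.integral_prod_right ?_)
    exact Continuous.stronglyMeasurable (by unfold Function.uncurry; fun_prop)
  have h1 := hVm (α.prod α) inferInstance
  have h2 := hVm (β.prod β) inferInstance
  have hV0 : ∀ γ : Measure (E × E), ∀ Ξ : E,
      0 ≤ ∫ q : E × E, (1 - Real.cos (2 * Real.pi * inner ℝ (q.1 - q.2) Ξ)) ∂γ := fun γ Ξ =>
    integral_nonneg fun q => by
      simp only [Pi.zero_apply]
      linarith [Real.cos_le_one (2 * Real.pi * inner ℝ (q.1 - q.2) Ξ)]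
  have key : ∫⁻ Ξ, (ENNReal.ofReal (h Ξ * (φ Ξ *
        ∫ q : E × E, (1 - Real.cos (2 * Real.pi * inner ℝ (q.1 - q.2) Ξ)) ∂(α.prod α))) +
      (ENNReal.ofReal (h Ξ * (φ Ξ *
        ∫ q : E × E, (1 - Real.cos (2 * Real.pi * inner ℝ (q.1 - q.2) Ξ)) ∂(β.prod β))) +
      ENNReal.ofReal (h Ξ * (φ Ξ *
        ‖charFun α (-(2 * Real.pi) • Ξ) - charFun β (-(2 * Real.pi) • Ξ)‖ ^ 2)))) =
      ∫⁻ Ξ, 2 * ENNReal.ofReal (h Ξ * (φ Ξ *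
        ∫ q : E × E, (1 - Real.cos (2 * Real.pi * inner ℝ (q.1 - q.2) Ξ)) ∂(α.prod β))) := by
    refine lintegral_congr_ae ?_
    filter_upwards [compl_mem_ae_iff.2 (measure_singleton (0 : E))] with Ξ hΞ
    have hw : 0 ≤ h Ξ * φ Ξ := mul_nonneg (H.symbol_nonneg Ξ hΞ) (hφ0 Ξ)
    simp_rw [← mul_assoc (h Ξ)]
    rw [← ENNReal.ofReal_add (mul_nonneg hw (hV0 _ _)) (by positivity),
      ← ENNReal.ofReal_add (mul_nonneg hw (hV0 _ _))
        (add_nonneg (mul_nonneg hw (hV0 _ _)) (by positivity)), ← mul_add, ← mul_add, ← add_assoc,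
      norm_charFun_sub_sq, mul_left_comm, ENNReal.ofReal_mul zero_le_two, ENNReal.ofReal_ofNat]
  rw [lintegral_add_left (by fun_prop), lintegral_add_left (by fun_prop),
    lintegral_const_mul' _ _ (by simp), a1, b1, c1, ← add_assoc, ← ENNReal.ofReal_add a0 b0,
    ← ENNReal.ofReal_ofNat, ← ENNReal.ofReal_mul zero_le_two] at key
  set Ia := ∫ q, (∫ X, G X * ρ (X - (q.1 - q.2))) ∂(α.prod α)
  set Ib := ∫ q, (∫ X, G X * ρ (X - (q.1 - q.2))) ∂(β.prod β)
  set Ic := ∫ q, (∫ X, G X * ρ (X - (q.1 - q.2))) ∂(α.prod β)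
  -- Dropping the Sobolev term first shows that the real energy is nonnegative; the finite terms are
  -- then cancelled in [0, ∞].
  have hle := le_self_add.trans_eq key
  rw [ENNReal.ofReal_le_ofReal_iff (by linarith)] at hle
  refine ⟨by linarith, ?_⟩
  rw [show Ia + Ib - 2 * Ic = 2 * ((∫ X, G X * ρ X) - Ic) -
      ((∫ X, G X * ρ X) - Ia + ((∫ X, G X * ρ X) - Ib)) by ring,
    ENNReal.ofReal_sub _ (add_nonneg a0 b0), ← key, ENNReal.add_sub_cancel_left ENNReal.ofReal_ne_top]

end PositiveFourierPair

end FourierEnergy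

/-! ### Radial mollifiers with nonnegative Fourier transform -/

section Mollifier

variable {E : Type*} [NormedAddCommGroup E] [InnerProductSpace ℝ E] [FiniteDimensional ℝ E]
  [MeasurableSpace E] [BorelSpace E] [Nontrivial E]

/-- A radial probability density on the ball of radius `ε` with nonnegative Fourier transform. -/
structure RadialMollifier (ε : ℝ) (R : 𝓢(E, ℂ)) (ρ φ : E → ℝ) : Prop where
  support : ∀ X, ε < ‖X‖ → R X = 0
  coe : ∀ X, R X = ρ X
  fourier : ∀ Ξ, 𝓕 R Ξ = φ Ξ
  fourier_nonneg : ∀ Ξ, 0 ≤ φ Ξ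
  nonneg : ∀ X, 0 ≤ ρ X
  integral_eq : ∫ X, ρ X = 1
  radial : ∀ X Y : E, ‖X‖ = ‖Y‖ → ρ X = ρ Y

/-- The normalised convolution square of a radial cutoff: its transform is the square of a real
function, the cutoff being real and even. -/
lemma exists_radialMollifier {ε : ℝ} (hε : 0 < ε) :
    ∃ (R : 𝓢(E, ℂ)) (ρ φ : E → ℝ), RadialMollifier ε R ρ φ := by
  -- The cutoff vanishes beyond radius 2 / r = ε / 2, so its convolution square vanishes beyond ε.
  set r : ℝ := 4 / ε with hr
  have hr0 : 0 < r := by positivity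
  set Γ := cutoffSchwartz E r hr0.ne' with hΓ
  have hΓa : ∀ X, Γ X = (radialCutoff E (r • X) : ℂ) := cutoffSchwartz_apply r hr0.ne'
  have hcont : Continuous (radialCutoff E) := contDiff_radialCutoff.continuous
  set M := ∫ X : E, radialCutoff E (r • X) with hM
  have hMpos : 0 < M := by
    have hsupp : HasCompactSupport fun X : E => radialCutoff E (r • X) := by
      refine HasCompactSupport.intro (isCompact_closedBall (0 : E) (2 / r)) fun Ξ hΞ => ?_
      rw [mem_closedBall_zero_iff, not_le, div_lt_iff₀ hr0] at hΞ
      rw [radialCutoff_eq_zero]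
      rw [norm_smul, Real.norm_of_nonneg hr0.le, mul_comm]
      exact hΞ.le
    refine Continuous.integral_pos_of_hasCompactSupport_nonneg_nonzero (x := 0) (by fun_prop)
      hsupp (fun X => radialCutoff_nonneg _) ?_
    rw [smul_zero, radialCutoff_eq_one (by simp)]
    exact one_ne_zero
  have hreal : ∀ Ξ, 𝓕 Γ Ξ = ((𝓕 Γ Ξ).re : ℂ) := by
    intro Ξ
    refine ((Complex.conj_eq_iff_re).1 ?_).symm
    rw [SchwartzMap.fourier_coe, Real.fourier_eq, ← integral_conj, ← integral_neg_eq_self]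
    refine integral_congr_ae (Eventually.of_forall fun v => ?_)
    simp only [Circle.smul_def, Real.fourierChar_apply, smul_eq_mul, map_mul, hΓa,
      Complex.conj_ofReal, ← Complex.exp_conj, Complex.conj_I, inner_neg_left]
    have : radialCutoff E (r • -v) = radialCutoff E (r • v) := by
      unfold radialCutoff; rw [smul_neg, norm_neg]
    rw [this]
    congr 2
    push_cast
    ring
  refine ⟨((M⁻¹ ^ 2 : ℝ) : ℂ) • SchwartzMap.convolution (ContinuousLinearMap.mul ℂ ℂ) Γ Γ,
    fun X => M⁻¹ ^ 2 * ∫ t, radialCutoff E (r • t) * radialCutoff E (r • (X - t)),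
    fun Ξ => M⁻¹ ^ 2 * (𝓕 Γ Ξ).re ^ 2, ?_⟩
  have hcoe : ∀ X, (((M⁻¹ ^ 2 : ℝ) : ℂ) •
      SchwartzMap.convolution (ContinuousLinearMap.mul ℂ ℂ) Γ Γ) X =
      ((M⁻¹ ^ 2 * ∫ t, radialCutoff E (r • t) * radialCutoff E (r • (X - t)) : ℝ) : ℂ) := by
    intro X
    rw [smul_apply, SchwartzMap.convolution_apply, convolution_def, smul_eq_mul,
      Complex.ofReal_mul, ← integral_complex_ofReal]
    congr 1
    refine integral_congr_ae (Eventually.of_forall fun t => ?_)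
    simp only [ContinuousLinearMap.mul_apply', hΓa, Complex.ofReal_mul]
  have hfour : ∀ Ξ, 𝓕 (((M⁻¹ ^ 2 : ℝ) : ℂ) •
      SchwartzMap.convolution (ContinuousLinearMap.mul ℂ ℂ) Γ Γ) Ξ =
      ((M⁻¹ ^ 2 * (𝓕 Γ Ξ).re ^ 2 : ℝ) : ℂ) := by
    intro Ξ
    rw [FourierTransform.fourier_smul, smul_apply, SchwartzMap.fourier_convolution,
      SchwartzMap.pairing_apply_apply, ContinuousLinearMap.mul_apply', hreal Ξ]
    push_cast
    simp only [Complex.ofReal_re, smul_eq_mul]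
    ring
  refine ⟨?_, hcoe, hfour, fun Ξ => by positivity, ?_, ?_, ?_⟩
  · intro X hX
    rw [hcoe]
    have : ∀ t : E, radialCutoff E (r • t) * radialCutoff E (r • (X - t)) = 0 := by
      intro t
      by_cases ht : 2 ≤ ‖r • t‖
      · rw [radialCutoff_eq_zero ht, zero_mul]
      · rw [radialCutoff_eq_zero (Ξ := r • (X - t)), mul_zero]
        rw [not_le, norm_smul, Real.norm_of_nonneg hr0.le] at ht
        rw [norm_smul, Real.norm_of_nonneg hr0.le]
        have h1 : ‖X‖ ≤ ‖X - t‖ + ‖t‖ := by simpa using norm_add_le (X - t) t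
        have h2 : r * ε = 4 := by rw [hr]; field_simp
        nlinarith
    simp [this]
  · intro X
    have : 0 ≤ ∫ t, radialCutoff E (r • t) * radialCutoff E (r • (X - t)) :=
      integral_nonneg fun t => mul_nonneg (radialCutoff_nonneg _) (radialCutoff_nonneg _)
    positivity
  · have h1 := hfour 0
    rw [SchwartzMap.fourier_coe, Real.fourier_eq] at h1
    simp only [inner_zero_right, neg_zero, AddChar.map_zero_eq_one, one_smul, hcoe] at h1
    rw [integral_complex_ofReal, Complex.ofReal_inj] at h1
    rw [h1]
    have h2 : 𝓕 Γ 0 = (M : ℂ) := by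
      rw [SchwartzMap.fourier_coe, Real.fourier_eq]
      simp only [inner_zero_right, neg_zero, AddChar.map_zero_eq_one, one_smul, hΓa]
      rw [integral_complex_ofReal]
    rw [h2, Complex.ofReal_re]
    field_simp
  · intro X Y hXY
    -- A linear isometry taking X to Y; the cutoff and Lebesgue measure are invariant under it.
    set O := (ℝ ∙ (X - Y))ᗮ.reflection with hO
    have hOX : O X = Y := Submodule.reflection_sub hXY
    have hinv : ∀ v : E, radialCutoff E (r • O v) = radialCutoff E (r • v) := by
      intro v
      unfold radialCutoff
      rw [norm_smul, norm_smul, O.norm_map]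
    congr 1
    rw [← hOX, ← O.measurePreserving.integral_comp O.toHomeomorph.measurableEmbedding
      (fun t => radialCutoff E (r • t) * radialCutoff E (r • (O X - t)))]
    refine integral_congr_ae (Eventually.of_forall fun t => ?_)
    simp only [← map_sub, hinv]

namespace RadialMollifier

variable {ε : ℝ} {R : 𝓢(E, ℂ)} {ρ φ : E → ℝ} (hM : RadialMollifier ε R ρ φ)
include hM

lemma eq_zero {X : E} (hX : ε < ‖X‖) : ρ X = 0 := by
  have := hM.support X hX
  rw [hM.coe] at this
  exact_mod_cast this

lemma continuous : Continuous ρ := by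
  have h1 : ρ = fun X => (R X).re := by ext X; rw [hM.coe, Complex.ofReal_re]
  rw [h1]
  exact Complex.continuous_re.comp R.continuous

lemma integrable : Integrable ρ := by
  by_contra h
  have := hM.integral_eq
  rw [integral_undef h] at this
  exact zero_ne_one this

lemma lintegral_eq : ∫⁻ X, ENNReal.ofReal (ρ X) = 1 := by
  rw [← ofReal_integral_eq_lintegral_ofReal hM.integrable (Eventually.of_forall hM.nonneg),
    hM.integral_eq, ENNReal.ofReal_one]

lemma abs_fourier_sub_one_le (Ξ : E) : |φ Ξ - 1| ≤ 2 * Real.pi * ε * ‖Ξ‖ := by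
  have h1 : ((φ Ξ - 1 : ℝ) : ℂ) = ∫ v, (Complex.exp ((-(2 * Real.pi * inner ℝ v Ξ) : ℝ) * Complex.I)
      - 1) * ρ v := by
    simp only [sub_mul, one_mul]
    rw [integral_sub, integral_complex_ofReal, hM.integral_eq, Complex.ofReal_sub]
    · congr 1
      rw [← hM.fourier, SchwartzMap.fourier_coe, Real.fourier_eq]
      refine integral_congr_ae (Eventually.of_forall fun v => ?_)
      simp only [Circle.smul_def, Real.fourierChar_apply, smul_eq_mul, hM.coe]
      congr 2
      push_cast
      ring
    · refine Integrable.bdd_mul hM.integrable.ofReal (c := 1)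
        (Continuous.aestronglyMeasurable (by fun_prop)) (Eventually.of_forall fun v => ?_)
      rw [Complex.norm_exp_ofReal_mul_I]
    · exact hM.integrable.ofReal
  rw [← Real.norm_eq_abs, ← Complex.norm_real, h1]
  have h2 : 2 * Real.pi * ε * ‖Ξ‖ = ∫ v, 2 * Real.pi * ε * ‖Ξ‖ * ρ v := by
    rw [integral_const_mul, hM.integral_eq, mul_one]
  rw [h2]
  refine norm_integral_le_of_norm_le (hM.integrable.const_mul _) (Eventually.of_forall fun v => ?_)
  by_cases hv : ε < ‖v‖
  · simp [hM.eq_zero hv]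
  rw [norm_mul, Complex.norm_real, Real.norm_of_nonneg (hM.nonneg v)]
  refine mul_le_mul_of_nonneg_right ?_ (hM.nonneg v)
  rw [mul_comm _ Complex.I]
  refine (Real.norm_exp_I_mul_ofReal_sub_one_le (x := -(2 * Real.pi * inner ℝ v Ξ))).trans ?_
  rw [norm_neg, norm_mul, Real.norm_of_nonneg (by positivity), mul_assoc _ ε]
  have := norm_inner_le_norm (𝕜 := ℝ) v Ξ
  have h3 : ‖v‖ * ‖Ξ‖ ≤ ε * ‖Ξ‖ := by gcongr; exact not_lt.1 hv
  have := Real.pi_pos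
  gcongr
  linarith

/-- The average against a radial mollifier is a superposition of spherical averages. -/
lemma lintegral_mul_le {F : E → ℝ≥0∞} (hF : Measurable F) {c : ℝ≥0∞}
    (h : ∀ r, 0 < r → r ≤ ε → ∫⁻ Y, F Y ∂sphereMeasure 0 r ≤ c) :
    ∫⁻ X, F X * ENNReal.ofReal (ρ X) ≤ c := by
  obtain ⟨e, he⟩ := exists_norm_eq E zero_le_one
  have hρm := hM.continuous.measurable
  have hrad : ∀ r, 0 < r → ∀ᵐ Y ∂sphereMeasure (0 : E) r, ρ Y = ρ (r • e) := by
    intro r hr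
    filter_upwards [ae_norm_sphereMeasure hr.le] with Y hY
    refine hM.radial _ _ ?_
    rw [hY, norm_smul, he, mul_one, Real.norm_of_nonneg hr.le]
  calc ∫⁻ X, F X * ENNReal.ofReal (ρ X)
      = ∫⁻ r in Ioi (0 : ℝ), (volume : Measure E).toSphere univ *
          ENNReal.ofReal (r ^ (Module.finrank ℝ E - 1)) *
          ∫⁻ Y, F Y * ENNReal.ofReal (ρ Y) ∂sphereMeasure 0 r :=
        lintegral_eq_lintegral_sphereMeasure (by fun_prop)
    _ ≤ ∫⁻ r in Ioi (0 : ℝ), c * ((volume : Measure E).toSphere univ *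
          ENNReal.ofReal (r ^ (Module.finrank ℝ E - 1)) *
          ∫⁻ Y, ENNReal.ofReal (ρ Y) ∂sphereMeasure 0 r) := by
        refine setLIntegral_mono' measurableSet_Ioi fun r hr => ?_
        have hr' : 0 < r := hr
        have e1 : ∫⁻ Y, F Y * ENNReal.ofReal (ρ Y) ∂sphereMeasure 0 r =
            (∫⁻ Y, F Y ∂sphereMeasure 0 r) * ENNReal.ofReal (ρ (r • e)) := by
          rw [← lintegral_mul_const _ hF]
          refine lintegral_congr_ae ?_
          filter_upwards [hrad r hr'] with Y hY
          rw [hY]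
        have e2 : ∫⁻ Y, ENNReal.ofReal (ρ Y) ∂sphereMeasure 0 r = ENNReal.ofReal (ρ (r • e)) := by
          have : ∫⁻ Y, ENNReal.ofReal (ρ Y) ∂sphereMeasure 0 r =
              ∫⁻ Y, ENNReal.ofReal (ρ (r • e)) ∂sphereMeasure (0 : E) r := by
            refine lintegral_congr_ae ?_
            filter_upwards [hrad r hr'] with Y hY
            rw [hY]
          rw [this, lintegral_const, measure_univ, mul_one]
        rw [e1, e2, mul_left_comm]
        by_cases hrε : r ≤ ε
        · gcongr
          exact h r hr' hrε
        · rw [hM.eq_zero]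
          · simp
          · rw [norm_smul, he, mul_one, Real.norm_of_nonneg hr'.le]
            exact not_le.1 hrε
    _ ≤ c * 1 := by
        by_cases hc : c = ∞
        · rw [hc, mul_one]; exact le_top
        rw [lintegral_const_mul' _ _ hc, ← lintegral_eq_lintegral_sphereMeasure (by fun_prop),
          hM.lintegral_eq]
    _ = c := mul_one c

end RadialMollifier

end Mollifier

/-! ### Mollified potentials and coercivity -/

section MollifiedPotential

variable {d m : ℕ} {s r₀ : ℝ} {A : ℕ → ℝ} {B C₁ C₂ c : ℝ} {g : Space d → ℝ} {G : ExtSpace d m → ℝ}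

namespace ExtAdmissible

variable (h : ExtAdmissible d m s r₀ A B C₁ C₂ c g G)
  (hs : (max ((d : ℝ) - 2) 0 < s ∧ s < d) ∨ (d = 1 ∧ s = 0)) (hd : 1 ≤ d)
include h hs hd

lemma exists_positiveFourierPair : ∃ k : ExtSpace d m → ℝ,
    PositiveFourierPair G k (3 * |A 0|) (singularExponent s) ∧
    ∀ Ξ, Ξ ≠ 0 → C₁ / ‖Ξ‖ ^ ((d : ℝ) + m - s) ≤ k Ξ := by
  obtain ⟨k, hkm, hkF, hk⟩ := h.fourier_bound
  have := nontrivial_extSpace (m := m) hd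
  have hds : singularExponent s < d := singularExponent_lt hs
  have hs' : s < d := by
    rcases hs with hs | ⟨rfl, rfl⟩
    · exact hs.2
    · norm_num
  have hm : (0 : ℝ) ≤ m := Nat.cast_nonneg m
  refine ⟨k, ⟨h.measurable, h.even, singularExponent_pos (nonneg_of_exponent_range hs), ?_,
    fun X hX => h.abs_le_growth hX, hkm, fun Ξ hΞ => ?_, fun δ hδ => ?_, hkF⟩,
    fun Ξ hΞ => (hk Ξ hΞ).1⟩
  · rw [finrank_extSpace]; push_cast; linarith
  · exact (div_nonneg h.C₁_pos.le (by positivity)).trans (hk Ξ hΞ).1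
  · refine ⟨|C₂| / δ ^ ((d : ℝ) + m - s), fun Ξ hΞ => ?_⟩
    refine ((hk Ξ (norm_pos_iff.1 (hδ.trans_le hΞ))).2).trans ?_
    have : 0 ≤ (d : ℝ) + m - s := by linarith
    gcongr
    exact le_abs_self _

omit hs in
lemma mollified_eq [Nontrivial (ExtSpace d m)] {ε : ℝ} {R : 𝓢(ExtSpace d m, ℂ)}
    {ρ φ : ExtSpace d m → ℝ} (hM : RadialMollifier ε R ρ φ) (a : ExtSpace d m) :
    ∫ X, G X * ρ (X - a) = ∫ Y, G (a - Y) * ρ Y := by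
  rw [← integral_sub_left_eq_self (fun X => G X * ρ (X - a)) volume a]
  refine integral_congr_ae (Eventually.of_forall fun Y => ?_)
  simp only
  rw [sub_sub_cancel_left, hM.radial (-Y) Y (norm_neg Y)]

lemma integrable_mollified {ε : ℝ} {R : 𝓢(ExtSpace d m, ℂ)}
    {ρ φ : ExtSpace d m → ℝ} (hM : RadialMollifier ε R ρ φ) (a : ExtSpace d m) :
    Integrable fun Y => G (a - Y) * ρ Y := by
  have := nontrivial_extSpace (m := m) hd
  obtain ⟨k, hk, -⟩ := h.exists_positiveFourierPair hs hd
  have h1 := (hk.integrable_mul_schwartz (R.compSubConstCLM ℂ a)).re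
  have h2 : Integrable fun X => G X * ρ (X - a) := by
    refine h1.congr (Eventually.of_forall fun X => ?_)
    simp only [RCLike.re_to_complex, SchwartzMap.compSubConstCLM_apply, hM.coe,
      ← Complex.ofReal_mul, Complex.ofReal_re]
  refine (h2.comp_sub_left a).congr (Eventually.of_forall fun Y => ?_)
  simp only
  rw [sub_sub_cancel_left, hM.radial (-Y) Y (norm_neg Y)]

lemma abs_mollified_sub_le {ε : ℝ} {R : 𝓢(ExtSpace d m, ℂ)}
    {ρ φ : ExtSpace d m → ℝ} (hM : RadialMollifier ε R ρ φ) {a : ExtSpace d m} (ha : a ≠ 0)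
    (hε : ε ≤ ‖a‖ / 2) :
    |(∫ X, G X * ρ (X - a)) - G a| ≤ |A 1| * (‖a‖ / 2) ^ (-(s + 1)) * ε := by
  have := nontrivial_extSpace (m := m) hd
  have hs0 := nonneg_of_exponent_range hs
  have e1 : (∫ X, G X * ρ (X - a)) - G a = ∫ Y, (G (a - Y) - G a) * ρ Y := by
    rw [h.mollified_eq hd hM]
    simp_rw [sub_mul]
    rw [integral_sub (h.integrable_mollified hs hd hM a) (hM.integrable.const_mul _),
      integral_const_mul, hM.integral_eq, mul_one]
  have e2 : |A 1| * (‖a‖ / 2) ^ (-(s + 1)) * ε = ∫ Y, |A 1| * (‖a‖ / 2) ^ (-(s + 1)) * ε * ρ Y := by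
    rw [integral_const_mul, hM.integral_eq, mul_one]
  rw [e1, e2, ← Real.norm_eq_abs]
  refine norm_integral_le_of_norm_le (hM.integrable.const_mul _) (Eventually.of_forall fun Y => ?_)
  by_cases hY : ε < ‖Y‖
  · simp [hM.eq_zero hY]
  rw [norm_mul, Real.norm_of_nonneg (hM.nonneg Y)]
  refine mul_le_mul_of_nonneg_right ?_ (hM.nonneg Y)
  rw [not_lt] at hY
  have := h.abs_sub_le hs0 ha (Z := -Y) (by rw [norm_neg]; linarith)
  rw [norm_neg, ← sub_eq_add_neg] at this
  exact this.trans (by gcongr)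

/-- The upper bound superposes the mean value inequality over the spheres that make up the
mollifier. This gives a domination near the singularity that does not depend on ε. -/
lemma mollified_mem_Icc {L : ℝ} (hL : ∀ Z, Z ≠ 0 → ‖Z‖ < r₀ → -L ≤ G Z) {ε : ℝ}
    {R : 𝓢(ExtSpace d m, ℂ)} {ρ φ : ExtSpace d m → ℝ} (hM : RadialMollifier ε R ρ φ)
    {a : ExtSpace d m} (ha : a ≠ 0) (hε : ‖a‖ + ε < r₀) :
    ∫ X, G X * ρ (X - a) ∈ Icc (-L) (G a) := by
  have := nontrivial_extSpace (m := m) hd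
  have hint := h.integrable_mollified hs hd hM a
  have e1 : (∫ X, G X * ρ (X - a)) + L = ∫ Y, (G (a - Y) + L) * ρ Y := by
    rw [h.mollified_eq hd hM]
    simp_rw [add_mul]
    rw [integral_add hint (hM.integrable.const_mul _), integral_const_mul, hM.integral_eq, mul_one]
  have hnn : 0 ≤ᵐ[volume] fun Y => (G (a - Y) + L) * ρ Y := by
    filter_upwards [compl_mem_ae_iff.2 (measure_singleton a)] with Y hY
    by_cases hY' : ε < ‖Y‖
    · simp [hM.eq_zero hY']
    refine mul_nonneg ?_ (hM.nonneg Y)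
    have := hL (a - Y) (sub_ne_zero.2 (Ne.symm hY))
      ((norm_sub_le _ _).trans_lt (by linarith [not_lt.1 hY']))
    linarith
  have hGa : 0 ≤ G a + L := by
    by_cases h0 : 0 ≤ ε
    · linarith [hL a ha (by linarith)]
    -- A negative ε would make ρ vanish identically, against its unit mass.
    · exfalso
      have : ∀ X, ρ X = 0 := fun X => hM.eq_zero (by linarith [norm_nonneg X])
      have h1 := hM.integral_eq
      simp [this] at h1
  have hle : ∫⁻ Y, liftedPotential G L (a - Y) * ENNReal.ofReal (ρ Y) ≤ ENNReal.ofReal (G a + L) := by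
    refine hM.lintegral_mul_le ?_ fun r hr hrε =>
      h.lintegral_liftedPotential_le hs hd hL ha hr (by linarith)
    have := (continuous_liftedPotential h.continuousOn h.tendsto_zero L).measurable
    fun_prop
  have hle2 : ENNReal.ofReal (∫ Y, (G (a - Y) + L) * ρ Y) ≤ ENNReal.ofReal (G a + L) := by
    rw [ofReal_integral_eq_lintegral_ofReal _ hnn]
    · refine le_trans (lintegral_mono fun Y => ?_) hle
      rw [ENNReal.ofReal_mul' (hM.nonneg Y)]
      gcongr
      exact ofReal_le_liftedPotential _ _ _
    · simp_rw [add_mul]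
      exact hint.add (hM.integrable.const_mul _)
  rw [ENNReal.ofReal_le_ofReal_iff hGa, ← e1] at hle2
  have := integral_nonneg_of_ae hnn
  rw [← e1] at this
  exact ⟨by linarith, by linarith⟩

/-- The mollified potential is dominated by the potential, up to a constant. -/
lemma exists_abs_mollified_le : ∃ C : ℝ, ∀ (ε : ℝ) (R : 𝓢(ExtSpace d m, ℂ))
    (ρ φ : ExtSpace d m → ℝ), RadialMollifier ε R ρ φ → 0 ≤ ε → ε ≤ r₀ / 4 → ∀ a, a ≠ 0 →
      |∫ X, G X * ρ (X - a)| ≤ |G a| + C := by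
  obtain ⟨L, hL0, hL⟩ := exists_lower_bound d s r₀ hd (nonneg_of_exponent_range hs) A c r₀
  have hr := h.r₀_pos
  have hs0 := nonneg_of_exponent_range hs
  set K := |A 1| * (r₀ / 4) ^ (-(s + 1)) * (r₀ / 4) with hK
  have hK0 : 0 ≤ K := by positivity
  refine ⟨L + K, fun ε R ρ φ hM hε0 hε a ha => ?_⟩
  by_cases har : ‖a‖ < r₀ / 2
  · obtain ⟨h1, h2⟩ := h.mollified_mem_Icc hs hd (fun Z hZ hZr => hL h Z hZ hZr.le) hM ha
      (by linarith)
    rw [_root_.abs_le]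
    constructor
    · linarith [abs_nonneg (G a)]
    · linarith [le_abs_self (G a)]
  · rw [not_lt] at har
    have h1 := h.abs_mollified_sub_le hs hd hM ha (by linarith)
    have h2 : |A 1| * (‖a‖ / 2) ^ (-(s + 1)) * ε ≤ K := by
      have : (‖a‖ / 2) ^ (-(s + 1)) ≤ (r₀ / 4) ^ (-(s + 1)) :=
        Real.rpow_le_rpow_of_nonpos (by linarith) (by linarith) (by linarith)
      rw [hK]
      gcongr
    have h3 := abs_sub_abs_le_abs_sub (∫ X, G X * ρ (X - a)) (G a)
    linarith

/-- Coercivity of the energy. -/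
theorem sobolevNormSq_le_energy (α β : Measure (ExtSpace d m)) [IsProbabilityMeasure α]
    [IsProbabilityMeasure β]
    (dαα : ∀ᵐ q ∂(α.prod α), q.1 - q.2 ≠ 0) (dαβ : ∀ᵐ q ∂(α.prod β), q.1 - q.2 ≠ 0)
    (dββ : ∀ᵐ q ∂(β.prod β), q.1 - q.2 ≠ 0)
    (hαα : Integrable (fun q : ExtSpace d m × ExtSpace d m => G (q.1 - q.2)) (α.prod α))
    (hαβ : Integrable (fun q : ExtSpace d m × ExtSpace d m => G (q.1 - q.2)) (α.prod β))
    (hββ : Integrable (fun q : ExtSpace d m × ExtSpace d m => G (q.1 - q.2)) (β.prod β)) :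
    0 ≤ (∫ q, G (q.1 - q.2) ∂(α.prod α)) + (∫ q, G (q.1 - q.2) ∂(β.prod β)) -
        2 * ∫ q, G (q.1 - q.2) ∂(α.prod β) ∧
    ENNReal.ofReal C₁ * sobolevNormSq ((s - d - m) / 2) α β ≤
      ENNReal.ofReal ((∫ q, G (q.1 - q.2) ∂(α.prod α)) + (∫ q, G (q.1 - q.2) ∂(β.prod β)) -
        2 * ∫ q, G (q.1 - q.2) ∂(α.prod β)) := by
  have := nontrivial_extSpace (m := m) hd
  obtain ⟨k, hk, hkC⟩ := h.exists_positiveFourierPair hs hd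
  obtain ⟨C, hC⟩ := h.exists_abs_mollified_le hs hd
  have hr := h.r₀_pos
  -- The bound r₀ / 4 is needed for the uniform domination by |G| + C, and the bound 1 because the
  -- Fourier representation takes mollifiers supported in the unit ball.
  set ε : ℕ → ℝ := fun n => min (r₀ / 4) 1 / ((n : ℝ) + 1) with hε
  have hmin : 0 < min (r₀ / 4) 1 := lt_min (by linarith) one_pos
  have hεpos : ∀ n, 0 < ε n := fun n => div_pos hmin n.cast_add_one_pos
  have hεle : ∀ n, ε n ≤ min (r₀ / 4) 1 := fun n =>
    div_le_self hmin.le (by linarith [n.cast_nonneg (α := ℝ)])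
  have hε1 : ∀ n, ε n ≤ 1 := fun n => (hεle n).trans (min_le_right _ _)
  have hε4 : ∀ n, ε n ≤ r₀ / 4 := fun n => (hεle n).trans (min_le_left _ _)
  have hεlim : Tendsto ε atTop (𝓝 0) := by
    have := (tendsto_one_div_add_atTop_nhds_zero_nat (𝕜 := ℝ)).const_mul (min (r₀ / 4) 1)
    simpa [hε, div_eq_mul_inv] using this
  choose R ρ φ hM using fun n => exists_radialMollifier (E := ExtSpace d m) (hεpos n)
  have hGm := h.measurable
  have hPm : ∀ n, Measurable fun q : ExtSpace d m × ExtSpace d m =>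
      ∫ X, G X * ρ n (X - (q.1 - q.2)) := by
    intro n
    have hρm := (hM n).continuous.measurable
    refine StronglyMeasurable.measurable (StronglyMeasurable.integral_prod_right ?_)
    exact Measurable.stronglyMeasurable (by unfold Function.uncurry; fun_prop)
  have hbound : ∀ γ : Measure (ExtSpace d m × ExtSpace d m), (∀ᵐ q ∂γ, q.1 - q.2 ≠ 0) → ∀ n,
      ∀ᵐ q ∂γ, ‖∫ X, G X * ρ n (X - (q.1 - q.2))‖ ≤ |G (q.1 - q.2)| + C := by
    intro γ hγ n
    filter_upwards [hγ] with q hq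
    exact hC (ε n) (R n) (ρ n) (φ n) (hM n) (hεpos n).le (hε4 n) _ hq
  have hbi : ∀ γ : Measure (ExtSpace d m × ExtSpace d m), IsProbabilityMeasure γ →
      Integrable (fun q : ExtSpace d m × ExtSpace d m => G (q.1 - q.2)) γ →
      Integrable (fun q : ExtSpace d m × ExtSpace d m => |G (q.1 - q.2)| + C) γ :=
    fun γ _ hγ => hγ.abs.add (integrable_const _)
  have hPi : ∀ γ : Measure (ExtSpace d m × ExtSpace d m), IsProbabilityMeasure γ →
      (∀ᵐ q ∂γ, q.1 - q.2 ≠ 0) →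
      Integrable (fun q : ExtSpace d m × ExtSpace d m => G (q.1 - q.2)) γ → ∀ n,
      Integrable (fun q : ExtSpace d m × ExtSpace d m => ∫ X, G X * ρ n (X - (q.1 - q.2))) γ :=
    fun γ hγp hγd hγ n => (hbi γ hγp hγ).mono' (hPm n).aestronglyMeasurable (hbound γ hγd n)
  have hPt : ∀ a : ExtSpace d m, a ≠ 0 →
      Tendsto (fun n => ∫ X, G X * ρ n (X - a)) atTop (𝓝 (G a)) := by
    intro a ha
    have hapos := norm_pos_iff.2 ha
    rw [tendsto_iff_norm_sub_tendsto_zero]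
    have h1 := hεlim.const_mul (|A 1| * (‖a‖ / 2) ^ (-(s + 1)))
    rw [mul_zero] at h1
    refine squeeze_zero' (Eventually.of_forall fun n => norm_nonneg _) ?_ h1
    filter_upwards [hεlim.eventually (gt_mem_nhds (half_pos hapos))] with n hn
    exact h.abs_mollified_sub_le hs hd (hM n) ha hn.le
  have hIt : ∀ γ : Measure (ExtSpace d m × ExtSpace d m), IsProbabilityMeasure γ →
      (∀ᵐ q ∂γ, q.1 - q.2 ≠ 0) →
      Integrable (fun q : ExtSpace d m × ExtSpace d m => G (q.1 - q.2)) γ →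
      Tendsto (fun n => ∫ q, (∫ X, G X * ρ n (X - (q.1 - q.2))) ∂γ) atTop
        (𝓝 (∫ q, G (q.1 - q.2) ∂γ)) := by
    intro γ hγp hγd hγ
    refine tendsto_integral_of_dominated_convergence _ (fun n => (hPm n).aestronglyMeasurable)
      (hbi γ hγp hγ) (hbound γ hγd) ?_
    filter_upwards [hγd] with q hq
    exact hPt _ hq
  have hE0 := ((hIt _ inferInstance dαα hαα).add (hIt _ inferInstance dββ hββ)).sub
    ((hIt _ inferInstance dαβ hαβ).const_mul 2)
  have hE := (ENNReal.continuous_ofReal.tendsto _).comp hE0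
  have hle : ∀ n, 0 ≤ (∫ q, (∫ X, G X * ρ n (X - (q.1 - q.2))) ∂(α.prod α)) +
        (∫ q, (∫ X, G X * ρ n (X - (q.1 - q.2))) ∂(β.prod β)) -
        2 * (∫ q, (∫ X, G X * ρ n (X - (q.1 - q.2))) ∂(α.prod β)) ∧ ∫⁻ Ξ, ENNReal.ofReal (k Ξ * (φ n Ξ *
      ‖charFun α (-(2 * Real.pi) • Ξ) - charFun β (-(2 * Real.pi) • Ξ)‖ ^ 2)) ≤ ENNReal.ofReal (
      (∫ q, (∫ X, G X * ρ n (X - (q.1 - q.2))) ∂(α.prod α)) +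
        (∫ q, (∫ X, G X * ρ n (X - (q.1 - q.2))) ∂(β.prod β)) -
        2 * ∫ q, (∫ X, G X * ρ n (X - (q.1 - q.2))) ∂(α.prod β)) := fun n =>
    hk.lintegral_symbol_charFun (R n) (fun X hX => (hM n).support X ((hε1 n).trans_lt hX))
      (hM n).coe (hM n).fourier (hM n).fourier_nonneg α β
      (hPi _ inferInstance dαα hαα n) (hPi _ inferInstance dαβ hαβ n) (hPi _ inferInstance dββ hββ n)
  have hφt : ∀ Ξ, Tendsto (fun n => φ n Ξ) atTop (𝓝 1) := by
    intro Ξ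
    rw [tendsto_iff_norm_sub_tendsto_zero]
    have h1 := (hεlim.const_mul (2 * Real.pi)).mul_const ‖Ξ‖
    rw [mul_zero, zero_mul] at h1
    exact squeeze_zero (fun n => norm_nonneg _) (fun n => (hM n).abs_fourier_sub_one_le Ξ) h1
  have hcm : ∀ γ : Measure (ExtSpace d m), IsProbabilityMeasure γ → Measurable fun Ξ =>
      charFun γ (-(2 * Real.pi) • Ξ) := fun γ _ =>
    ((continuous_charFun (μ := γ)).comp (continuous_const_smul _)).measurable
  have hcα := hcm α inferInstance
  have hcβ := hcm β inferInstance
  have hφm : ∀ n, Measurable (φ n) := by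
    intro n
    have h1 : φ n = fun Ξ => (𝓕 (R n) Ξ).re := by ext Ξ; rw [(hM n).fourier, Complex.ofReal_re]
    rw [h1]
    exact (Complex.continuous_re.comp (𝓕 (R n)).continuous).measurable
  have hkm := hk.measurable_symbol
  refine ⟨ge_of_tendsto' hE0 fun n => (hle n).1, ?_⟩
  calc ENNReal.ofReal C₁ * sobolevNormSq ((s - d - m) / 2) α β
      = ∫⁻ Ξ, ENNReal.ofReal C₁ * ENNReal.ofReal (‖Ξ‖ ^ (2 * ((s - d - m) / 2)) *
          ‖charFun α (-(2 * Real.pi) • Ξ) - charFun β (-(2 * Real.pi) • Ξ)‖ ^ 2) := by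
        rw [sobolevNormSq, lintegral_const_mul' _ _ ENNReal.ofReal_ne_top]
    _ ≤ ∫⁻ Ξ, ENNReal.ofReal (k Ξ *
          ‖charFun α (-(2 * Real.pi) • Ξ) - charFun β (-(2 * Real.pi) • Ξ)‖ ^ 2) := by
        refine lintegral_mono_ae ?_
        filter_upwards [compl_mem_ae_iff.2 (measure_singleton (0 : ExtSpace d m))] with Ξ hΞ
        rw [← ENNReal.ofReal_mul h.C₁_pos.le, ← mul_assoc]
        gcongr
        refine le_trans (le_of_eq ?_) (hkC Ξ hΞ)
        rw [div_eq_mul_inv C₁, ← Real.rpow_neg (norm_nonneg _)]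
        congr 2
        ring
    _ = ∫⁻ Ξ, liminf (fun n => ENNReal.ofReal (k Ξ * (φ n Ξ *
          ‖charFun α (-(2 * Real.pi) • Ξ) - charFun β (-(2 * Real.pi) • Ξ)‖ ^ 2))) atTop := by
        refine lintegral_congr fun Ξ => ?_
        refine (Tendsto.liminf_eq ?_).symm
        refine (ENNReal.continuous_ofReal.tendsto _).comp (Tendsto.const_mul _ ?_)
        simpa using (hφt Ξ).mul_const
          (‖charFun α (-(2 * Real.pi) • Ξ) - charFun β (-(2 * Real.pi) • Ξ)‖ ^ 2)
    -- Fatou's lemma; no domination on the Fourier side is required.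
    _ ≤ liminf (fun n => ∫⁻ Ξ, ENNReal.ofReal (k Ξ * (φ n Ξ *
          ‖charFun α (-(2 * Real.pi) • Ξ) - charFun β (-(2 * Real.pi) • Ξ)‖ ^ 2))) atTop := by
        refine lintegral_liminf_le fun n => ?_
        have := hφm n
        fun_prop
    _ ≤ _ := by
        rw [← hE.liminf_eq]
        exact liminf_le_liminf (Eventually.of_forall fun n => (hle n).2)

end ExtAdmissible

end MollifiedPotential

/-! ### The embedding of ℝ^d in ℝ^(d+m) -/

section Embedding

variable (d m : ℕ)

/-- The embedding `x ↦ (x, 0)` as a linear isometry. -/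
noncomputable def embedIsometry : Space d →ₗᵢ[ℝ] ExtSpace d m where
  toFun := embedZero d m
  map_add' x y := by
    ext i
    rcases i with i | i <;> simp [embedZero]
  map_smul' t x := by
    ext i
    rcases i with i | i <;> simp [embedZero]
  norm_map' x := by
    simp [embedZero, EuclideanSpace.norm_eq]

variable {d m}

lemma norm_embedZero (x : Space d) : ‖embedZero d m x‖ = ‖x‖ := (embedIsometry d m).norm_map x

lemma embedZero_sub (x y : Space d) : embedZero d m (x - y) = embedZero d m x - embedZero d m y :=
  map_sub (embedIsometry d m) x y

lemma embedZero_zero : embedZero d m 0 = 0 := map_zero (embedIsometry d m)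

lemma embedZero_injective : Function.Injective (embedZero d m) := (embedIsometry d m).injective

lemma measurable_embedZero : Measurable (embedZero d m) :=
  (embedIsometry d m).continuous.measurable

lemma embedZero_ne_zero {x : Space d} (hx : x ≠ 0) : embedZero d m x ≠ 0 :=
  fun h => hx (embedZero_injective (h.trans embedZero_zero.symm))

/-- The projection `(x, z) ↦ x`. -/
noncomputable def extFst (d m : ℕ) (X : ExtSpace d m) : Space d := WithLp.toLp 2 fun i => X (Sum.inl i)

lemma norm_extFst_le (X : ExtSpace d m) : ‖extFst d m X‖ ≤ ‖X‖ := by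
  rw [EuclideanSpace.norm_eq, EuclideanSpace.norm_eq, Fintype.sum_sum_type]
  refine Real.sqrt_le_sqrt ?_
  have : 0 ≤ ∑ j, ‖X (Sum.inr j)‖ ^ 2 := Finset.sum_nonneg fun j _ => by positivity
  simpa [extFst] using this

lemma extFst_sub_embedZero (X : ExtSpace d m) (y : Space d) :
    extFst d m (X - embedZero d m y) = extFst d m X - y := by
  ext i
  simp [extFst, embedZero]

end Embedding

/-! ### Measures with bounded density and absence of atoms -/

section BoundedDensity

variable {d m : ℕ}

lemma le_densitySup_smul (μ : Measure (Space d)) [IsProbabilityMeasure μ] (hμ : μ ≪ volume) :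
    μ ≤ densitySup μ • (volume : Measure (Space d)) := by
  refine Measure.le_iff.2 fun t ht => ?_
  rw [← Measure.setLIntegral_rnDeriv hμ t, Measure.smul_apply, smul_eq_mul, ← setLIntegral_const]
  exact lintegral_mono_ae (ae_restrict_of_ae (ENNReal.ae_le_essSup _))

lemma map_embedZero_singleton (hd : 1 ≤ d) {μ : Measure (Space d)} (hμ : μ ≪ volume)
    (X : ExtSpace d m) : μ.map (embedZero d m) {X} = 0 := by
  have := nontrivial_space hd
  rw [Measure.map_apply measurable_embedZero (measurableSet_singleton X)]
  refine hμ ?_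
  exact (subsingleton_singleton.preimage embedZero_injective).measure_zero _

lemma ae_prod_sub_ne_zero {E : Type*} [NormedAddCommGroup E] [MeasurableSpace E] [BorelSpace E]
    [SecondCountableTopology E] (α β : Measure E) [SFinite β] (hβ : ∀ X, β {X} = 0) :
    ∀ᵐ q ∂(α.prod β), q.1 - q.2 ≠ 0 := by
  have hm : MeasurableSet {q : E × E | q.1 - q.2 = 0} :=
    (measurable_fst.sub measurable_snd) (measurableSet_singleton 0)
  rw [ae_iff]
  simp only [ne_eq, not_not]
  rw [Measure.measure_prod_null hm]
  refine Eventually.of_forall fun X => ?_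
  refine measure_mono_null (fun Y hY => ?_) (hβ X)
  have hY' : X - Y = 0 := hY
  exact (sub_eq_zero.1 hY').symm

end BoundedDensity

/-! ### The error made by smearing -/

section SmearingError

variable {d m : ℕ} {s r₀ : ℝ} {A : ℕ → ℝ} {B C₁ C₂ c : ℝ} {g : Space d → ℝ} {G : ExtSpace d m → ℝ}

namespace ExtAdmissible

variable (h : ExtAdmissible d m s r₀ A B C₁ C₂ c g G)
  (hs : (max ((d : ℝ) - 2) 0 < s ∧ s < d) ∨ (d = 1 ∧ s = 0)) (hd : 1 ≤ d)
include h hs hd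

/-- The smearing error away from the singularity is quadratic. -/
lemma abs_smeared_sub_le {X : ExtSpace d m} (hX : X ≠ 0) {η : ℝ} (hη : 0 < η) (hη2 : 2 * η < r₀)
    (hηX : η ≤ ‖X‖ / 2) :
    |smeared G η X - G X| ≤ |A 2| * (‖X‖ / 2) ^ (-(s + 2)) * η ^ 2 := by
  have := nontrivial_extSpace (m := m) hd
  have hI := h.integrable_sphere hs hd hη hη2 X
  have hmp := measurePreserving_neg_sphereMeasure (E := ExtSpace d m) η
  have hI' : Integrable (fun Y => G (X + Y)) (sphereMeasure (0 : ExtSpace d m) η) := by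
    refine ((hmp.integrable_comp hI.aestronglyMeasurable).2 hI).congr
      (Eventually.of_forall fun Y => ?_)
    simp
  have e1 : smeared G η X = ∫ Y, G (X + Y) ∂sphereMeasure (0 : ExtSpace d m) η := by
    rw [smeared, ← hmp.integral_comp (Homeomorph.neg _).measurableEmbedding]
    simp
  -- The sphere is symmetric, so averaging over Y and -Y together leaves a symmetric second
  -- difference and no first order term.
  have e2 : 2 * (smeared G η X - G X) =
      ∫ Y, (G (X + Y) + G (X - Y) - 2 * G X) ∂sphereMeasure (0 : ExtSpace d m) η := by
    rw [integral_sub (f := fun Y => G (X + Y) + G (X - Y)) (hI'.add hI) (integrable_const _), integral_add hI' hI, ← e1, integral_const]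
    simp only [smeared, probReal_univ, one_smul]
    ring
  have h3 : ‖2 * (smeared G η X - G X)‖ ≤ 2 * (|A 2| * (‖X‖ / 2) ^ (-(s + 2))) * η ^ 2 := by
    rw [e2]
    refine (norm_integral_le_of_norm_le_const (C := 2 * (|A 2| * (‖X‖ / 2) ^ (-(s + 2))) * η ^ 2)
      ?_).trans (by simp)
    filter_upwards [ae_norm_sphereMeasure hη.le] with Y hY
    have := h.abs_symm_diff_le (nonneg_of_exponent_range hs) hX (Z := Y) (by rw [hY]; exact hηX)
    rwa [hY] at this
  rw [norm_mul, Real.norm_ofNat, Real.norm_eq_abs] at h3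
  linarith

end ExtAdmissible

end SmearingError

section ScaledError

variable {d m : ℕ} {s r₀ : ℝ} {A : ℕ → ℝ} {B C₁ C₂ c : ℝ} {g : Space d → ℝ} {G : ExtSpace d m → ℝ}

/-- The profile controlling the smearing error at unit scale. -/
noncomputable def errorProfile (d : ℕ) (s a₀ a₂ L : ℝ) (w : Space d) : ℝ :=
  (ball (0 : Space d) 2).indicator
      (fun w => a₀ * (‖w‖ ^ (-s) + if s = 0 then |Real.log ‖w‖| else 0) + L) w +
    {w : Space d | 2 ≤ ‖w‖}.indicator (fun w => a₂ * 2 ^ (s + 2) * ‖w‖ ^ (-(s + 2))) w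

lemma errorProfile_nonneg {a₀ a₂ L : ℝ} (h₀ : 0 ≤ a₀) (h₂ : 0 ≤ a₂) (hL : 0 ≤ L) (w : Space d) :
    0 ≤ errorProfile d s a₀ a₂ L w := by
  refine add_nonneg (indicator_nonneg (fun w _ => ?_) w) (indicator_nonneg (fun w _ => ?_) w)
  · have : 0 ≤ if s = 0 then |Real.log ‖w‖| else 0 := by split_ifs <;> positivity
    positivity
  · positivity

/-- The singularity needs s < d and the tail needs d < s + 2; this is where the range of s enters
the density error. -/
lemma integrable_errorProfile (hs : (max ((d : ℝ) - 2) 0 < s ∧ s < d) ∨ (d = 1 ∧ s = 0))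
    (hd : 1 ≤ d) (a₀ a₂ L : ℝ) : Integrable (errorProfile d s a₀ a₂ L) := by
  have := nontrivial_space hd
  have hfin : Module.finrank ℝ (Space d) = d := by simp
  have hsd : s < d := by
    rcases hs with hs | ⟨rfl, rfl⟩
    · exact hs.2
    · norm_num
  have hds : (d : ℝ) < s + 2 := by
    rcases hs with hs | ⟨rfl, rfl⟩
    · linarith [(le_max_left _ _).trans_lt hs.1]
    · norm_num
  have hd1 : (1 : ℝ) ≤ d := by exact_mod_cast hd
  have h1 : IntegrableOn (fun w : Space d => ‖w‖ ^ (-s)) (ball 0 2) :=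
    integrableOn_ball_norm_rpow (by rw [hfin]; exact hsd) 2
  have hc : ∀ a : ℝ, IntegrableOn (fun _ : Space d => a) (ball 0 2) := fun a =>
    integrableOn_const measure_ball_lt_top.ne
  have h2 : IntegrableOn (fun w : Space d => |Real.log ‖w‖|) (ball 0 2) := by
    have h3 : IntegrableOn (fun w : Space d => ‖w‖ ^ (-(1 / 2 : ℝ))) (ball 0 2) :=
      integrableOn_ball_norm_rpow (by rw [hfin]; linarith) 2
    refine Integrable.mono' ((h3.add (hc (2 ^ (1 / 2 : ℝ)))).const_mul 2)
      (continuous_abs.measurable.comp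
        (Real.measurable_log.comp measurable_norm)).aestronglyMeasurable ?_
    filter_upwards [ae_restrict_mem measurableSet_ball,
      ae_restrict_of_ae (compl_mem_ae_iff.2 (measure_singleton (0 : Space d)))] with w hw hw0
    rw [mem_ball_zero_iff] at hw
    rw [Real.norm_eq_abs, abs_abs]
    refine (abs_log_le_rpow (norm_pos_iff.2 hw0)).trans ?_
    simp only [Pi.add_apply]
    gcongr
  have h4 : IntegrableOn (fun w : Space d => if s = 0 then |Real.log ‖w‖| else 0) (ball 0 2) := by
    split_ifs
    · exact h2
    · exact hc 0
  have h5 : MeasurableSet {w : Space d | 2 ≤ ‖w‖} := measurableSet_le measurable_const measurable_norm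
  refine Integrable.add (IntegrableOn.integrable_indicator ?_ measurableSet_ball)
    (IntegrableOn.integrable_indicator ?_ h5)
  · exact ((h1.add h4).const_mul a₀).add (hc L)
  · exact (integrableOn_norm_rpow_of_lt (by rw [hfin]; exact hds) two_pos).const_mul _

namespace ExtAdmissible

variable (h : ExtAdmissible d m s r₀ A B C₁ C₂ c g G)
  (hs : (max ((d : ℝ) - 2) 0 < s ∧ s < d) ∨ (d = 1 ∧ s = 0)) (hd : 1 ≤ d)
include h hs hd

/-- For ‖w‖ < 2 the growth bound on G and the lower bound -L on G_η suffice; for ‖w‖ ≥ 2 the error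
is quadratic, and η² (η‖w‖)^(-(s+2)) = η^(-s) ‖w‖^(-(s+2)). When s = 0, log(η‖w‖) splits and leaves
|log η| on the ball. -/
lemma sub_smeared_scaled_le {L : ℝ} (hL0 : 0 ≤ L) (hL : ∀ Z, Z ≠ 0 → ‖Z‖ ≤ 2 * r₀ → -L ≤ G Z)
    {η : ℝ} (hη : 0 < η) (hη1 : η ≤ 1) (hη2 : 2 * η < r₀) {w : Space d} (hw : w ≠ 0) :
    g (η • w) - smeared G η (embedZero d m (η • w)) ≤
      η ^ (-s) * errorProfile d s |A 0| |A 2| L w +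
        (ball (0 : Space d) 2).indicator (fun _ => if s = 0 then |A 0| * |Real.log η| else 0) w := by
  have hs0 := nonneg_of_exponent_range hs
  have hwpos : 0 < ‖w‖ := norm_pos_iff.2 hw
  have hz : η • w ≠ 0 := smul_ne_zero hη.ne' hw
  have hnz : ‖embedZero d m (η • w)‖ = η * ‖w‖ := by
    rw [norm_embedZero, norm_smul, Real.norm_of_nonneg hη.le]
  have hZ := embedZero_ne_zero (m := m) hz
  rw [← h.restrict _ hz]
  unfold errorProfile
  by_cases hw2 : ‖w‖ < 2
  · have hb : w ∈ ball (0 : Space d) 2 := mem_ball_zero_iff.2 hw2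
    have hnb : w ∉ {w : Space d | 2 ≤ ‖w‖} := not_le.2 hw2
    rw [indicator_of_mem hb, indicator_of_mem hb, indicator_of_notMem hnb, add_zero]
    have h1 := (le_abs_self _).trans (h.abs_le hZ)
    have h2 : -L ≤ smeared G η (embedZero d m (η • w)) :=
      h.neg_le_smeared hs hd hη hη2 fun Z hZ0 hZr => hL Z hZ0 (hZr.trans (by rw [hnz]; nlinarith))
    rw [hnz, Real.mul_rpow hη.le hwpos.le] at h1
    -- Since η ≤ 1, the constant L fits under η^(-s) L.
    have h3 : 1 ≤ η ^ (-s) := Real.one_le_rpow_of_pos_of_le_one_of_nonpos hη hη1 (by linarith)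
    have h5 : L ≤ η ^ (-s) * L := le_mul_of_one_le_left hL0 h3
    by_cases hs1 : s = 0
    · subst hs1
      simp only [if_true, neg_zero, Real.rpow_zero, one_mul] at h1 ⊢
      have h4 : |Real.log (η * ‖w‖)| ≤ |Real.log η| + |Real.log ‖w‖| := by
        rw [Real.log_mul hη.ne' hwpos.ne']; exact abs_add_le _ _
      have := mul_le_mul_of_nonneg_left h4 (abs_nonneg (A 0))
      linarith
    · simp only [hs1, if_false, add_zero] at h1 ⊢
      linarith
  · have hnb : w ∉ ball (0 : Space d) 2 := fun hb => hw2 (mem_ball_zero_iff.1 hb)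
    have hb : w ∈ {w : Space d | 2 ≤ ‖w‖} := not_lt.1 hw2
    rw [indicator_of_mem hb, indicator_of_notMem hnb, indicator_of_notMem hnb, add_zero, zero_add]
    have h1 := h.abs_smeared_sub_le hs hd hZ hη hη2 (by rw [hnz]; nlinarith [not_lt.1 hw2])
    rw [abs_sub_comm] at h1
    refine (le_abs_self _).trans (h1.trans (le_of_eq ?_))
    rw [hnz, mul_div_assoc, Real.mul_rpow hη.le (by positivity), Real.div_rpow hwpos.le two_pos.le,
      Real.rpow_neg two_pos.le, div_inv_eq_mul, neg_add s 2, Real.rpow_add hη]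
    have : η ^ (-2 : ℝ) = (η ^ 2)⁻¹ := by
      rw [Real.rpow_neg hη.le]; norm_cast
    rw [this]
    field_simp

end ExtAdmissible

/-- The error made by smearing, integrated against a measure with bounded density. -/
lemma exists_integral_sub_smeared_le
    (hs : (max ((d : ℝ) - 2) 0 < s ∧ s < d) ∨ (d = 1 ∧ s = 0)) (hd : 1 ≤ d)
    (r₀ : ℝ) (A : ℕ → ℝ) (c : ℝ) :
    ∃ K : ℝ, 0 ≤ K ∧ ∀ {m : ℕ} {B C₁ C₂ : ℝ} {g : Space d → ℝ} {G : ExtSpace d m → ℝ},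
      ExtAdmissible d m s r₀ A B C₁ C₂ c g G → ∀ (M : ℝ≥0∞) (μ : Measure (Space d)),
      M ≠ ∞ → μ ≤ M • (volume : Measure (Space d)) → ∀ η, 0 < η → η ≤ 1 → 2 * η < r₀ → ∀ x,
      ∫ y, (g (x - y) - smeared G η (embedZero d m (x - y))) ∂μ ≤
        K * (M.toReal * (η ^ ((d : ℝ) - s) + if s = 0 then η ^ d * |Real.log η| else 0)) := by
  have := nontrivial_space hd
  obtain ⟨L, hL0, hL⟩ := ExtAdmissible.exists_lower_bound d s r₀ hd (nonneg_of_exponent_range hs) A c (2 * r₀)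
  set Ψ := errorProfile d s |A 0| |A 2| L with hΨ
  have hΨi : Integrable Ψ := integrable_errorProfile hs hd _ _ _
  have hΨ0 : ∀ w, 0 ≤ Ψ w := errorProfile_nonneg (abs_nonneg _) (abs_nonneg _) hL0
  set V := (volume (ball (0 : Space d) 2)).toReal with hV
  refine ⟨(∫ w, Ψ w) + |A 0| * V, add_nonneg (integral_nonneg hΨ0) (by positivity), ?_⟩
  intro m B C₁ C₂ g G h M μ hM hμ η hη hη1 hη2 x
  set f : Space d → ℝ := fun z => g z - smeared G η (embedZero d m z) with hf
  have hlog : 0 ≤ if s = 0 then η ^ d * |Real.log η| else 0 := by split_ifs <;> positivity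
  have hΨI : 0 ≤ ∫ w, Ψ w := integral_nonneg hΨ0
  have hrhs : 0 ≤ ((∫ w, Ψ w) + |A 0| * V) *
      (M.toReal * (η ^ ((d : ℝ) - s) + if s = 0 then η ^ d * |Real.log η| else 0)) := by
    have : 0 ≤ M.toReal := ENNReal.toReal_nonneg
    positivity
  by_cases hint : Integrable (fun y => f (x - y)) μ
  swap
  -- Without integrability the integral is 0 by convention, and the right side is nonnegative.
  · rw [integral_undef hint]; exact hrhs
  set Θ : Space d → ℝ := fun w => η ^ (-s) * Ψ w + (ball (0 : Space d) 2).indicator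
    (fun _ => if s = 0 then |A 0| * |Real.log η| else 0) w with hΘ
  have hΘi : Integrable Θ := (hΨi.const_mul _).add
    (IntegrableOn.integrable_indicator (integrableOn_const measure_ball_lt_top.ne) measurableSet_ball)
  have hΘ0 : ∀ w, 0 ≤ Θ w := fun w => by
    refine add_nonneg (mul_nonneg (by positivity) (hΨ0 w)) (indicator_nonneg (fun _ _ => ?_) w)
    split_ifs <;> positivity
  have hpt : ∀ w, w ≠ 0 → f (η • w) ≤ Θ w := fun w hw =>
    h.sub_smeared_scaled_le hs hd hL0 (fun Z hZ hZr => hL h Z hZ hZr) hη hη1 hη2 hw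
  have hΘz : ∀ z, z ≠ 0 → f z ≤ Θ (η⁻¹ • z) := fun z hz => by
    have := hpt (η⁻¹ • z) (smul_ne_zero (inv_ne_zero hη.ne') hz)
    rwa [smul_inv_smul₀ hη.ne'] at this
  have hΘηi : Integrable fun z => Θ (η⁻¹ • z) := hΘi.comp_smul (inv_ne_zero hη.ne')
  have hΘxi : Integrable fun y => Θ (η⁻¹ • (x - y)) := hΘηi.comp_sub_left x
  have hμac : μ ≪ volume := Measure.absolutelyContinuous_of_le_smul hμ
  have hΘμ : Integrable (fun y => Θ (η⁻¹ • (x - y))) μ :=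
    (hΘxi.smul_measure hM).mono_measure hμ
  calc ∫ y, f (x - y) ∂μ ≤ ∫ y, Θ (η⁻¹ • (x - y)) ∂μ := by
        refine integral_mono_ae hint hΘμ (hμac.ae_le ?_)
        filter_upwards [compl_mem_ae_iff.2 (measure_singleton x)] with y hy
        exact hΘz _ (sub_ne_zero.2 (Ne.symm hy))
    _ ≤ ∫ y, Θ (η⁻¹ • (x - y)) ∂(M • (volume : Measure (Space d))) :=
        integral_mono_measure hμ (Eventually.of_forall fun y => hΘ0 _) (hΘxi.smul_measure hM)
    _ = M.toReal * ∫ y, Θ (η⁻¹ • (x - y)) := by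
        rw [integral_smul_measure, smul_eq_mul]
    _ = M.toReal * (η ^ d * ∫ w, Θ w) := by
        rw [integral_sub_left_eq_self (fun z => Θ (η⁻¹ • z)) volume x,
          Measure.integral_comp_inv_smul_of_nonneg _ _ hη.le]
        simp
    _ = M.toReal * (η ^ d * (η ^ (-s) * (∫ w, Ψ w) +
          V * if s = 0 then |A 0| * |Real.log η| else 0)) := by
        rw [hΘ, integral_add (hΨi.const_mul _) (IntegrableOn.integrable_indicator
          (integrableOn_const measure_ball_lt_top.ne) measurableSet_ball), integral_const_mul,
          integral_indicator measurableSet_ball, setIntegral_const, smul_eq_mul]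
        rfl
    _ ≤ _ := by
        rw [mul_left_comm _ M.toReal]
        refine mul_le_mul_of_nonneg_left ?_ ENNReal.toReal_nonneg
        have e1 : η ^ ((d : ℝ) - s) = η ^ d * η ^ (-s) := by
          rw [sub_eq_add_neg, Real.rpow_add hη, Real.rpow_natCast]
        rw [e1]
        have p1 : 0 ≤ η ^ d * η ^ (-s) := by positivity
        have p2 : 0 ≤ |A 0| * V := by positivity
        split_ifs at hlog ⊢
        · nlinarith [mul_nonneg hΨI hlog, mul_nonneg p2 p1]
        · nlinarith [mul_nonneg p2 p1]

end ScaledError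

/-! ### Potentials of measures with bounded density -/

section DensityPotential

variable {d m : ℕ} {s r₀ : ℝ} {A : ℕ → ℝ} {B C₁ C₂ c : ℝ} {g : Space d → ℝ} {G : ExtSpace d m → ℝ}

namespace ExtAdmissible

variable (h : ExtAdmissible d m s r₀ A B C₁ C₂ c g G)
  (hs : (max ((d : ℝ) - 2) 0 < s ∧ s < d) ∨ (d = 1 ∧ s = 0)) (hd : 1 ≤ d)
  {M : ℝ≥0∞} (hM : M ≠ ∞) {μ : Measure (Space d)} [IsProbabilityMeasure μ]
  (hμ : μ ≤ M • (volume : Measure (Space d)))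
  (hlog : s = 0 → Integrable (fun y => Real.log (1 + ‖y‖)) μ)
include h hs hd hM hμ hlog

/-- The potential of a measure with bounded density grows at most logarithmically. -/
lemma exists_lintegral_embedZero_le : ∃ T : ℝ, ∀ a : ExtSpace d m,
    ∫⁻ y, ENNReal.ofReal |G (a - embedZero d m y)| ∂μ ≤
      ENNReal.ofReal (T + 3 * |A 0| * if s = 0 then Real.log (1 + ‖a‖) else 0) := by
  have := nontrivial_space hd
  have hμac : μ ≪ volume := Measure.absolutelyContinuous_of_le_smul hμ
  have hp : singularExponent s < Module.finrank ℝ (Space d) := by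
    simpa using singularExponent_lt hs
  have hp0 := singularExponent_pos (nonneg_of_exponent_range hs)
  -- The singular part, measured in ℝ^d after projecting: ‖a - (y, 0)‖ is at least the distance from
  -- y to the projection of a. The radius 2 leaves room for the closed condition ‖X‖ ≤ 1.
  set u : Space d → ℝ := (ball (0 : Space d) 2).indicator fun z => ‖z‖ ^ (-singularExponent s)
    with hu
  have hui : Integrable u := (integrableOn_ball_norm_rpow hp 2).integrable_indicator measurableSet_ball
  have hu0 : ∀ z, 0 ≤ u z := fun z => indicator_nonneg (fun _ _ => by positivity) z
  have hli : Integrable (fun y => if s = 0 then Real.log (1 + ‖y‖) else 0) μ := by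
    split_ifs with hs0
    · exact hlog hs0
    · exact integrable_const 0
  set Il := ∫ y, (if s = 0 then Real.log (1 + ‖y‖) else 0) ∂μ with hIl
  refine ⟨3 * |A 0| * ((M.toReal * ∫ z, u z) + (1 + Il)), fun a => ?_⟩
  set la : ℝ := if s = 0 then Real.log (1 + ‖a‖) else 0 with hla
  have hl0 : ∀ t : ℝ, 0 ≤ t → 0 ≤ if s = 0 then Real.log (1 + t) else 0 := by
    intro t ht
    split_ifs
    · exact Real.log_nonneg (by linarith)
    · exact le_rfl
  set F : Space d → ℝ := fun y => 3 * |A 0| * (u (extFst d m a - y) +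
    ((1 + la) + if s = 0 then Real.log (1 + ‖y‖) else 0)) with hF
  have hF0 : ∀ y, 0 ≤ F y := fun y => by
    have := hu0 (extFst d m a - y)
    have := hl0 ‖a‖ (norm_nonneg _)
    have := hl0 ‖y‖ (norm_nonneg _)
    positivity
  have huv : Integrable fun y => u (extFst d m a - y) := hui.comp_sub_left _
  have huμ : Integrable (fun y => u (extFst d m a - y)) μ :=
    (huv.smul_measure hM).mono_measure hμ
  have hFi : Integrable F μ :=
    (huμ.add ((integrable_const _).add hli)).const_mul _
  have hle : ∀ᵐ y ∂μ, |G (a - embedZero d m y)| ≤ F y := by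
    filter_upwards [hμac (compl_mem_ae_iff.2 (measure_singleton (extFst d m a)))] with y hy
    have hz : 0 < ‖extFst d m a - y‖ := norm_pos_iff.2 (sub_ne_zero.2 (Ne.symm hy))
    have hzX : ‖extFst d m a - y‖ ≤ ‖a - embedZero d m y‖ := by
      rw [← extFst_sub_embedZero]; exact norm_extFst_le _
    have hX : a - embedZero d m y ≠ 0 := norm_pos_iff.1 (hz.trans_le hzX)
    refine (h.abs_le_log (nonneg_of_exponent_range hs) hX).trans ?_
    rw [hF]
    simp only
    refine mul_le_mul_of_nonneg_left (add_le_add ?_ ?_) (by positivity)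
    · split_ifs with h1
      · rw [hu, indicator_of_mem (mem_ball_zero_iff.2 (by linarith))]
        exact Real.rpow_le_rpow_of_nonpos hz hzX (by linarith)
      · exact hu0 _
    · rw [add_assoc]
      gcongr
      rw [hla]
      split_ifs
      · rw [← Real.log_mul (by positivity) (by positivity)]
        refine Real.log_le_log (by positivity) ?_
        have := norm_sub_le a (embedZero d m y)
        rw [norm_embedZero] at this
        nlinarith [norm_nonneg a, norm_nonneg y]
      · simp
  calc ∫⁻ y, ENNReal.ofReal |G (a - embedZero d m y)| ∂μ ≤ ∫⁻ y, ENNReal.ofReal (F y) ∂μ := by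
        refine lintegral_mono_ae ?_
        filter_upwards [hle] with y hy
        gcongr
    _ = ENNReal.ofReal (∫ y, F y ∂μ) :=
        (ofReal_integral_eq_lintegral_ofReal hFi (Eventually.of_forall hF0)).symm
    _ ≤ _ := by
        refine ENNReal.ofReal_le_ofReal ?_
        have h1 : ∫ y, u (extFst d m a - y) ∂μ ≤ M.toReal * ∫ z, u z := by
          refine (integral_mono_measure hμ (Eventually.of_forall fun y => hu0 _)
            (huv.smul_measure hM)).trans (le_of_eq ?_)
          rw [integral_smul_measure, smul_eq_mul, integral_sub_left_eq_self]
        have h2 : ∫ y, ((1 + la) + if s = 0 then Real.log (1 + ‖y‖) else 0) ∂μ = (1 + la) + Il := by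
          rw [integral_add (integrable_const _) hli, integral_const, probReal_univ, one_smul]
        have h3 : ∫ y, F y ∂μ = 3 * |A 0| * ((∫ y, u (extFst d m a - y) ∂μ) + ((1 + la) + Il)) := by
          rw [hF, integral_const_mul, ← h2]
          congr 1
          exact integral_add huμ ((integrable_const _).add hli)
        rw [h3, ← mul_add]
        refine mul_le_mul_of_nonneg_left ?_ (by positivity)
        linarith

/-- The potential of |G| generated by μ is bounded if s > 0 and grows logarithmically if s = 0, so
the logarithmic moment of α is all that is needed. -/
lemma integrable_prod_map_embedZero (α : Measure (ExtSpace d m)) [IsProbabilityMeasure α]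
    (hα : s = 0 → Integrable (fun a => Real.log (1 + ‖a‖)) α) :
    Integrable (fun q : ExtSpace d m × ExtSpace d m => G (q.1 - q.2))
      (α.prod (μ.map (embedZero d m))) := by
  obtain ⟨T, hT⟩ := h.exists_lintegral_embedZero_le hs hd hM hμ hlog
  have hGm := h.measurable
  have := (Measure.isProbabilityMeasure_map (μ := μ)
    (measurable_embedZero (d := d) (m := m)).aemeasurable)
  have hm : Measurable fun q : ExtSpace d m × ExtSpace d m => G (q.1 - q.2) := by fun_prop
  refine ⟨hm.aestronglyMeasurable, ?_⟩
  rw [hasFiniteIntegral_iff_norm, lintegral_prod _ (by fun_prop)]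
  have h1 : ∀ a, ∫⁻ b, ENNReal.ofReal ‖G (a - b)‖ ∂(μ.map (embedZero d m)) ≤
      ENNReal.ofReal (T + 3 * |A 0| * if s = 0 then Real.log (1 + ‖a‖) else 0) := by
    intro a
    rw [lintegral_map (by fun_prop) measurable_embedZero]
    exact hT a
  refine (lintegral_mono h1).trans_lt ?_
  have h2 : Integrable (fun a => T + 3 * |A 0| * if s = 0 then Real.log (1 + ‖a‖) else 0) α := by
    refine (integrable_const _).add (Integrable.const_mul ?_ _)
    split_ifs with hs0
    · exact hα hs0
    · exact integrable_const 0
  exact Integrable.lintegral_lt_top h2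

end ExtAdmissible

end DensityPotential

/-! ### Interaction of two smeared charges -/

section SphereInteraction

variable {d m : ℕ} {s r₀ : ℝ} {A : ℕ → ℝ} {B C₁ C₂ c : ℝ} {g : Space d → ℝ} {G : ExtSpace d m → ℝ}

/-- The interaction of two spheres, written as an integral over centred spheres. -/
lemma map_prod_sphereMeasure {E : Type*} [NormedAddCommGroup E] [InnerProductSpace ℝ E]
    [FiniteDimensional ℝ E] [MeasurableSpace E] [BorelSpace E] [Nontrivial E] (X X' : E) (η η' : ℝ) :
    ((sphereMeasure X η).prod (sphereMeasure X' η')).map (fun q => q.1 - q.2) =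
      ((sphereMeasure (0 : E) η).prod (sphereMeasure (0 : E) η')).map
        (fun q => X - X' + q.2 - q.1) := by
  have e1 := (measurePreserving_neg_sphereMeasure (E := E) η).prod
    (measurePreserving_neg_sphereMeasure (E := E) η')
  rw [sphereMeasure_eq_map X, sphereMeasure_eq_map X', Measure.map_prod_map _ _
    (by fun_prop) (by fun_prop)]
  rw [← e1.map_eq, Measure.map_map (by fun_prop) (by fun_prop),
    Measure.map_map (by fun_prop) (by fun_prop), e1.map_eq]
  congr 1
  funext q
  simp only [Function.comp, Prod.map]
  abel

namespace ExtAdmissible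

variable (h : ExtAdmissible d m s r₀ A B C₁ C₂ c g G)
  (hs : (max ((d : ℝ) - 2) 0 < s ∧ s < d) ∨ (d = 1 ∧ s = 0)) (hd : 1 ≤ d)

lemma integral_prod_sphereMeasure (hd : 1 ≤ d) (h : ExtAdmissible d m s r₀ A B C₁ C₂ c g G)
    (X X' : ExtSpace d m) (η η' : ℝ) :
    ∫ q, G (q.1 - q.2) ∂((sphereMeasure X η).prod (sphereMeasure X' η')) =
      ∫ q, G (X - X' + q.2 - q.1) ∂((sphereMeasure (0 : ExtSpace d m) η).prod
        (sphereMeasure (0 : ExtSpace d m) η')) := by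
  have := nontrivial_extSpace (m := m) hd
  have hm : StronglyMeasurable G := h.measurable.stronglyMeasurable
  rw [← integral_map (φ := fun q : ExtSpace d m × ExtSpace d m => q.1 - q.2) (f := G)
    (by fun_prop) hm.aestronglyMeasurable, map_prod_sphereMeasure,
    integral_map (by fun_prop) hm.aestronglyMeasurable]

include h hs hd

/-- The inner average of |G| over the sphere of radius η is bounded uniformly in its centre a + Z,
as ‖Z‖ = η'. -/
lemma integrable_prod_sphereMeasure_centred (a : ExtSpace d m) {η η' : ℝ} (hη : 0 < η)
    (hη2 : 2 * η < r₀) (hη' : 0 < η') :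
    Integrable (fun q : ExtSpace d m × ExtSpace d m => G (a + q.2 - q.1))
      ((sphereMeasure (0 : ExtSpace d m) η).prod (sphereMeasure (0 : ExtSpace d m) η')) := by
  have := nontrivial_extSpace (m := m) hd
  obtain ⟨K, hK0, hK⟩ := exists_lintegral_sphere_le hs hd m r₀ A c η (‖a‖ + η') hη
  have hGm := h.measurable
  have hm : Measurable fun q : ExtSpace d m × ExtSpace d m => G (a + q.2 - q.1) := by fun_prop
  refine ⟨hm.aestronglyMeasurable, ?_⟩
  rw [hasFiniteIntegral_iff_norm, lintegral_prod_symm' _ (by fun_prop)]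
  have h1 : ∫⁻ Z, ∫⁻ Y, ENNReal.ofReal ‖G (a + Z - Y)‖ ∂sphereMeasure (0 : ExtSpace d m) η
      ∂sphereMeasure (0 : ExtSpace d m) η' ≤
      ∫⁻ _, ENNReal.ofReal K ∂sphereMeasure (0 : ExtSpace d m) η' := by
    refine lintegral_mono_ae ?_
    filter_upwards [ae_norm_sphereMeasure hη'.le] with Z hZ
    exact hK h η le_rfl hη2 (a + Z) ((norm_add_le _ _).trans (by rw [hZ]))
  refine h1.trans_lt ?_
  simp

lemma integrable_prod_sphereMeasure (X X' : ExtSpace d m) {η η' : ℝ} (hη : 0 < η)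
    (hη2 : 2 * η < r₀) (hη' : 0 < η') :
    Integrable (fun q : ExtSpace d m × ExtSpace d m => G (q.1 - q.2))
      ((sphereMeasure X η).prod (sphereMeasure X' η')) := by
  have := nontrivial_extSpace (m := m) hd
  have h1 := h.integrable_prod_sphereMeasure_centred hs hd (X - X') hη hη2 hη'
  have hm : StronglyMeasurable G := h.measurable.stronglyMeasurable
  have h2 := (integrable_map_measure (μ := (sphereMeasure (0 : ExtSpace d m) η).prod
    (sphereMeasure (0 : ExtSpace d m) η')) (f := fun q : ExtSpace d m × ExtSpace d m =>
      X - X' + q.2 - q.1) (g := G) hm.aestronglyMeasurable (by fun_prop)).2 h1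
  rw [← map_prod_sphereMeasure] at h2
  exact (integrable_map_measure (f := fun q : ExtSpace d m × ExtSpace d m => q.1 - q.2)
    hm.aestronglyMeasurable (by fun_prop)).1 h2

lemma integral_prod_eq_integral_smeared (X X' : ExtSpace d m) {η η' : ℝ} (hη : 0 < η)
    (hη2 : 2 * η < r₀) (hη' : 0 < η') :
    ∫ q, G (q.1 - q.2) ∂((sphereMeasure X η).prod (sphereMeasure X' η')) =
      ∫ Z, smeared G η (X - X' + Z) ∂sphereMeasure (0 : ExtSpace d m) η' := by
  have := nontrivial_extSpace (m := m) hd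
  rw [integral_prod_sphereMeasure hd h,
    integral_prod_symm _ (h.integrable_prod_sphereMeasure_centred hs hd (X - X') hη hη2 hη')]
  rfl

lemma integrable_smeared_sphere (a : ExtSpace d m) {η η' : ℝ} (hη : 0 < η)
    (hη2 : 2 * η < r₀) (hη' : 0 < η') :
    Integrable (fun Z => smeared G η (a + Z)) (sphereMeasure (0 : ExtSpace d m) η') := by
  have := nontrivial_extSpace (m := m) hd
  exact (h.integrable_prod_sphereMeasure_centred hs hd a hη hη2 hη').integral_prod_right

lemma integrable_sphere_add {η : ℝ} (hη : 0 < η) (hη2 : 2 * η < r₀) (X : ExtSpace d m) :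
    Integrable (fun Y => G (X + Y)) (sphereMeasure (0 : ExtSpace d m) η) := by
  have := nontrivial_extSpace (m := m) hd
  have hI := h.integrable_sphere hs hd hη hη2 X
  refine (((measurePreserving_neg_sphereMeasure (E := ExtSpace d m) η).integrable_comp
    hI.aestronglyMeasurable).2 hI).congr (Eventually.of_forall fun Y => ?_)
  simp

omit hs h in
lemma smeared_eq_integral_add (η : ℝ) (X : ExtSpace d m) :
    smeared G η X = ∫ Y, G (X + Y) ∂sphereMeasure (0 : ExtSpace d m) η := by
  have := nontrivial_extSpace (m := m) hd
  rw [smeared, ← (measurePreserving_neg_sphereMeasure (E := ExtSpace d m) η).integral_comp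
    (Homeomorph.neg _).measurableEmbedding]
  simp

lemma ae_add_ne_zero {η : ℝ} (hη : 0 < η) (hη2 : 2 * η < r₀) (X : ExtSpace d m) :
    ∀ᵐ Y ∂sphereMeasure (0 : ExtSpace d m) η, X + Y ≠ 0 := by
  filter_upwards [h.ae_sub_ne_zero hs hd hη hη2 (-X)] with Y hY h0
  exact hY (by rw [← neg_add', h0, neg_zero])

/-- Superharmonicity bounds the interaction of two close spheres by the smeared potential. -/
lemma integral_prod_le_smeared (X X' : ExtSpace d m) {η η' : ℝ} (hη : 0 < η) (hη2 : 2 * η < r₀)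
    (hη' : 0 < η') (hη'2 : 2 * η' < r₀) (hX : ‖X - X'‖ + η' + η < r₀) :
    ∫ q, G (q.1 - q.2) ∂((sphereMeasure X η).prod (sphereMeasure X' η')) ≤
      smeared G η' (X - X') := by
  have := nontrivial_extSpace (m := m) hd
  rw [h.integral_prod_eq_integral_smeared hs hd X X' hη hη2 hη', smeared_eq_integral_add hd]
  refine integral_mono_ae (h.integrable_smeared_sphere hs hd _ hη hη2 hη')
    (h.integrable_sphere_add hs hd hη' hη'2 _) ?_
  filter_upwards [ae_norm_sphereMeasure hη'.le, h.ae_add_ne_zero hs hd hη' hη'2 (X - X')]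
    with Z hZ hZ0
  refine h.smeared_le hs hd hZ0 hη hη2 ?_
  have := norm_add_le (X - X') Z
  linarith

/-- The interaction of two distant spheres is close to that of their centres. -/
lemma abs_integral_prod_sub_le (X X' : ExtSpace d m) {η η' : ℝ} (hη : 0 < η) (hη2 : 2 * η < r₀)
    (hη' : 0 < η') (hη'2 : 2 * η' < r₀) (h1 : r₀ / 2 + η' ≤ ‖X - X'‖)
    (h2 : 2 * η + η' ≤ ‖X - X'‖) :
    |(∫ q, G (q.1 - q.2) ∂((sphereMeasure X η).prod (sphereMeasure X' η'))) - G (X - X')| ≤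
      |A 2| * (r₀ / 4) ^ (-(s + 2)) * (η ^ 2 + η' ^ 2) := by
  have := nontrivial_extSpace (m := m) hd
  have hr := h.r₀_pos
  have hs0 := nonneg_of_exponent_range hs
  have hfar : ∀ Y : ExtSpace d m, r₀ / 2 ≤ ‖Y‖ → ∀ ζ, 0 < ζ → 2 * ζ < r₀ → ζ ≤ ‖Y‖ / 2 →
      |smeared G ζ Y - G Y| ≤ |A 2| * (r₀ / 4) ^ (-(s + 2)) * ζ ^ 2 := by
    intro Y hY ζ hζ hζ2 hζY
    refine (h.abs_smeared_sub_le hs hd (norm_pos_iff.1 (by linarith)) hζ hζ2 hζY).trans ?_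
    have : (‖Y‖ / 2) ^ (-(s + 2)) ≤ (r₀ / 4) ^ (-(s + 2)) :=
      Real.rpow_le_rpow_of_nonpos (by linarith) (by linarith) (by linarith)
    gcongr
  have e1 := hfar (X - X') (by linarith) η' hη' hη'2 (by linarith)
  have e2 : |(∫ q, G (q.1 - q.2) ∂((sphereMeasure X η).prod (sphereMeasure X' η'))) -
      smeared G η' (X - X')| ≤ |A 2| * (r₀ / 4) ^ (-(s + 2)) * η ^ 2 := by
    rw [h.integral_prod_eq_integral_smeared hs hd X X' hη hη2 hη', smeared_eq_integral_add hd,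
      ← integral_sub (h.integrable_smeared_sphere hs hd _ hη hη2 hη')
        (h.integrable_sphere_add hs hd hη' hη'2 _), ← Real.norm_eq_abs]
    refine (norm_integral_le_of_norm_le_const (C := |A 2| * (r₀ / 4) ^ (-(s + 2)) * η ^ 2)
      ?_).trans (by simp)
    filter_upwards [ae_norm_sphereMeasure hη'.le] with Z hZ
    have h4 : ‖X - X'‖ - η' ≤ ‖X - X' + Z‖ := by
      have := norm_sub_le (X - X' + Z) Z
      rw [add_sub_cancel_right, hZ] at this
      linarith
    exact hfar _ (by linarith) η hη hη2 (by linarith)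
  have := _root_.abs_sub_le (∫ q, G (q.1 - q.2) ∂((sphereMeasure X η).prod (sphereMeasure X' η')))
    (smeared G η' (X - X')) (G (X - X'))
  linarith

end ExtAdmissible

/-- The interaction of two spheres is bounded when one of the radii is bounded below. -/
lemma exists_integral_prod_le (hs : (max ((d : ℝ) - 2) 0 < s ∧ s < d) ∨ (d = 1 ∧ s = 0))
    (hd : 1 ≤ d) (m : ℕ) (r₀ : ℝ) (A : ℕ → ℝ) (c η₀ R : ℝ) (hη₀ : 0 < η₀) :
    ∃ K : ℝ, 0 ≤ K ∧ ∀ {B C₁ C₂ : ℝ} {g : Space d → ℝ} {G : ExtSpace d m → ℝ},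
      ExtAdmissible d m s r₀ A B C₁ C₂ c g G → ∀ η η', 0 < η → 2 * η < r₀ → 0 < η' →
      2 * η' < r₀ → η₀ ≤ max η η' → ∀ X X', ‖X - X'‖ ≤ R →
      ∫ q, G (q.1 - q.2) ∂((sphereMeasure X η).prod (sphereMeasure X' η')) ≤ K := by
  have := nontrivial_extSpace (m := m) hd
  obtain ⟨K, hK0, hK⟩ := ExtAdmissible.exists_lintegral_sphere_le hs hd m r₀ A c η₀ (R + r₀) hη₀
  have main : ∀ {B C₁ C₂ : ℝ} {g : Space d → ℝ} {G : ExtSpace d m → ℝ},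
      ExtAdmissible d m s r₀ A B C₁ C₂ c g G → ∀ η η', 0 < η → 2 * η < r₀ → 0 < η' →
      2 * η' < r₀ → η₀ ≤ η → ∀ X X', ‖X - X'‖ ≤ R →
      ∫ q, G (q.1 - q.2) ∂((sphereMeasure X η).prod (sphereMeasure X' η')) ≤ K := by
    intro B C₁ C₂ g G h η η' hη hη2 hη' hη'2 hηη X X' hX
    rw [h.integral_prod_eq_integral_smeared hs hd X X' hη hη2 hη']
    have h1 : ∫ Z, smeared G η (X - X' + Z) ∂sphereMeasure (0 : ExtSpace d m) η' ≤
        ∫ _, K ∂sphereMeasure (0 : ExtSpace d m) η' := by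
      refine integral_mono_ae (h.integrable_smeared_sphere hs hd _ hη hη2 hη')
        (integrable_const _) ?_
      filter_upwards [ae_norm_sphereMeasure hη'.le] with Z hZ
      refine (le_abs_self _).trans (h.abs_smeared_le hs hd hK0 (hK h η hηη hη2 _ ?_))
      have := norm_add_le (X - X') Z
      linarith
    simpa using h1
  refine ⟨K, hK0, fun {B C₁ C₂ g G} h η η' hη hη2 hη' hη'2 hmax X X' hX => ?_⟩
  rcases le_max_iff.1 hmax with h1 | h1
  · exact main h η η' hη hη2 hη' hη'2 h1 X X' hX
  -- If η' is the large radius, the two spheres are exchanged. Evenness of G holds off the origin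
  -- only, hence the check that the diagonal is null.
  · have h2 := main h η' η hη' hη'2 hη hη2 h1 X' X (by rwa [norm_sub_rev])
    refine le_trans (le_of_eq ?_) h2
    rw [← integral_prod_swap]
    refine integral_congr_ae ?_
    have hα : ∀ Z, sphereMeasure X η {Z} = 0 := fun Z => by
      rw [sphereMeasure_eq_map, Measure.map_apply (by fun_prop) (measurableSet_singleton Z)]
      refine measure_mono_null (fun Y hY => ?_) (h.sphereMeasure_singleton hs hd hη hη2 (Z - X))
      have hY' : X + Y = Z := hY
      simp [← hY']
    filter_upwards [ae_prod_sub_ne_zero _ _ hα] with q hq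
    have h3 := h.even _ hq
    rw [neg_sub] at h3
    exact h3.symm

end SphereInteraction

/-! ### Averages of measures and their products -/

section Averages

variable {E F : Type*} [MeasurableSpace E] [MeasurableSpace F] {N : ℕ}

lemma isProbabilityMeasure_averageMeasure (hN : 0 < N) (ν : Fin N → Measure E)
    [∀ i, IsProbabilityMeasure (ν i)] : IsProbabilityMeasure (averageMeasure ν) := by
  constructor
  rw [averageMeasure, Measure.smul_apply, Measure.finsetSum_apply]
  simp only [measure_univ, Finset.sum_const, Finset.card_univ, Fintype.card_fin, nsmul_eq_mul,
    mul_one, smul_eq_mul]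
  exact ENNReal.inv_mul_cancel (by exact_mod_cast hN.ne') (ENNReal.natCast_ne_top N)

lemma averageMeasure_prod (ν : Fin N → Measure E) [∀ i, SFinite (ν i)] (β : Measure F) [SFinite β] :
    (averageMeasure ν).prod β = averageMeasure fun i => (ν i).prod β := by
  unfold averageMeasure
  rw [Measure.prod_smul_left, ← Measure.sum_fintype, ← Measure.sum_fintype, Measure.prod_sum_left]

lemma prod_averageMeasure (α : Measure E) [SFinite α] (ν : Fin N → Measure F)
    [∀ i, SFinite (ν i)] : α.prod (averageMeasure ν) = averageMeasure fun i => α.prod (ν i) := by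
  unfold averageMeasure
  have : SFinite (∑ i, ν i) := by rw [← Measure.sum_fintype]; infer_instance
  rw [Measure.prod_smul_right, ← Measure.sum_fintype, ← Measure.sum_fintype, Measure.prod_sum_right]

lemma integrable_averageMeasure (hN : 0 < N) {ν : Fin N → Measure E} {f : E → ℝ}
    (hf : ∀ i, Integrable f (ν i)) : Integrable f (averageMeasure ν) := by
  refine Integrable.smul_measure (integrable_finsetSum_measure.2 fun i _ => hf i) ?_
  exact ENNReal.inv_ne_top.2 (by exact_mod_cast hN.ne')

lemma integral_averageMeasure {ν : Fin N → Measure E} {f : E → ℝ}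
    (hf : ∀ i, Integrable f (ν i)) :
    ∫ x, f x ∂(averageMeasure ν) = 1 / (N : ℝ) * ∑ i, ∫ x, f x ∂(ν i) := by
  rw [averageMeasure, integral_smul_measure, integral_finsetSum_measure fun i _ => hf i]
  simp

end Averages

/-! ### Point interactions against smeared interactions -/

section PairBound

variable {d m : ℕ} {s r₀ : ℝ} {A : ℕ → ℝ} {B C₁ C₂ c : ℝ} {g : Space d → ℝ} {G : ExtSpace d m → ℝ}

/-- The interaction of two points dominates that of the smeared charges. -/
lemma exists_pair_bound (hs : (max ((d : ℝ) - 2) 0 < s ∧ s < d) ∨ (d = 1 ∧ s = 0))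
    (hd : 1 ≤ d) (m : ℕ) (r₀ : ℝ) (A : ℕ → ℝ) (c : ℝ) :
    ∃ K : ℝ, 0 ≤ K ∧ ∀ {B C₁ C₂ : ℝ} {g : Space d → ℝ} {G : ExtSpace d m → ℝ},
      ExtAdmissible d m s r₀ A B C₁ C₂ c g G → ∀ η η', 0 < η → 2 * η < r₀ → 0 < η' →
      2 * η' < r₀ → ∀ x y : Space d, x ≠ y →
      (if ‖y - x‖ ≤ r₀ / 2 then max (g (x - y) - smeared G η' (embedZero d m (x - y))) 0 else 0) ≤
        g (x - y) - (∫ q, G (q.1 - q.2) ∂((sphereMeasure (embedZero d m x) η).prod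
          (sphereMeasure (embedZero d m y) η'))) + K * (η ^ 2 + η' ^ 2) := by
  rcases le_or_gt r₀ 0 with hr | hr
  · exact ⟨0, le_rfl, fun h => absurd h.r₀_pos hr.not_gt⟩
  have hs0 := nonneg_of_exponent_range hs
  obtain ⟨L, hL0, hL⟩ := ExtAdmissible.exists_lower_bound d s r₀ hd hs0 A c (3 * r₀)
  -- The threshold r₀ / 6 makes η, η' < r₀ / 6 and ‖a‖ + η + η' ≥ r₀ imply ‖a‖ > 2 r₀ / 3, which
  -- exceeds both r₀ / 2 + η' and 2η + η'.
  obtain ⟨K, hK0, hK⟩ := exists_integral_prod_le hs hd m r₀ A c (r₀ / 6) (2 * r₀) (by linarith)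
  set K₁ := |A 2| * (r₀ / 4) ^ (-(s + 2)) with hK₁
  have hK₁0 : 0 ≤ K₁ := by positivity
  refine ⟨K₁ + 36 * (L + K) / r₀ ^ 2, by positivity, ?_⟩
  intro B C₁ C₂ g G h η η' hη hη2 hη' hη'2 x y hxy
  have hz : x - y ≠ 0 := sub_ne_zero.2 hxy
  have ha : embedZero d m (x - y) ≠ 0 := embedZero_ne_zero hz
  have hna : ‖embedZero d m (x - y)‖ = ‖y - x‖ := by rw [norm_embedZero, norm_sub_rev]
  set Q := ∫ q, G (q.1 - q.2) ∂((sphereMeasure (embedZero d m x) η).prod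
          (sphereMeasure (embedZero d m y) η')) with hQ
  have e0 : embedZero d m x - embedZero d m y = embedZero d m (x - y) := (embedZero_sub x y).symm
  rw [← h.restrict _ hz]
  set a := embedZero d m (x - y) with haa
  have hsq : 0 ≤ η ^ 2 + η' ^ 2 := by positivity
  have hterm : 0 ≤ 36 * (L + K) / r₀ ^ 2 := by positivity
  -- Everything stays in B(0, r₀): Q ≤ G_η' a ≤ G a, so the positive part is attained and bounded by
  -- G a - Q.
  by_cases hb : ‖a‖ + η' + η < r₀
  · have h1 : Q ≤ smeared G η' a := by
      have := h.integral_prod_le_smeared hs hd (embedZero d m x) (embedZero d m y) hη hη2 hη' hη'2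
        (by rw [e0]; exact hb)
      rwa [e0] at this
    have h2 : smeared G η' a ≤ G a := h.smeared_le hs hd ha hη' hη'2 (by linarith)
    have h3 : 0 ≤ (K₁ + 36 * (L + K) / r₀ ^ 2) * (η ^ 2 + η' ^ 2) := by positivity
    split_ifs
    · rw [max_eq_left (by linarith)]; linarith
    · linarith
  rw [not_lt] at hb
  -- Well separated spheres: the error is quadratic, and ‖a‖ > r₀ / 2, so the left side is 0.
  by_cases hc : max η η' < r₀ / 6 ∨ 2 * r₀ ≤ ‖a‖
  · have h1 : r₀ / 2 + η' ≤ ‖a‖ := by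
      rcases hc with hc | hc
      · have := max_lt_iff.1 hc; linarith
      · linarith
    have h2 : 2 * η + η' ≤ ‖a‖ := by
      rcases hc with hc | hc
      · have := max_lt_iff.1 hc; linarith
      · linarith
    have h3 := h.abs_integral_prod_sub_le hs hd (embedZero d m x) (embedZero d m y) hη hη2 hη' hη'2
      (by rw [e0]; exact h1) (by rw [e0]; exact h2)
    rw [e0, ← hQ, ← hK₁] at h3
    have h4 := (_root_.abs_le.1 h3).2
    rw [if_neg (by rw [← hna]; linarith)]
    have h5 := mul_nonneg hterm hsq
    rw [add_mul]
    linarith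
  -- A radius is at least r₀ / 6 and ‖a‖ < 2 r₀. Then Q - G_η' a and Q - G a are at most K + L,
  -- which 36 (L + K) / r₀² times η² + η'² dominates.
  · rw [not_or, not_lt, not_le] at hc
    have h1 : Q ≤ K := hK h η η' hη hη2 hη' hη'2 hc.1 _ _ (by rw [e0]; exact hc.2.le)
    have h2 : -L ≤ G a := hL h a ha (by linarith [hc.2])
    have h3 : -L ≤ smeared G η' a := h.neg_le_smeared hs hd hη' hη'2 fun Z hZ hZr =>
      hL h Z hZ (hZr.trans (by linarith [hc.2]))
    have h4 : L + K ≤ (K₁ + 36 * (L + K) / r₀ ^ 2) * (η ^ 2 + η' ^ 2) := by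
      have h5 : (r₀ / 6) ^ 2 ≤ η ^ 2 + η' ^ 2 := by
        rcases le_max_iff.1 hc.1 with h6 | h6
        · have := pow_le_pow_left₀ (by linarith) h6 2
          linarith [sq_nonneg η']
        · have := pow_le_pow_left₀ (by linarith) h6 2
          linarith [sq_nonneg η]
      calc L + K = 36 * (L + K) / r₀ ^ 2 * (r₀ / 6) ^ 2 := by field_simp; norm_num
        _ ≤ 36 * (L + K) / r₀ ^ 2 * (η ^ 2 + η' ^ 2) := by gcongr
        _ ≤ _ := by
          rw [add_mul]
          have := mul_nonneg hK₁0 hsq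
          linarith
    split_ifs
    · exact max_le (by linarith) (by linarith)
    · linarith

end PairBound

/-! ### The modulated energy as a sum -/

section EnergyDecomposition

variable {d m : ℕ} {s r₀ : ℝ} {A : ℕ → ℝ} {B C₁ C₂ c : ℝ} {g : Space d → ℝ} {G : ExtSpace d m → ℝ}

lemma measurableSet_offDiagonal (d : ℕ) : MeasurableSet (offDiagonal (Space d)) :=
  (measurableSet_eq_fun measurable_fst measurable_snd).compl

namespace ExtAdmissible

variable (h : ExtAdmissible d m s r₀ A B C₁ C₂ c g G)
include h

lemma indicator_offDiagonal_eq (p : Space d × Space d) :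
    (offDiagonal (Space d)).indicator (fun p => g (p.1 - p.2)) p =
      (offDiagonal (Space d)).indicator
        (fun p => G (embedZero d m p.1 - embedZero d m p.2)) p := by
  by_cases hp : p ∈ offDiagonal (Space d)
  · rw [indicator_of_mem hp, indicator_of_mem hp, ← embedZero_sub,
      h.restrict _ (sub_ne_zero.2 hp)]
  · rw [indicator_of_notMem hp, indicator_of_notMem hp]

lemma measurable_indicator_offDiagonal :
    Measurable ((offDiagonal (Space d)).indicator fun p => g (p.1 - p.2)) := by
  rw [funext h.indicator_offDiagonal_eq]
  have h1 := h.measurable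
  have h2 := measurable_embedZero (d := d) (m := m)
  exact Measurable.indicator (by fun_prop) (measurableSet_offDiagonal d)

lemma indicator_offDiagonal_ae_eq {γ : Measure (Space d × Space d)}
    (hγ : ∀ᵐ p ∂γ, p.1 - p.2 ≠ 0) :
    (offDiagonal (Space d)).indicator (fun p => g (p.1 - p.2)) =ᵐ[γ]
      fun p => G (embedZero d m p.1 - embedZero d m p.2) := by
  filter_upwards [hγ] with p hp
  rw [h.indicator_offDiagonal_eq, indicator_of_mem]
  exact sub_ne_zero.1 hp

lemma even_restrict {x : Space d} (hx : x ≠ 0) : g (-x) = g x := by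
  rw [← h.restrict _ hx, ← h.restrict _ (neg_ne_zero.2 hx), h.even _ (embedZero_ne_zero hx)]
  congr 1
  exact map_neg (embedIsometry d m) x

variable (hs : (max ((d : ℝ) - 2) 0 < s ∧ s < d) ∨ (d = 1 ∧ s = 0)) (hd : 1 ≤ d)
  {M : ℝ≥0∞} (hM : M ≠ ∞) {μ : Measure (Space d)} [IsProbabilityMeasure μ]
  (hμ : μ ≤ M • (volume : Measure (Space d)))
  (hlog : s = 0 → Integrable (fun y => Real.log (1 + ‖y‖)) μ)
include hs hd hM hμ hlog

omit h hs hM hlog in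
lemma measure_singleton_of_le (y : Space d) : μ {y} = 0 := by
  have := nontrivial_space hd
  exact Measure.absolutelyContinuous_of_le_smul hμ (measure_singleton y)

lemma integrable_sub_embedZero (a : ExtSpace d m) :
    Integrable (fun y => G (a - embedZero d m y)) μ := by
  obtain ⟨T, hT⟩ := h.exists_lintegral_embedZero_le hs hd hM hμ hlog
  have h1 := h.measurable
  have h2 := measurable_embedZero (d := d) (m := m)
  refine ⟨Measurable.aestronglyMeasurable (by fun_prop), ?_⟩
  rw [hasFiniteIntegral_iff_norm]
  exact (hT a).trans_lt ENNReal.ofReal_lt_top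

lemma integrable_sub (x : Space d) : Integrable (fun y => g (x - y)) μ := by
  refine (h.integrable_sub_embedZero hs hd hM hμ hlog (embedZero d m x)).congr ?_
  filter_upwards [compl_mem_ae_iff.2 (measure_singleton_of_le hd hμ x)] with y hy
  rw [← embedZero_sub, h.restrict _ (sub_ne_zero.2 (Ne.symm hy))]

lemma integral_dirac_prod (x : Space d) :
    Integrable ((offDiagonal (Space d)).indicator fun p => g (p.1 - p.2))
      ((Measure.dirac x).prod μ) ∧
    ∫ p, (offDiagonal (Space d)).indicator (fun p => g (p.1 - p.2)) p ∂((Measure.dirac x).prod μ) =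
      ∫ y, g (x - y) ∂μ := by
  have hm := h.measurable_indicator_offDiagonal.stronglyMeasurable.aestronglyMeasurable
    (μ := μ.map (Prod.mk x))
  have he : (fun y => (offDiagonal (Space d)).indicator (fun p => g (p.1 - p.2)) (x, y)) =ᵐ[μ]
      fun y => g (x - y) := by
    filter_upwards [compl_mem_ae_iff.2 (measure_singleton_of_le hd hμ x)] with y hy
    rw [indicator_of_mem]
    exact Ne.symm hy
  rw [Measure.dirac_prod]
  constructor
  · rw [integrable_map_measure hm (by fun_prop)]
    exact (h.integrable_sub hs hd hM hμ hlog x).congr he.symm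
  · rw [integral_map (by fun_prop) hm]
    exact integral_congr_ae he

lemma integral_prod_dirac (x : Space d) :
    Integrable ((offDiagonal (Space d)).indicator fun p => g (p.1 - p.2))
      (μ.prod (Measure.dirac x)) ∧
    ∫ p, (offDiagonal (Space d)).indicator (fun p => g (p.1 - p.2)) p ∂(μ.prod (Measure.dirac x)) =
      ∫ y, g (x - y) ∂μ := by
  have hm := h.measurable_indicator_offDiagonal.stronglyMeasurable.aestronglyMeasurable
    (μ := μ.map fun y => (y, x))
  have he : (fun y => (offDiagonal (Space d)).indicator (fun p => g (p.1 - p.2)) (y, x)) =ᵐ[μ]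
      fun y => g (x - y) := by
    filter_upwards [compl_mem_ae_iff.2 (measure_singleton_of_le hd hμ x)] with y hy
    rw [indicator_of_mem, ← h.even_restrict (sub_ne_zero.2 hy), neg_sub]
    exact hy
  rw [Measure.prod_dirac]
  constructor
  · rw [integrable_map_measure hm (by fun_prop)]
    exact (h.integrable_sub hs hd hM hμ hlog x).congr he.symm
  · rw [integral_map (by fun_prop) hm]
    exact integral_congr_ae he

omit h hs hd hM hμ in
lemma integrable_log_map_embedZero :
    s = 0 → Integrable (fun a => Real.log (1 + ‖a‖)) (μ.map (embedZero d m)) := by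
  intro hs0
  rw [integrable_map_measure (Measurable.aestronglyMeasurable (by fun_prop))
    measurable_embedZero.aemeasurable]
  refine (hlog hs0).congr (Eventually.of_forall fun y => ?_)
  simp only [Function.comp, norm_embedZero]

lemma integral_prod_density :
    Integrable ((offDiagonal (Space d)).indicator fun p => g (p.1 - p.2)) (μ.prod μ) ∧
    ∫ p, (offDiagonal (Space d)).indicator (fun p => g (p.1 - p.2)) p ∂(μ.prod μ) =
      ∫ q, G (q.1 - q.2) ∂((μ.map (embedZero d m)).prod (μ.map (embedZero d m))) := by
  have hme := measurable_embedZero (d := d) (m := m)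
  have := Measure.isProbabilityMeasure_map (μ := μ) hme.aemeasurable
  have h1 := h.integrable_prod_map_embedZero hs hd hM hμ hlog (μ.map (embedZero d m))
    (integrable_log_map_embedZero hlog)
  have hGm := h.measurable
  have hm : StronglyMeasurable fun q : ExtSpace d m × ExtSpace d m => G (q.1 - q.2) :=
    Measurable.stronglyMeasurable (by fun_prop)
  have he := h.indicator_offDiagonal_ae_eq
    (ae_prod_sub_ne_zero μ μ (measure_singleton_of_le hd hμ))
  rw [Measure.map_prod_map _ _ hme hme] at h1 ⊢
  rw [integrable_map_measure hm.aestronglyMeasurable (by fun_prop)] at h1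
  rw [integral_map (by fun_prop) hm.aestronglyMeasurable]
  exact ⟨h1.congr he.symm, integral_congr_ae he⟩

/-- The modulated energy as a sum of pair interactions. -/
lemma modulatedEnergy_eq {N : ℕ} (hN : 0 < N) (x : Fin N → Space d) :
    OffDiagonalIntegrable g (empiricalMeasure x) μ ∧
    modulatedEnergy g x μ = 1 / (N : ℝ) ^ 2 *
        (∑ i, ∑ j, (offDiagonal (Space d)).indicator (fun p => g (p.1 - p.2)) (x i, x j)) +
      (∫ q, G (q.1 - q.2) ∂((μ.map (embedZero d m)).prod (μ.map (embedZero d m)))) -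
      2 / (N : ℝ) * ∑ i, ∫ y, g (x i - y) ∂μ := by
  set f := (offDiagonal (Space d)).indicator fun p => g (p.1 - p.2) with hf
  have hS := measurableSet_offDiagonal d
  have hprob : IsProbabilityMeasure (empiricalMeasure x) :=
    isProbabilityMeasure_averageMeasure hN _
  have hdd : ∀ i j, Integrable f ((Measure.dirac (x i)).prod (Measure.dirac (x j))) := by
    intro i j
    rw [Measure.dirac_prod_dirac]
    exact integrable_dirac enorm_lt_top
  have e1 : (empiricalMeasure x).prod (empiricalMeasure x) = averageMeasure fun i =>
      averageMeasure fun j => (Measure.dirac (x i)).prod (Measure.dirac (x j)) := by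
    unfold empiricalMeasure
    have := isProbabilityMeasure_averageMeasure hN fun j => Measure.dirac (x j)
    rw [averageMeasure_prod]
    congr 1
    funext i
    rw [prod_averageMeasure]
  have e2 : (empiricalMeasure x).prod μ = averageMeasure fun i => (Measure.dirac (x i)).prod μ :=
    averageMeasure_prod _ _
  have e3 : μ.prod (empiricalMeasure x) = averageMeasure fun i => μ.prod (Measure.dirac (x i)) :=
    prod_averageMeasure _ _
  have hl := fun i => h.integral_dirac_prod hs hd hM hμ hlog (x i)
  have hr := fun i => h.integral_prod_dirac hs hd hM hμ hlog (x i)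
  obtain ⟨hi4, hv4⟩ := h.integral_prod_density hs hd hM hμ hlog
  have hi1 : Integrable f ((empiricalMeasure x).prod (empiricalMeasure x)) := by
    rw [e1]
    exact integrable_averageMeasure hN fun i => integrable_averageMeasure hN fun j => hdd i j
  have hi2 : Integrable f ((empiricalMeasure x).prod μ) := by
    rw [e2]; exact integrable_averageMeasure hN fun i => (hl i).1
  have hi3 : Integrable f (μ.prod (empiricalMeasure x)) := by
    rw [e3]; exact integrable_averageMeasure hN fun i => (hr i).1
  constructor
  · unfold OffDiagonalIntegrable
    rw [← integrable_indicator_iff hS, Measure.prod_add, Measure.add_prod, Measure.add_prod]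
    exact (hi1.add_measure hi3).add_measure (hi2.add_measure hi4)
  · unfold modulatedEnergy offDiagonalEnergy
    rw [← integral_indicator hS, ← integral_indicator hS, ← hf, integral_add_measure hi1 hi4,
      integral_add_measure hi2 hi3, hv4]
    have v1 : ∫ p, f p ∂((empiricalMeasure x).prod (empiricalMeasure x)) =
        1 / (N : ℝ) ^ 2 * ∑ i, ∑ j, f (x i, x j) := by
      rw [e1, integral_averageMeasure fun i => integrable_averageMeasure hN fun j => hdd i j]
      simp_rw [integral_averageMeasure fun j => hdd _ j, Measure.dirac_prod_dirac, integral_dirac]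
      rw [← Finset.mul_sum, ← mul_assoc]
      congr 1
      ring
    have v2 : ∫ p, f p ∂((empiricalMeasure x).prod μ) =
        1 / (N : ℝ) * ∑ i, ∫ y, g (x i - y) ∂μ := by
      rw [e2, integral_averageMeasure fun i => (hl i).1]
      simp_rw [fun i => (hl i).2]
    have v3 : ∫ p, f p ∂(μ.prod (empiricalMeasure x)) =
        1 / (N : ℝ) * ∑ i, ∫ y, g (x i - y) ∂μ := by
      rw [e3, integral_averageMeasure fun i => (hr i).1]
      simp_rw [fun i => (hr i).2]
    rw [v1, v2, v3]
    ring

end ExtAdmissible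

end EnergyDecomposition

/-! ### The energy of the smeared charges as a sum -/

section SmearedEnergy

variable {d m : ℕ} {s r₀ : ℝ} {A : ℕ → ℝ} {B C₁ C₂ c : ℝ} {g : Space d → ℝ} {G : ExtSpace d m → ℝ}

namespace ExtAdmissible

variable (h : ExtAdmissible d m s r₀ A B C₁ C₂ c g G)
  (hs : (max ((d : ℝ) - 2) 0 < s ∧ s < d) ∨ (d = 1 ∧ s = 0)) (hd : 1 ≤ d)
include h hs hd

lemma sphereMeasure_singleton_eq_zero (X : ExtSpace d m) {η : ℝ} (hη : 0 < η) (hη2 : 2 * η < r₀)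
    (Z : ExtSpace d m) : sphereMeasure X η {Z} = 0 := by
  have := nontrivial_extSpace (m := m) hd
  rw [sphereMeasure_eq_map, Measure.map_apply (by fun_prop) (measurableSet_singleton Z)]
  refine measure_mono_null (fun Y hY => ?_) (h.sphereMeasure_singleton hs hd hη hη2 (Z - X))
  have hY' : X + Y = Z := hY
  simp [← hY']

variable {M : ℝ≥0∞} (hM : M ≠ ∞) {μ : Measure (Space d)} [IsProbabilityMeasure μ]
  (hμ : μ ≤ M • (volume : Measure (Space d)))
  (hlog : s = 0 → Integrable (fun y => Real.log (1 + ‖y‖)) μ)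
include hM hμ hlog

lemma integrable_sphere_prod (x : Space d) {η : ℝ} (hη : 0 < η) :
    Integrable (fun q : ExtSpace d m × ExtSpace d m => G (q.1 - q.2))
      ((sphereMeasure (embedZero d m x) η).prod (μ.map (embedZero d m))) := by
  have := nontrivial_extSpace (m := m) hd
  refine h.integrable_prod_map_embedZero hs hd hM hμ hlog _ fun _ => ?_
  rw [sphereMeasure_eq_map, integrable_map_measure (Measurable.aestronglyMeasurable (by fun_prop))
    (by fun_prop)]
  refine Integrable.of_bound (C := Real.log (1 + (‖embedZero d m x‖ + η)))
    (Measurable.aestronglyMeasurable (by fun_prop)) ?_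
  filter_upwards [ae_norm_sphereMeasure hη.le] with Y hY
  simp only [Function.comp]
  rw [Real.norm_of_nonneg (Real.log_nonneg (by linarith [norm_nonneg (embedZero d m x + Y)]))]
  refine Real.log_le_log (by positivity) ?_
  have := norm_add_le (embedZero d m x) Y
  linarith

lemma integral_sphere_prod (x : Space d) {η : ℝ} (hη : 0 < η) :
    Integrable (fun y => smeared G η (embedZero d m (x - y))) μ ∧
    ∫ q, G (q.1 - q.2) ∂((sphereMeasure (embedZero d m x) η).prod (μ.map (embedZero d m))) =
      ∫ y, smeared G η (embedZero d m (x - y)) ∂μ := by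
  have := nontrivial_extSpace (m := m) hd
  have hme := measurable_embedZero (d := d) (m := m)
  have := Measure.isProbabilityMeasure_map (μ := μ) hme.aemeasurable
  have hI := h.integrable_sphere_prod hs hd hM hμ hlog x hη
  have hGm := h.measurable
  have e1 : ∀ b : ExtSpace d m, ∫ a, G (a - b) ∂sphereMeasure (embedZero d m x) η =
      smeared G η (embedZero d m x - b) := by
    intro b
    rw [sphereMeasure_eq_map, integral_map (by fun_prop)
      (Measurable.aestronglyMeasurable (by fun_prop)), smeared_eq_integral_add hd]
    refine integral_congr_ae (Eventually.of_forall fun Y => ?_)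
    simp only
    congr 1
    abel
  have h1 := hI.integral_prod_right
  simp only [e1] at h1
  constructor
  · have h2 := (integrable_map_measure h1.aestronglyMeasurable hme.aemeasurable).1 h1
    refine h2.congr (Eventually.of_forall fun y => ?_)
    simp only [Function.comp, embedZero_sub]
  · rw [integral_prod_symm _ hI]
    simp only [e1]
    rw [integral_map hme.aemeasurable h1.aestronglyMeasurable]
    simp only [embedZero_sub]

/-- Coercivity of the energy of the smeared charges. -/
lemma sobolevNormSq_le_smeared_energy {N : ℕ} (hN : 0 < N) (x : Fin N → Space d) (η : Fin N → ℝ)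
    (hη : ∀ i, 0 < η i) (hη2 : ∀ i, 2 * η i < r₀) :
    0 ≤ 1 / (N : ℝ) ^ 2 * (∑ i, ∑ j, ∫ q, G (q.1 - q.2)
        ∂((sphereMeasure (embedZero d m (x i)) (η i)).prod
          (sphereMeasure (embedZero d m (x j)) (η j)))) +
      (∫ q, G (q.1 - q.2) ∂((μ.map (embedZero d m)).prod (μ.map (embedZero d m)))) -
      2 / (N : ℝ) * ∑ i, ∫ y, smeared G (η i) (embedZero d m (x i - y)) ∂μ ∧
    ENNReal.ofReal C₁ * sobolevNormSq ((s - d - m) / 2)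
        (averageMeasure fun i => sphereMeasure (embedZero d m (x i)) (η i)) (μ.map (embedZero d m)) ≤
      ENNReal.ofReal (1 / (N : ℝ) ^ 2 * (∑ i, ∑ j, ∫ q, G (q.1 - q.2)
        ∂((sphereMeasure (embedZero d m (x i)) (η i)).prod
          (sphereMeasure (embedZero d m (x j)) (η j)))) +
      (∫ q, G (q.1 - q.2) ∂((μ.map (embedZero d m)).prod (μ.map (embedZero d m)))) -
      2 / (N : ℝ) * ∑ i, ∫ y, smeared G (η i) (embedZero d m (x i - y)) ∂μ) := by
  have := nontrivial_extSpace (m := m) hd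
  have hme := measurable_embedZero (d := d) (m := m)
  have := Measure.isProbabilityMeasure_map (μ := μ) hme.aemeasurable
  set ν : Fin N → Measure (ExtSpace d m) := fun i => sphereMeasure (embedZero d m (x i)) (η i)
    with hν
  have hνp : ∀ i, IsProbabilityMeasure (ν i) := fun i => by rw [hν]; infer_instance
  set β := μ.map (embedZero d m) with hβ
  have hα : IsProbabilityMeasure (averageMeasure ν) := isProbabilityMeasure_averageMeasure hN ν
  have hβ0 : ∀ Z, β {Z} = 0 := map_embedZero_singleton hd (Measure.absolutelyContinuous_of_le_smul hμ)
  have hα0 : ∀ Z, averageMeasure ν {Z} = 0 := by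
    intro Z
    rw [averageMeasure, Measure.smul_apply, Measure.finsetSum_apply]
    simp only [hν, h.sphereMeasure_singleton_eq_zero hs hd _ (hη _) (hη2 _), Finset.sum_const_zero,
      smul_zero]
  have e1 : (averageMeasure ν).prod (averageMeasure ν) = averageMeasure fun i =>
      averageMeasure fun j => (ν i).prod (ν j) := by
    rw [averageMeasure_prod]
    congr 1
    funext i
    rw [prod_averageMeasure]
  have hij : ∀ i j, Integrable (fun q : ExtSpace d m × ExtSpace d m => G (q.1 - q.2))
      ((ν i).prod (ν j)) := fun i j =>
    h.integrable_prod_sphereMeasure hs hd _ _ (hη i) (hη2 i) (hη j)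
  have e2 : (averageMeasure ν).prod β = averageMeasure fun i => (ν i).prod β :=
    averageMeasure_prod _ _
  have hiβ : ∀ i, Integrable (fun q : ExtSpace d m × ExtSpace d m => G (q.1 - q.2))
      ((ν i).prod β) := fun i => h.integrable_sphere_prod hs hd hM hμ hlog (x i) (hη i)
  have key := h.sobolevNormSq_le_energy hs hd (averageMeasure ν) β
    (ae_prod_sub_ne_zero _ _ hα0) (ae_prod_sub_ne_zero _ _ hβ0) (ae_prod_sub_ne_zero _ _ hβ0)
    (by rw [e1]; exact integrable_averageMeasure hN fun i => integrable_averageMeasure hN (hij i))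
    (by rw [e2]; exact integrable_averageMeasure hN hiβ)
    (h.integrable_prod_map_embedZero hs hd hM hμ hlog β (integrable_log_map_embedZero hlog))
  have v1 : ∫ q, G (q.1 - q.2) ∂((averageMeasure ν).prod (averageMeasure ν)) =
      1 / (N : ℝ) ^ 2 * ∑ i, ∑ j, ∫ q, G (q.1 - q.2) ∂((ν i).prod (ν j)) := by
    rw [e1, integral_averageMeasure fun i => integrable_averageMeasure hN (hij i)]
    simp_rw [integral_averageMeasure (hij _)]
    rw [← Finset.mul_sum, ← mul_assoc]
    congr 1
    ring
  have v2 : ∫ q, G (q.1 - q.2) ∂((averageMeasure ν).prod β) =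
      1 / (N : ℝ) * ∑ i, ∫ y, smeared G (η i) (embedZero d m (x i - y)) ∂μ := by
    rw [e2, integral_averageMeasure hiβ]
    simp_rw [hν, hβ, fun i => (h.integral_sphere_prod hs hd hM hμ hlog (x i) (hη i)).2]
  rw [v1, v2, ← mul_assoc, mul_one_div] at key
  exact key

end ExtAdmissible

end SmearedEnergy
end SmearedCharges

/-! ### Comparison of the two energies -/

theorem proposition2p2 (d m : ℕ) (s : ℝ) (hd : 1 ≤ d)
    (hs : (max ((d : ℝ) - 2) 0 < s ∧ s < d) ∨ (d = 1 ∧ s = 0))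
    (r₀ : ℝ) (A : ℕ → ℝ) (B C₁ C₂ c : ℝ) :
    ∃ C : ℝ, 0 < C ∧
      ∀ (g : Space d → ℝ) (G : ExtSpace d m → ℝ), ExtAdmissible d m s r₀ A B C₁ C₂ c g G →
      ∀ (N : ℕ), 0 < N →
      ∀ (x : Fin N → Space d), Function.Injective x →
      ∀ (μ : Measure (Space d)), IsProbabilityMeasure μ → μ ≪ volume → densitySup μ ≠ ∞ →
        (s = 0 → Integrable (fun y => Real.log (1 + ‖y‖)) μ) →
      ∀ (η : Fin N → ℝ), (∀ i, 0 < η i ∧ η i < min (1 / 2) (r₀ / 2)) →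
        OffDiagonalIntegrable g (empiricalMeasure x) μ ∧
        (∀ i X, Integrable (fun Y => G (X - Y)) (sphereMeasure (0 : ExtSpace d m) (η i))) ∧
        sobolevNormSq ((s - d - m) / 2)
          (averageMeasure fun i => sphereMeasure (embedZero d m (x i)) (η i)) (μ.map (embedZero d m)) ≠ ∞ ∧
        1 / (N : ℝ) ^ 2 * (∑ i, ∑ j, if i ≠ j ∧ ‖x i - x j‖ ≤ r₀ / 2 then
              max (g (x j - x i) - smeared G (η i) (embedZero d m (x j - x i))) 0 else 0)
            + C⁻¹ * (sobolevNormSq ((s - d - m) / 2)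
                (averageMeasure fun i => sphereMeasure (embedZero d m (x i)) (η i))
                (μ.map (embedZero d m))).toReal
          ≤ modulatedEnergy g x μ + 1 / (N : ℝ) ^ 2 * ∑ i, smeared G (η i) 0
            + C / N * ∑ i, ((densitySup μ).toReal *
                (η i ^ ((d : ℝ) - s) + if s = 0 then η i ^ d * |Real.log (η i)| else 0)
                + η i ^ 2) := by
  obtain ⟨K₁, hK₁0, hK₁⟩ := exists_integral_sub_smeared_le hs hd r₀ A c
  obtain ⟨K₂, hK₂0, hK₂⟩ := exists_pair_bound hs hd m r₀ A c
  -- C₁⁻¹ pays for coercivity, 2 K₁ for the two cross terms with μ, and 2 K₂ for ∑_{i,j} (η_i² +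
  -- η_j²) = 2N ∑ η_i². The absolute value and the 1 make C positive before C₁ is known to be so.
  set C := 1 + |C₁⁻¹| + 2 * K₁ + 2 * K₂ with hC
  have hC0 : 0 < C := by positivity
  refine ⟨C, hC0, ?_⟩
  intro g G h N hN x hx μ hμp hμac hμM hlog η hη
  have hη0 : ∀ i, 0 < η i := fun i => (hη i).1
  have hη1 : ∀ i, η i ≤ 1 := fun i => by
    have := (hη i).2.le.trans (min_le_left _ _); linarith
  have hη2 : ∀ i, 2 * η i < r₀ := fun i => by
    have := (hη i).2.trans_le (min_le_right _ _); linarith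
  have hμ := le_densitySup_smul μ hμac
  have hNpos : (0 : ℝ) < N := by exact_mod_cast hN
  obtain ⟨hF1, hF2⟩ := h.modulatedEnergy_eq hs hd hμM hμ hlog hN x
  obtain ⟨hE0, hE⟩ := h.sobolevNormSq_le_smeared_energy hs hd hμM hμ hlog hN x η hη0 hη2
  set S := sobolevNormSq ((s - d - m) / 2)
    (averageMeasure fun i => sphereMeasure (embedZero d m (x i)) (η i)) (μ.map (embedZero d m))
    with hS
  set J := ∫ q, G (q.1 - q.2) ∂((μ.map (embedZero d m)).prod (μ.map (embedZero d m))) with hJ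
  set Q : Fin N → Fin N → ℝ := fun i j => ∫ q, G (q.1 - q.2)
    ∂((sphereMeasure (embedZero d m (x i)) (η i)).prod
      (sphereMeasure (embedZero d m (x j)) (η j))) with hQ
  set f : Fin N → Fin N → ℝ := fun i j =>
    (offDiagonal (Space d)).indicator (fun p => g (p.1 - p.2)) (x i, x j) with hf
  have hSfin : S ≠ ∞ := by
    intro htop
    rw [htop, ENNReal.mul_top (ENNReal.ofReal_pos.2 h.C₁_pos).ne', top_le_iff] at hE
    exact ENNReal.ofReal_ne_top hE
  refine ⟨hF1, fun i X => h.integrable_sphere hs hd (hη0 i) (hη2 i) X, hSfin, ?_⟩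
  have hSE : C⁻¹ * S.toReal ≤ 1 / (N : ℝ) ^ 2 * (∑ i, ∑ j, Q i j) + J -
      2 / (N : ℝ) * ∑ i, ∫ y, smeared G (η i) (embedZero d m (x i - y)) ∂μ := by
    have h1 := ENNReal.toReal_mono ENNReal.ofReal_ne_top hE
    rw [ENNReal.toReal_mul, ENNReal.toReal_ofReal h.C₁_pos.le, ENNReal.toReal_ofReal hE0] at h1
    refine le_trans (mul_le_mul_of_nonneg_right ?_ ENNReal.toReal_nonneg) h1
    rw [inv_le_comm₀ hC0 h.C₁_pos]
    linarith [le_abs_self C₁⁻¹]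
  have hpair : ∀ i j, (if i ≠ j ∧ ‖x i - x j‖ ≤ r₀ / 2 then
      max (g (x j - x i) - smeared G (η i) (embedZero d m (x j - x i))) 0 else 0) ≤
      f j i - Q j i + (if i = j then smeared G (η i) 0 else 0) + K₂ * (η j ^ 2 + η i ^ 2) := by
    intro i j
    have hsq : 0 ≤ K₂ * (η j ^ 2 + η i ^ 2) := by positivity
    by_cases hij : i = j
    · subst hij
      have h1 : f i i = 0 := Set.indicator_of_notMem (s := offDiagonal (Space d))
        (a := (x i, x i)) (fun h0 => (show x i ≠ x i from h0) rfl) _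
      -- On the diagonal there is no point interaction, and the self-energy of a sphere is at most
      -- G_{η_i}(0).
      have h2 := h.integral_prod_le_smeared hs hd (embedZero d m (x i)) (embedZero d m (x i))
        (hη0 i) (hη2 i) (hη0 i) (hη2 i) (by rw [sub_self, norm_zero]; linarith [hη2 i])
      rw [sub_self] at h2
      rw [h1, if_neg (fun h0 => h0.1 rfl), if_pos rfl]
      simp only [hQ]
      linarith
    · have hxij : x j ≠ x i := fun h0 => hij (hx h0.symm)
      -- The pair is taken in the order (j, i), so that the radius kept in the smeared potential is
      -- η_i.
      have h1 := hK₂ h (η j) (η i) (hη0 j) (hη2 j) (hη0 i) (hη2 i) (x j) (x i) hxij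
      have h2 : f j i = g (x j - x i) := Set.indicator_of_mem (s := offDiagonal (Space d))
        (a := (x j, x i)) hxij _
      simp only [ne_eq, hij, not_false_eq_true, true_and, if_false, add_zero]
      rw [h2]
      exact h1
  have hsum : (∑ i, ∑ j, if i ≠ j ∧ ‖x i - x j‖ ≤ r₀ / 2 then
      max (g (x j - x i) - smeared G (η i) (embedZero d m (x j - x i))) 0 else 0) ≤
      (∑ i, ∑ j, f i j) - (∑ i, ∑ j, Q i j) + (∑ i, smeared G (η i) 0) +
        2 * N * K₂ * ∑ i, η i ^ 2 := by
    refine (Finset.sum_le_sum fun i _ => Finset.sum_le_sum fun j _ => hpair i j).trans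
      (le_of_eq ?_)
    simp only [Finset.sum_add_distrib, Finset.sum_sub_distrib, Finset.sum_ite_eq, Finset.mem_univ,
      if_true, ← Finset.mul_sum, Finset.sum_const, Finset.card_univ, Fintype.card_fin,
      nsmul_eq_mul]
    rw [Finset.sum_comm (f := fun i j => f j i), Finset.sum_comm (f := fun i j => Q j i)]
    ring
  have herr : ∀ i, (∫ y, g (x i - y) ∂μ) -
      ∫ y, smeared G (η i) (embedZero d m (x i - y)) ∂μ ≤ K₁ * ((densitySup μ).toReal *
        (η i ^ ((d : ℝ) - s) + if s = 0 then η i ^ d * |Real.log (η i)| else 0)) := by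
    intro i
    rw [← integral_sub (h.integrable_sub hs hd hμM hμ hlog (x i))
      (h.integral_sphere_prod hs hd hμM hμ hlog (x i) (hη0 i)).1]
    exact hK₁ h _ μ hμM hμ (η i) (hη0 i) (hη1 i) (hη2 i) (x i)
  set e : Fin N → ℝ := fun i => (densitySup μ).toReal *
        (η i ^ ((d : ℝ) - s) + if s = 0 then η i ^ d * |Real.log (η i)| else 0) with he
  have he0 : ∀ i, 0 ≤ e i := by
    intro i
    have h1 := (hη0 i).le
    refine mul_nonneg ENNReal.toReal_nonneg (add_nonneg (by positivity) ?_)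
    split_ifs <;> positivity
  have herr2 : 2 / (N : ℝ) * ((∑ i, ∫ y, g (x i - y) ∂μ) -
      ∑ i, ∫ y, smeared G (η i) (embedZero d m (x i - y)) ∂μ) ≤
      2 / (N : ℝ) * (K₁ * ∑ i, e i) := by
    refine mul_le_mul_of_nonneg_left ?_ (by positivity)
    rw [← Finset.sum_sub_distrib, Finset.mul_sum]
    exact Finset.sum_le_sum fun i _ => herr i
  have hsum2 := mul_le_mul_of_nonneg_left hsum (show 0 ≤ 1 / (N : ℝ) ^ 2 by positivity)
  have hfin : 2 / (N : ℝ) * (K₁ * ∑ i, e i) + 1 / (N : ℝ) ^ 2 * (2 * N * K₂ * ∑ i, η i ^ 2) ≤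
      C / N * ∑ i, (e i + η i ^ 2) := by
    have s1 : 0 ≤ ∑ i, e i := Finset.sum_nonneg fun i _ => he0 i
    have s2 : 0 ≤ ∑ i, η i ^ 2 := Finset.sum_nonneg fun i _ => by positivity
    have e1 : 2 / (N : ℝ) * (K₁ * ∑ i, e i) + 1 / (N : ℝ) ^ 2 * (2 * N * K₂ * ∑ i, η i ^ 2) =
        (2 * K₁ * (∑ i, e i) + 2 * K₂ * ∑ i, η i ^ 2) / N := by
      field_simp
    have c1 : 2 * K₁ ≤ C := by rw [hC]; linarith [abs_nonneg C₁⁻¹]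
    have c2 : 2 * K₂ ≤ C := by rw [hC]; linarith [abs_nonneg C₁⁻¹]
    rw [e1, Finset.sum_add_distrib, div_mul_eq_mul_div, mul_add]
    gcongr
  have hsum3 := hsum2.trans_eq (b := 1 / (N : ℝ) ^ 2 * ((∑ i, ∑ j, f i j) - (∑ i, ∑ j, Q i j) +
    (∑ i, smeared G (η i) 0) + 2 * N * K₂ * ∑ i, η i ^ 2)) (c := 1 / (N : ℝ) ^ 2 *
    (∑ i, ∑ j, f i j) - 1 / (N : ℝ) ^ 2 * (∑ i, ∑ j, Q i j) + 1 / (N : ℝ) ^ 2 *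
    (∑ i, smeared G (η i) 0) + 1 / (N : ℝ) ^ 2 * (2 * N * K₂ * ∑ i, η i ^ 2)) (by ring)
  rw [mul_sub] at herr2
  -- The self-interaction J of μ occurs in F_N and in the smeared energy alike, and cancels on
  -- adding the bounds.
  rw [hF2]
  change _ ≤ _ + C / N * ∑ i, (e i + η i ^ 2)
  linarith
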